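/- Fix a finite relational schema $\mathcal S$ whose relation names have positive arity and whose attributes are typed by one of two infinite domains: the rationals $\mathbb Q$ or a set $D$ of uninterpreted constants (identified with their names). Let $\mathcal L$ be the (two-sorted) first-order language built from $\mathcal S$, the constants of both domains, the built-in symbols $=,\neq$ on $D$ and the built-in symbols $=,\neq,<,\le,>,\ge$ with their natural interpretation on $\mathbb Q$. An instance is a finite set of facts $R(t)$. A universal constraint is an $\mathcal L$-sentence of the form $$\forall \bar x.\ \neg\bigl[R_1(\bar x_1)\wedge\dots\wedge R_n(\bar x_n)\wedge\neg P_1(\bar y_1)\wedge\dots\wedge\neg P_m(\bar y_m)\wedge\varphi(\bar x)\bigr],\qquad n+m>0,$$ where the $\bar x_i,\bar y_j$ are tuples of variables, $\varphi$ is a quantifier-free formula using built-in symbols only, and $\bar y_1\cup\dots\cup\bar y_m\subseteq\bar x_1\cup\dots\cup\bar x_n=\bar x$. For a finite set $F$ of universal constraints, an instance $I'$ is a repair of an instance $I$ w.r.t. $F$ if $I'$ satisfies $F$ and there is no instance $J\neq I'$ satisfying $F$ with $\Delta(I,J)\subseteq\Delta(I,I')$, where $\Delta$ denotes symmetric difference.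 For a closed $\mathcal L$-formula $Q$, true is the consistent answer to $Q$ in $I$ w.r.t. $F$ if $Q$ holds in every repair of $I$ w.r.t. $F$. Lemma. For every finite set $F$ of universal constraints and every closed query $Q$ (both, like the schema, fixed; that is, in data complexity, with instances given as strings listing their facts, with rationals written as reduced fractions in binary): (i) repair checking, i.e. the decision problem $\mathcal B_F=\{(I,I') : I'\text{ is a repair of } I \text{ w.r.t. } F\}$, is in coNP: its complement is solvable in polynomial time by a nondeterministic Turing machine; (ii) consistent query answering, i.e. the decision problem $\mathcal D_{F,Q}=\{I : \text{true is the consistent answer to } Q \text{ in } I \text{ w.r.t. } F\}$, is in $\Pi^p_2$: its complement is solvable in polynomial time by a nondeterministic Turing machine with an NP oracle. -/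

import Mathlib

namespace CQA

/-! ### Two-sorted first-order language over a database schema -/

/-- The two types of attributes (and of variables). -/
inductive Srt where
  | rat
  | name
  deriving DecidableEq

/-- The domain of each type: the rationals `ℚ`, and the infinite set `D` of uninterpreted
constants. An uninterpreted constant is identified with its name, a finite binary word. -/
def Dom : Srt → Type
  | .rat => ℚ
  | .name => List Bool

/-- A (finite) schema: relation names of positive arity with typed attributes. The attributes of
`R` are identified with the positions `0, …, arity R - 1`. -/
structure Schema where
  Rel : Type
  finite_rel : Finite Rel
  arity : Rel → ℕ
  arity_pos : ∀ R, 0 < arity R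
  sort : (R : Rel) → Fin (arity R) → Srt

/-- Typed variables. -/
structure Var where
  sort : Srt
  idx : ℕ
  deriving DecidableEq

/-- A valuation maps every variable to a constant of its type. -/
abbrev Valuation : Type := (x : Var) → Dom x.sort

/-- Terms of type `s`: variables of type `s` and constants of type `s`. -/
inductive Term (s : Srt) where
  | var (i : ℕ) : Term s
  | const (a : Dom s) : Term s

def Term.eval {s : Srt} (v : Valuation) : Term s → Dom s
  | .var i => v ⟨s, i⟩
  | .const a => a

def Term.vars {s : Srt} : Term s → Set Var
  | .var i => {⟨s, i⟩}
  | .const _ => ∅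

/-- Built-in atoms: `=` on both types, `<` and `≤` on the rationals. (The symbols `≠`, `>`, `≥` are
obtained by negating an equality and by exchanging the two arguments.) -/
inductive BuiltIn where
  | eq {s : Srt} (t u : Term s) : BuiltIn
  | lt (t u : Term .rat) : BuiltIn
  | le (t u : Term .rat) : BuiltIn

def BuiltIn.Sat (v : Valuation) : BuiltIn → Prop
  | .eq t u => t.eval v = u.eval v
  | .lt t u => (show ℚ from t.eval v) < (show ℚ from u.eval v)
  | .le t u => (show ℚ from t.eval v) ≤ (show ℚ from u.eval v)

def BuiltIn.vars : BuiltIn → Set Var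
  | .eq t u => t.vars ∪ u.vars
  | .lt t u => t.vars ∪ u.vars
  | .le t u => t.vars ∪ u.vars

/-- First-order formulas over the schema `S` and the built-in relation symbols. -/
inductive Formula (S : Schema) where
  | rel (R : S.Rel) (ts : (i : Fin (S.arity R)) → Term (S.sort R i)) : Formula S
  | builtIn (b : BuiltIn) : Formula S
  | not (φ : Formula S) : Formula S
  | and (φ ψ : Formula S) : Formula S
  | or (φ ψ : Formula S) : Formula S
  | all (x : Var) (φ : Formula S) : Formula S
  | ex (x : Var) (φ : Formula S) : Formula S

def Formula.freeVars {S : Schema} : Formula S → Set Var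
  | .rel _ ts => ⋃ i, (ts i).vars
  | .builtIn b => b.vars
  | .not φ => φ.freeVars
  | .and φ ψ => φ.freeVars ∪ ψ.freeVars
  | .or φ ψ => φ.freeVars ∪ ψ.freeVars
  | .all x φ => φ.freeVars \ {x}
  | .ex x φ => φ.freeVars \ {x}

def Formula.IsClosed {S : Schema} (φ : Formula S) : Prop := φ.freeVars = ∅

/-! ### Instances and satisfaction -/

/-- A fact `R(t)`. -/
structure Fact (S : Schema) where
  rel : S.Rel
  args : (i : Fin (S.arity rel)) → Dom (S.sort rel i)

/-- A database instance, viewed as the finite set of its facts. -/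
abbrev Instance (S : Schema) : Type := Finset (Fact S)

/-- Satisfaction of a formula under a valuation. Variables range over the full domains. -/
def Formula.Sat {S : Schema} (I : Instance S) : Valuation → Formula S → Prop
  | v, .rel R ts => (⟨R, fun i => (ts i).eval v⟩ : Fact S) ∈ I
  | v, .builtIn b => b.Sat v
  | v, .not φ => ¬ φ.Sat I v
  | v, .and φ ψ => φ.Sat I v ∧ ψ.Sat I v
  | v, .or φ ψ => φ.Sat I v ∨ ψ.Sat I v
  | v, .all x φ => ∀ a : Dom x.sort, φ.Sat I (Function.update v x a)
  | v, .ex x φ => ∃ a : Dom x.sort, φ.Sat I (Function.update v x a)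

/-- `I ⊨ Q` for a closed query `Q`: its answer in `I` is **true** (the valuation is immaterial for
closed formulas). -/
def Holds {S : Schema} (I : Instance S) (Q : Formula S) : Prop := ∀ v, Q.Sat I v

/-! ### Universal constraints -/

/-- A relational atom `R(x₁, …, xₖ)` whose arguments are variables of the right types. -/
structure VarAtom (S : Schema) where
  rel : S.Rel
  idx : Fin (S.arity rel) → ℕ

def VarAtom.vars {S : Schema} (A : VarAtom S) : Set Var :=
  Set.range fun i => (⟨S.sort A.rel i, A.idx i⟩ : Var)

/-- The fact obtained from a relational atom by a ground substitution. -/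
def VarAtom.ground {S : Schema} (A : VarAtom S) (v : Valuation) : Fact S :=
  ⟨A.rel, fun i => v ⟨S.sort A.rel i, A.idx i⟩⟩

/-- Quantifier-free formulas using built-in relation symbols only. -/
inductive Cond where
  | tt : Cond
  | atom (b : BuiltIn) : Cond
  | not (φ : Cond) : Cond
  | and (φ ψ : Cond) : Cond
  | or (φ ψ : Cond) : Cond

def Cond.Sat (v : Valuation) : Cond → Prop
  | .tt => True
  | .atom b => b.Sat v
  | .not φ => ¬ φ.Sat v
  | .and φ ψ => φ.Sat v ∧ ψ.Sat v
  | .or φ ψ => φ.Sat v ∨ ψ.Sat v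

def Cond.vars : Cond → Set Var
  | .tt => ∅
  | .atom b => b.vars
  | .not φ => φ.vars
  | .and φ ψ => φ.vars ∪ ψ.vars
  | .or φ ψ => φ.vars ∪ ψ.vars

/-- A universal constraint
`∀ x̄. ¬ [R₁(x̄₁) ∧ … ∧ Rₙ(x̄ₙ) ∧ ¬P₁(ȳ₁) ∧ … ∧ ¬Pₘ(ȳₘ) ∧ φ(x̄)]` with `n + m > 0` that is safe: every
variable in some `ȳⱼ` or in `φ` occurs in some `x̄ᵢ`. -/
structure UniversalConstraint (S : Schema) where
  pos : List (VarAtom S)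
  neg : List (VarAtom S)
  cond : Cond
  nonempty : 0 < pos.length + neg.length
  safe_neg : ∀ P ∈ neg, P.vars ⊆ ⋃ R ∈ pos, R.vars
  safe_cond : cond.vars ⊆ ⋃ R ∈ pos, R.vars

def UniversalConstraint.Holds {S : Schema} (c : UniversalConstraint S) (I : Instance S) : Prop :=
  ∀ v : Valuation,
    ¬ ((∀ R ∈ c.pos, R.ground v ∈ I) ∧ (∀ P ∈ c.neg, P.ground v ∉ I) ∧ c.cond.Sat v)

/-- `I` is consistent with `F`. -/
def Consistent {S : Schema} (F : Finset (UniversalConstraint S)) (I : Instance S) : Prop :=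
  ∀ c ∈ F, c.Holds I

/-! ### Repairs and consistent query answers -/

/-- The symmetric difference `Δ(I, J)`. -/
def diff {S : Schema} (I J : Instance S) : Set (Fact S) :=
  {f | (f ∈ I ∧ f ∉ J) ∨ (f ∈ J ∧ f ∉ I)}

/-- `J ≤_I J'`. -/
def ProxLE {S : Schema} (I J J' : Instance S) : Prop := diff I J ⊆ diff I J'

/-- `J <_I J'`. -/
def ProxLT {S : Schema} (I J J' : Instance S) : Prop := ProxLE I J J' ∧ J ≠ J'

/-- `I'` is a repair of `I` w.r.t. `F`: a `≤_I`-minimal instance consistent with `F`. -/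
def IsRepair {S : Schema} (F : Finset (UniversalConstraint S)) (I I' : Instance S) : Prop :=
  Consistent F I' ∧ ¬ ∃ J, Consistent F J ∧ ProxLT I J I'

/-- **true** is the consistent answer to `Q` in `I` w.r.t. `F`. -/
def ConsistentlyTrue {S : Schema} (F : Finset (UniversalConstraint S)) (Q : Formula S)
    (I : Instance S) : Prop :=
  ∀ I', IsRepair F I I' → Holds I' Q

/-- The problem `B_F` of repair checking. -/
def repairChecking {S : Schema} (F : Finset (UniversalConstraint S)) :
    Set (Instance S × Instance S) :=
  {p | IsRepair F p.1 p.2}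

/-- The problem `D_{F,Q}` of consistent query answering. -/
def consistentQueryAnswering {S : Schema} (F : Finset (UniversalConstraint S)) (Q : Formula S) :
    Set (Instance S) :=
  {I | ConsistentlyTrue F Q I}

/-! ### Encoding of instances as strings -/

/-- The finite alphabet in which instances over the fixed schema `S` are written. -/
inductive Sym (S : Schema) where
  | rel (R : S.Rel) : Sym S
  | bit (b : Bool) : Sym S
  | minus : Sym S
  | slash : Sym S
  | endMark : Sym S
  | sep : Sym S

def encodeBits (S : Schema) (w : List Bool) : List (Sym S) := w.map Sym.bit

/-- A rational is written as a reduced fraction in binary (least significant bit first), an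
uninterpreted constant by its name; both are followed by an end marker. -/
def encodeConst (S : Schema) : (s : Srt) → Dom s → List (Sym S)
  | .rat, a =>
      let q : ℚ := a
      (if q < 0 then [Sym.minus] else []) ++ encodeBits S q.num.natAbs.bits ++ [Sym.slash] ++
        encodeBits S q.den.bits ++ [Sym.endMark]
  | .name, a => encodeBits S a ++ [Sym.endMark]

def encodeFact {S : Schema} (f : Fact S) : List (Sym S) :=
  Sym.rel f.rel :: (List.ofFn fun i => encodeConst S (S.sort f.rel i) (f.args i)).flatten

def encodeFacts {S : Schema} (l : List (Fact S)) : List (Sym S) := (l.map encodeFact).flatten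

/-- The string `w` represents the instance `I`: it lists the facts of `I` (in any order). -/
def RepresentsInstance {S : Schema} (w : List (Sym S)) (I : Instance S) : Prop :=
  ∃ l : List (Fact S), (∀ f, f ∈ l ↔ f ∈ I) ∧ w = encodeFacts l

/-- The string `w` represents the pair `(I, I')`. -/
def RepresentsPair {S : Schema} (w : List (Sym S)) (p : Instance S × Instance S) : Prop :=
  ∃ w₁ w₂, RepresentsInstance w₁ p.1 ∧ RepresentsInstance w₂ p.2 ∧ w = w₁ ++ Sym.sep :: w₂

/-! ### Nondeterministic Turing machines, with and without oracle -/

/-- `b` is reached from `a` by exactly `n` steps of the relation `r`. -/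
def StepsTo {C : Type} (r : C → C → Prop) : ℕ → C → C → Prop
  | 0, a, b => a = b
  | n + 1, a, b => ∃ c, r a c ∧ StepsTo r n c b

/-- A nondeterministic multi-tape Turing machine with input alphabet `α`. A tape cell contains a
symbol of the finite alphabet `Γ` or is blank (`none`). In state `q` reading the symbols `h`, the
machine may execute any `(q', a) ∈ δ q h`: it enters state `q'` and, on every tape `k`, writes
`(a k).1` and then moves its head as told by `(a k).2` (`none`: the head stays). -/
structure NTM (α : Type) where
  K : Type
  decEq_K : DecidableEq K
  finite_K : Finite K
  Γ : Type
  finite_Γ : Finite Γ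
  Q : Type
  finite_Q : Finite Q
  inTape : K
  inSym : α → Γ
  inSym_injective : Function.Injective inSym
  start : Q
  accept : Q
  δ : Q → (K → Option Γ) → Set (Q × (K → Option Γ × Option Turing.Dir))

attribute [instance] NTM.decEq_K

structure NTM.Cfg {α : Type} (M : NTM α) where
  state : M.Q
  tapes : M.K → Turing.Tape (Option M.Γ)

/-- The initial configuration on input `w`: the input tape contains `w`, with the head on its first
symbol, and all other tapes are blank. -/
def NTM.init {α : Type} (M : NTM α) (w : List α) : M.Cfg where
  state := M.start
  tapes k := if k = M.inTape then Turing.Tape.mk₁ (w.map fun x => some (M.inSym x))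
    else Turing.Tape.mk₁ []

/-- Write a symbol, then move the head. -/
def act {Γ : Type} (T : Turing.Tape (Option Γ)) :
    Option Γ × Option Turing.Dir → Turing.Tape (Option Γ)
  | (x, none) => T.write x
  | (x, some d) => (T.write x).move d

def NTM.Step {α : Type} (M : NTM α) (c c' : M.Cfg) : Prop :=
  ∃ a, (c'.state, a) ∈ M.δ c.state (fun k => (c.tapes k).head) ∧
    c'.tapes = fun k => act (c.tapes k) (a k)

/-- `M` decides `L` in polynomial time: every computation on an input of length `n` has at most
`p(n)` steps, for some polynomial `p`, and `w ∈ L` iff some computation on `w` reaches the accepting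
state. -/
def NTM.DecidesInPolyTime {α : Type} (M : NTM α) (L : Set (List α)) : Prop :=
  (∃ p : Polynomial ℕ, ∀ w n c, StepsTo M.Step n (M.init w) c → n ≤ p.eval w.length) ∧
    ∀ w, w ∈ L ↔ ∃ n c, StepsTo M.Step n (M.init w) c ∧ c.state = M.accept

/-- The class NP of languages over the alphabet `α`. -/
def NP (α : Type) : Set (Set (List α)) := {L | ∃ M : NTM α, M.DecidesInPolyTime L}

/-- A nondeterministic Turing machine with an oracle for a language over the alphabet `β`. In the
state `query` it passes in one step to the state `yes` or `no`, depending on whether the word on the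
tape `oracleTape` (with the head on its first symbol) belongs to the oracle. -/
structure OracleNTM (α β : Type) extends NTM α where
  oracleTape : K
  oracleSym : β → Γ
  oracleSym_injective : Function.Injective oracleSym
  query : Q
  yes : Q
  no : Q

/-- The oracle `A` gives a positive answer in the configuration `c`. -/
def OracleNTM.Positive {α β : Type} (M : OracleNTM α β) (A : Set (List β)) (c : M.Cfg) : Prop :=
  ∃ u ∈ A, c.tapes M.oracleTape = Turing.Tape.mk₁ (u.map fun x => some (M.oracleSym x))

def OracleNTM.Step {α β : Type} (M : OracleNTM α β) (A : Set (List β)) (c c' : M.Cfg) : Prop :=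
  (c.state ≠ M.query ∧ M.toNTM.Step c c') ∨
  (c.state = M.query ∧ c'.tapes = c.tapes ∧
    ((M.Positive A c ∧ c'.state = M.yes) ∨ (¬ M.Positive A c ∧ c'.state = M.no)))

/-- `M` with oracle `A` decides `L` in polynomial time. -/
def OracleNTM.DecidesInPolyTime {α β : Type} (M : OracleNTM α β) (A : Set (List β))
    (L : Set (List α)) : Prop :=
  (∃ p : Polynomial ℕ, ∀ w n c, StepsTo (M.Step A) n (M.init w) c → n ≤ p.eval w.length) ∧
    ∀ w, w ∈ L ↔ ∃ n c, StepsTo (M.Step A) n (M.init w) c ∧ c.state = M.accept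

/-- The class of languages over `α` decided in polynomial time by nondeterministic Turing machines
with an oracle in NP. -/
def NPwithNPOracle (α : Type) : Set (Set (List α)) :=
  {L | ∃ (β : Type) (A : Set (List β)) (M : OracleNTM α β), A ∈ NP β ∧ M.DecidesInPolyTime A L}

/-! ### Complexity of decision problems -/

/-- The decision problem `P` on inputs of type `X`, written as strings according to `rep`, is solved
by the language `L`: for every input, the strings that represent it are in `L` iff the answer is
"yes". -/
def SolvedBy {α X : Type} (rep : List α → X → Prop) (P : Set X) (L : Set (List α)) : Prop :=
  ∀ w x, rep w x → (w ∈ L ↔ x ∈ P)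

/-- coNP: the complementary problem is in NP. -/
def InCoNP {α X : Type} (rep : List α → X → Prop) (P : Set X) : Prop :=
  ∃ L ∈ NP α, SolvedBy rep Pᶜ L

/-- `Π₂ᵖ`: the complementary problem is solvable in polynomial time by a nondeterministic Turing
machine with an NP oracle. -/
def InPiTwo {α X : Type} (rep : List α → X → Prop) (P : Set X) : Prop :=
  ∃ L ∈ NPwithNPOracle α, SolvedBy rep Pᶜ L

end CQA

open Turing

namespace CQA

/-! ### Program fragments over abstract tapes -/

/-! The combinatorial reason for both bounds is that every instance worth guessing uses only
constants of the input. If `Δ(I, J) ⊆ Δ(I, I')`, then `J ⊆ I ∪ I'` (`Over.of_proxLE`). If `I'` is a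
repair of `I`, then by safety of the constraints one may delete from `I'` the facts with constants
foreign to `I` without losing consistency, and the distance to `I` does not grow; so by minimality
nothing is deleted (`IsRepair.over`). Hence for (i) a machine guesses a competitor `J` over the
input, or notes that `I'` is inconsistent; for (ii) it guesses a repair falsifying `Q` and asks the
oracle about competitors.

To obtain actual Turing machines, all computation is confined to one generic program, which
evaluates a fixed first-order formula over a word with guessed relations on its positions
(`det_ev`). It yields the easy direction of Fagin's theorem and its analogue one level up: `∃ H, φ`
defines a language in NP (`mem_NP_of_fml`), and `∃ G, ∀ H, φ` one in NP with an NP oracle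
(`mem_NPwithNPOracle_of_fml`). What remains is to define the properties involved by formulas, over
words that list facts, followed by the constants of `F` and `Q`. An instance becomes a family of
relations on positions, a position standing for the constant written there.

Two matters are not evidently first-order. Comparing fractions requires products of binary numbers;
the bits and carries of all these products are guessed along with the instance and are pinned down
by a local recursion (`ArithRec.prod_carry`). Moreover, the quantifiers of `Q` range over infinite
domains. A value is therefore described by a place, consisting of a constant of the word and a
rational offset, places being ordered lexicographically. Values and places are matched by back and
forth between dense orders (`Agree.exists_value`, `Agree.exists_place`), and finitely many offsets
suffice for each quantifier, as only their order relative to the offsets in use matters. This gives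
the translation `transl`. Names are treated like rationals, through an arbitrary bijection `rank`.
-/

/-- A tape, seen from its head, which is at position `0`. -/
abbrev ATape (Γ : Type) := ℤ → Option Γ

def dirOff : Option Dir → ℤ
  | none => 0
  | some .left => -1
  | some .right => 1

/-- Positions are relative to the head, so a head move appears as a shift of the contents after
writing at `0`. -/
def aact {Γ : Type} (T : ATape Γ) (a : Option Γ × Option Dir) : ATape Γ :=
  fun i => Function.update T 0 a.1 (i + dirOff a.2)

theorem act_nth {Γ : Type} (T : Tape (Option Γ)) (a : Option Γ × Option Dir) :
    (act T a).nth = aact T.nth a := by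
  obtain ⟨x, d⟩ := a
  rcases d with _ | _ | _ <;> funext i <;>
    simp [act, aact, dirOff, Function.update_apply, sub_eq_add_neg]

/-- Allows equations between abstract tapes to be carried back to machine tapes, for steps and for
the oracle condition. -/
theorem Tape.nth_injective {Γ : Type} :
    Function.Injective (Tape.nth : Tape (Option Γ) → ℤ → Option Γ) := by
  intro T T' h
  obtain ⟨a, l, r⟩ := T
  obtain ⟨a', l', r'⟩ := T'
  have h0 : a = a' := congrFun h 0
  have hr : r = r' := ListBlank.ext fun i => congrFun h ((i + 1 : ℕ) : ℤ)
  have hl : l = l' := ListBlank.ext fun i => congrFun h (Int.negSucc i)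
  rw [h0, hr, hl]

/-- The tape with contents `f` and head at `p`. -/
def shift {Γ : Type} (f : ATape Γ) (p : ℤ) : ATape Γ := fun i => f (i + p)

@[simp] theorem shift_head {Γ : Type} (f : ATape Γ) (p : ℤ) : shift f p 0 = f p := by simp [shift]

theorem shift_zero {Γ : Type} (f : ATape Γ) : shift f 0 = f := by funext i; simp [shift]

theorem shift_shift {Γ : Type} (f : ATape Γ) (p q : ℤ) : shift (shift f p) q = shift f (p + q) := by
  funext i; simp only [shift]; congr 1; ring

theorem aact_shift {Γ : Type} (f : ATape Γ) (p : ℤ) (x : Option Γ) (d : Option Dir) :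
    aact (shift f p) (x, d) = shift (Function.update f p x) (p + dirOff d) := by
  funext i
  simp only [aact, shift, Function.update_apply]
  have h1 : i + dirOff d = 0 ↔ i + (p + dirOff d) = p := by constructor <;> intro h <;> linarith
  have h2 : i + dirOff d + p = i + (p + dirOff d) := by ring
  simp only [h1, h2]

theorem aact_same {Γ : Type} (T : ATape Γ) (d : Option Dir) :
    aact T (T 0, d) = shift T (dirOff d) := by
  funext i; simp [aact, shift]

/-! ### Nondeterministic programs: time bounds, reachable exits, composition -/

/-- A nondeterministic multi-tape program with exits labelled by `E`. -/
structure Frag (K Γ E : Type) where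
  Q : Type
  finite_Q : Finite Q
  start : Q
  δ : Q → (K → Option Γ) → Set ((Q ⊕ E) × (K → Option Γ × Option Dir))

namespace Frag

variable {K Γ E E' : Type}

abbrev Cfg (c : Frag K Γ E) : Type := (c.Q ⊕ E) × (K → ATape Γ)

def Step (c : Frag K Γ E) (s s' : c.Cfg) : Prop :=
  ∃ q, s.1 = .inl q ∧ ∃ a, (s'.1, a) ∈ c.δ q (fun k => s.2 k 0) ∧ s'.2 = fun k => aact (s.2 k) (a k)

/-- Every run from `s` has at most `t` steps. -/
def Bnd (c : Frag K Γ E) : ℕ → c.Cfg → Prop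
  | 0, s => ∀ s', ¬ c.Step s s'
  | t + 1, s => ∀ s', c.Step s s' → c.Bnd t s'

abbrev Reach (c : Frag K Γ E) : c.Cfg → c.Cfg → Prop := Relation.ReflTransGen c.Step

theorem Bnd.succ {c : Frag K Γ E} {t : ℕ} {s : c.Cfg} (h : c.Bnd t s) : c.Bnd (t + 1) s := by
  induction t generalizing s with
  | zero => intro s' hs; exact absurd hs (h s')
  | succ t ih => intro s' hs; exact ih (h s' hs)

theorem Bnd.mono {c : Frag K Γ E} {t t' : ℕ} {s : c.Cfg} (h : c.Bnd t s) (htt : t ≤ t') :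
    c.Bnd t' s := by
  induction htt with
  | refl => exact h
  | step _ ih => exact ih.succ

theorem not_step_exit (c : Frag K Γ E) (e : E) (B : K → ATape Γ) (s : c.Cfg) :
    ¬ c.Step (.inr e, B) s := by
  rintro ⟨q, h, -⟩
  cases h

/-- From `s` every run has at most `t` steps, and the reachable exits are those in `R`. -/
def SpecAt (c : Frag K Γ E) (s : c.Cfg) (t : ℕ) (R : E → (K → ATape Γ) → Prop) : Prop :=
  c.Bnd t s ∧ ∀ e B, c.Reach s (.inr e, B) ↔ R e B

def Spec (c : Frag K Γ E) (A : K → ATape Γ) (t : ℕ) (R : E → (K → ATape Γ) → Prop) : Prop :=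
  c.SpecAt (.inl c.start, A) t R

theorem SpecAt.mono {c : Frag K Γ E} {s : c.Cfg} {t t' : ℕ} {R R' : E → (K → ATape Γ) → Prop}
    (h : c.SpecAt s t R) (ht : t ≤ t') (hR : ∀ e B, R e B ↔ R' e B) : c.SpecAt s t' R' :=
  ⟨h.1.mono ht, fun e B => (h.2 e B).trans (hR e B)⟩

theorem Spec.mono {c : Frag K Γ E} {A : K → ATape Γ} {t t' : ℕ} {R R' : E → (K → ATape Γ) → Prop}
    (h : c.Spec A t R) (ht : t ≤ t') (hR : ∀ e B, R e B ↔ R' e B) : c.Spec A t' R' :=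
  SpecAt.mono h ht hR

theorem specAt_exit (c : Frag K Γ E) (e : E) (B : K → ATape Γ) :
    c.SpecAt (.inr e, B) 0 (fun e' B' => e' = e ∧ B' = B) := by
  refine ⟨fun s => not_step_exit c e B s, fun e' B' => ⟨fun h => ?_, ?_⟩⟩
  · rcases Relation.ReflTransGen.cases_head h with h | ⟨s, hs, -⟩
    · simp only [Prod.mk.injEq, Sum.inr.injEq] at h
      exact ⟨h.1.symm, h.2.symm⟩
    · exact absurd hs (not_step_exit c e B s)
  · rintro ⟨rfl, rfl⟩
    exact .refl

/-- `c` runs inside `c'`, with the exits of `c` redirected by `lift`. -/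
structure Embeds (c : Frag K Γ E) (c' : Frag K Γ E') (lift : c.Q ⊕ E → c'.Q ⊕ E') : Prop where
  inl : ∀ q, ∃ q', lift (.inl q) = .inl q' ∧
    ∀ h, c'.δ q' h = (fun p => (lift p.1, p.2)) '' c.δ q h

variable {c : Frag K Γ E} {c' : Frag K Γ E'} {lift : c.Q ⊕ E → c'.Q ⊕ E'}

theorem Embeds.step (hl : Embeds c c' lift) {s s' : c.Cfg} (h : c.Step s s') :
    c'.Step (lift s.1, s.2) (lift s'.1, s'.2) := by
  obtain ⟨q, hq, a, ha, hB⟩ := h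
  obtain ⟨q', hq', hδ⟩ := hl.inl q
  refine ⟨q', by rw [hq, hq'], a, ?_, hB⟩
  rw [hδ]
  exact ⟨_, ha, rfl⟩

theorem Embeds.step_inv (hl : Embeds c c' lift) {q : c.Q} {B : K → ATape Γ} {u : c'.Cfg}
    (h : c'.Step (lift (.inl q), B) u) : ∃ s', c.Step (.inl q, B) s' ∧ u = (lift s'.1, s'.2) := by
  obtain ⟨q₁, hq₁, a, ha, hB⟩ := h
  obtain ⟨q', hq', hδ⟩ := hl.inl q
  simp only [hq', Sum.inl.injEq] at hq₁
  subst hq₁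
  rw [hδ] at ha
  obtain ⟨⟨r, b⟩, hr, hrb⟩ := ha
  simp only [Prod.mk.injEq] at hrb
  obtain ⟨h1, rfl⟩ := hrb
  exact ⟨(r, _), ⟨q, rfl, b, hr, rfl⟩, Prod.ext h1.symm hB⟩

/-- The budget `t` pays for the steps mirrored in `c`, and `t'` for whatever follows an exit of `c`.
-/
theorem Embeds.bnd (hl : Embeds c c' lift) {t t' : ℕ} {s : c.Cfg} (h : c.Bnd t s)
    (hx : ∀ e B, c.Reach s (.inr e, B) → c'.Bnd t' (lift (.inr e), B)) :
    c'.Bnd (t + t') (lift s.1, s.2) := by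
  induction t generalizing s with
  | zero =>
    obtain ⟨q | e, B⟩ := s
    · rw [Nat.zero_add]
      refine Bnd.mono (t := 0) ?_ (Nat.zero_le _)
      intro u hu
      obtain ⟨s', hs', -⟩ := hl.step_inv hu
      exact h s' hs'
    · rw [Nat.zero_add]
      exact hx e B .refl
  | succ t ih =>
    obtain ⟨q | e, B⟩ := s
    · rw [Nat.add_right_comm]
      intro u hu
      obtain ⟨s', hs', rfl⟩ := hl.step_inv hu
      exact ih (h s' hs') fun e B hr => hx e B (.head hs' hr)
    · exact (hx e B .refl).mono (Nat.le_add_left _ _)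

theorem Embeds.reach (hl : Embeds c c' lift) {s s' : c.Cfg} (h : c.Reach s s') :
    c'.Reach (lift s.1, s.2) (lift s'.1, s'.2) := by
  induction h with
  | refl => exact .refl
  | tail _ h ih => exact ih.tail (hl.step h)

/-- A lifted state of `c` is never an exit of `c'`, so a run that ends in an exit must leave `c`
through one of its exits; the run is split there. -/
theorem Embeds.reach_inv (hl : Embeds c c' lift) {u u' : c'.Cfg} (h : c'.Reach u u') {e' : E'}
    {B' : K → ATape Γ} (hu' : u' = (.inr e', B')) {s : c.Cfg} (hs : u = (lift s.1, s.2)) :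
    ∃ e B, c.Reach s (.inr e, B) ∧ c'.Reach (lift (.inr e), B) (.inr e', B') := by
  subst hu'
  induction h using Relation.ReflTransGen.head_induction_on generalizing s with
  | refl =>
    obtain ⟨q | e, B⟩ := s
    · obtain ⟨q', hq', -⟩ := hl.inl q
      simp [hq'] at hs
    · exact ⟨e, B, .refl, by rw [hs]⟩
  | head h1 h2 ih =>
    obtain ⟨q | e, B⟩ := s
    · subst hs
      obtain ⟨s', hs', hu⟩ := hl.step_inv h1
      obtain ⟨e, B, h3, h4⟩ := ih hu
      exact ⟨e, B, .head hs' h3, h4⟩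
    · subst hs
      exact ⟨e, B, .refl, .head h1 h2⟩

/-- The common core of sequencing and looping, which differ only in where the exits of `c` are sent.
-/
theorem Embeds.spec (hl : Embeds c c' lift) {t t' : ℕ} {s : c.Cfg} {R : E → (K → ATape Γ) → Prop}
    {R' : E → (K → ATape Γ) → E' → (K → ATape Γ) → Prop} (h : c.SpecAt s t R)
    (h' : ∀ e B, R e B → c'.SpecAt (lift (.inr e), B) t' (R' e B)) :
    c'.SpecAt (lift s.1, s.2) (t + t') (fun e' B' => ∃ e B, R e B ∧ R' e B e' B') := by
  refine ⟨hl.bnd h.1 fun e B hr => (h' e B ((h.2 e B).1 hr)).1, fun e' B' => ⟨fun hr => ?_, ?_⟩⟩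
  · obtain ⟨e, B, h1, h2⟩ := hl.reach_inv hr rfl rfl
    have := (h.2 e B).1 h1
    exact ⟨e, B, this, ((h' e B this).2 e' B').1 h2⟩
  · rintro ⟨e, B, h1, h2⟩
    exact (hl.reach ((h.2 e B).2 h1)).trans (((h' e B h1).2 e' B').2 h2)

/-- A single step. -/
def prim (f : (K → Option Γ) → Set (E × (K → Option Γ × Option Dir))) : Frag K Γ E where
  Q := Unit
  finite_Q := inferInstance
  start := ()
  δ _ h := {p | ∃ e a, (e, a) ∈ f h ∧ p = (.inr e, a)}

theorem spec_prim (f : (K → Option Γ) → Set (E × (K → Option Γ × Option Dir))) (A : K → ATape Γ) :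
    (prim f).Spec A 1
      (fun e B => ∃ a, (e, a) ∈ f (fun k => A k 0) ∧ B = fun k => aact (A k) (a k)) := by
  have hstep : ∀ s', (prim f).Step (.inl (), A) s' ↔ ∃ e a, (e, a) ∈ f (fun k => A k 0) ∧
      s' = (.inr e, fun k => aact (A k) (a k)) := by
    rintro ⟨r, B⟩
    constructor
    · rintro ⟨q, -, a, ⟨e, a', h1, h2⟩, hB⟩
      have h3 : r = .inr e := congrArg Prod.fst h2
      have h4 : a = a' := congrArg Prod.snd h2
      subst h3 h4
      exact ⟨e, a, h1, Prod.ext rfl hB⟩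
    · rintro ⟨e, a, h1, h2⟩
      simp only [Prod.mk.injEq] at h2
      exact ⟨(), rfl, a, ⟨e, a, h1, Prod.ext h2.1 rfl⟩, h2.2⟩
  refine ⟨?_, fun e B => ⟨fun h => ?_, ?_⟩⟩
  · intro s' hs
    obtain ⟨e, a, -, rfl⟩ := (hstep s').1 hs
    exact fun s => not_step_exit _ e _ s
  · rcases Relation.ReflTransGen.cases_head h with h | ⟨s, hs, h⟩
    · simp at h
    · obtain ⟨e', a, h1, rfl⟩ := (hstep s).1 hs
      obtain ⟨rfl, rfl⟩ := ((specAt_exit _ e' _).2 e B).1 h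
      exact ⟨a, h1, rfl⟩
  · rintro ⟨a, h1, rfl⟩
    exact .single ((hstep _).2 ⟨e, a, h1, rfl⟩)

/-- Run `c`, then the continuation selected by its exit. -/
def bind [Finite E] (c : Frag K Γ E) (k : E → Frag K Γ E') : Frag K Γ E' where
  Q := c.Q ⊕ Σ e, (k e).Q
  finite_Q := by
    have := c.finite_Q
    have := fun e => (k e).finite_Q
    infer_instance
  start := .inl c.start
  δ
    | .inl q, h => (fun p => (Sum.elim (fun q => .inl (.inl q))
        (fun e => .inl (.inr ⟨e, (k e).start⟩)) p.1, p.2)) '' c.δ q h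
    | .inr ⟨e, q⟩, h => (fun p => (Sum.elim (fun q => .inl (.inr ⟨e, q⟩)) .inr p.1, p.2)) ''
        (k e).δ q h

theorem spec_bind [Finite E] {c : Frag K Γ E} {k : E → Frag K Γ E'} {A : K → ATape Γ} {t t' : ℕ}
    {R : E → (K → ATape Γ) → Prop} {R' : E → (K → ATape Γ) → E' → (K → ATape Γ) → Prop}
    (h : c.Spec A t R) (h' : ∀ e B, R e B → (k e).Spec B t' (R' e B)) :
    (bind c k).Spec A (t + t') (fun e' B' => ∃ e B, R e B ∧ R' e B e' B') := by
  have h1 : Embeds c (bind c k) (Sum.elim (fun q => .inl (.inl q))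
      (fun e => .inl (.inr ⟨e, (k e).start⟩))) := ⟨fun q => ⟨_, rfl, fun h => rfl⟩⟩
  have h2 : ∀ e, Embeds (k e) (bind c k) (Sum.elim (fun q => .inl (.inr ⟨e, q⟩)) .inr) :=
    fun e => ⟨fun q => ⟨_, rfl, fun h => rfl⟩⟩
  refine h1.spec h fun e B hR => ?_
  refine ((h2 e).spec (h' e B hR) (t' := 0)
    (R' := fun e B e' B' => e' = e ∧ B' = B) fun e B _ => specAt_exit _ e B).mono le_rfl ?_
  intro e B
  constructor
  · rintro ⟨e, B, h, rfl, rfl⟩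
    exact h
  · intro h
    exact ⟨e, B, h, rfl, rfl⟩

/-- Run `c` again as long as it exits with `none`. -/
def loop (c : Frag K Γ (Option E)) : Frag K Γ E where
  Q := c.Q
  finite_Q := c.finite_Q
  start := c.start
  δ q h := (fun p => (Sum.elim .inl (fun e => e.elim (.inl c.start) .inr) p.1, p.2)) '' c.δ q h

/-- One unfolding of the loop. The specification of the remaining rounds is a hypothesis, to be
supplied by induction. -/
theorem spec_loop {c : Frag K Γ (Option E)} {A : K → ATape Γ} {t t' : ℕ}
    {R : Option E → (K → ATape Γ) → Prop} {R' : (K → ATape Γ) → E → (K → ATape Γ) → Prop}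
    (h : c.Spec A t R) (h' : ∀ B, R none B → (loop c).Spec B t' (R' B)) :
    (loop c).Spec A (t + t') (fun e B' => R (some e) B' ∨ ∃ B, R none B ∧ R' B e B') := by
  have h1 : Embeds c (loop c) (Sum.elim .inl (fun e => e.elim (.inl c.start) .inr)) :=
    ⟨fun q => ⟨_, rfl, fun h => rfl⟩⟩
  refine (h1.spec h (t' := t') (R' := fun e B => e.elim (R' B) fun e e' B' => e' = e ∧ B' = B)
    ?_).mono le_rfl ?_
  · rintro (_ | e) B hR
    · exact h' B hR
    · exact (specAt_exit _ e B).mono (Nat.zero_le _) fun _ _ => Iff.rfl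
  · intro e B
    constructor
    · rintro ⟨_ | e, B, h, h'⟩
      · exact .inr ⟨_, h, h'⟩
      · obtain ⟨rfl, rfl⟩ := h'
        exact .inl h
    · rintro (h | ⟨B', h, h'⟩)
      · exact ⟨some e, B, h, rfl, rfl⟩
      · exact ⟨none, B', h, h'⟩

end Frag

theorem StepsTo.add {C : Type} {r : C → C → Prop} {m n : ℕ} {a c : C} :
    StepsTo r (m + n) a c ↔ ∃ b, StepsTo r m a b ∧ StepsTo r n b c := by
  induction m generalizing a with
  | zero => simp [StepsTo]
  | succ m ih =>
    rw [Nat.add_right_comm]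
    simp only [StepsTo, ih]
    constructor
    · rintro ⟨d, h, b, h', h''⟩
      exact ⟨b, ⟨d, h, h'⟩, h''⟩
    · rintro ⟨b, ⟨d, h, h'⟩, h''⟩
      exact ⟨d, h, b, h', h''⟩

theorem stepsTo_one {C : Type} {r : C → C → Prop} {a b : C} : StepsTo r 1 a b ↔ r a b := by
  simp [StepsTo]

/-- `n` iterations of `m`-fold steps are `n * m` steps. -/
theorem StepsTo.mul {C : Type} {r : C → C → Prop} {m n : ℕ} {a c : C} :
    StepsTo (StepsTo r m) n a c ↔ StepsTo r (n * m) a c := by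
  induction n generalizing a with
  | zero => simp [StepsTo]
  | succ n ih =>
    rw [Nat.add_comm n, StepsTo.add, Nat.add_comm 1, Nat.succ_mul, Nat.add_comm (n * m),
      StepsTo.add]
    simp only [stepsTo_one, ih]

namespace Frag

section
variable {K Γ E E' : Type}

/-- Deterministic computation from `A` to the exit `e` with tapes `B`. -/
def Det (c : Frag K Γ E) (A : K → ATape Γ) (t : ℕ) (e : E) (B : K → ATape Γ) : Prop :=
  c.Spec A t (fun e' B' => e' = e ∧ B' = B)

theorem Det.mono {c : Frag K Γ E} {A B : K → ATape Γ} {t t' : ℕ} {e : E} (h : c.Det A t e B)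
    (ht : t ≤ t') : c.Det A t' e B :=
  Spec.mono h ht fun _ _ => Iff.rfl

theorem Det.bind [Finite E] {c : Frag K Γ E} {k : E → Frag K Γ E'} {A B : K → ATape Γ} {t t' : ℕ}
    {e : E} {R : E' → (K → ATape Γ) → Prop} (h : c.Det A t e B) (h' : (k e).Spec B t' R) :
    (bind c k).Spec A (t + t') R := by
  refine (spec_bind h (t' := t') (R' := fun _ _ => R) ?_).mono le_rfl ?_
  · rintro e B ⟨rfl, rfl⟩
    exact h'
  · intro e' B'
    constructor
    · rintro ⟨_, _, -, h⟩
      exact h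
    · exact fun h => ⟨e, B, ⟨rfl, rfl⟩, h⟩

/-- Iterating a body `m` times before leaving the loop. -/
theorem spec_loop_iter {c : Frag K Γ (Option E)} {σ : Type} {r : σ → σ → Prop}
    {T : ℕ → σ → K → ATape Γ} {D : σ → K → ATape Γ} {m t : ℕ} {e₀ : E}
    (hbody : ∀ i < m, ∀ s, c.Spec (T i s) t (fun e B => ∃ s', r s s' ∧ e = none ∧ B = T (i + 1) s'))
    (hexit : ∀ s, c.Det (T m s) t (some e₀) (D s)) (s : σ) :
    (loop c).Spec (T 0 s) ((m + 1) * t) (fun e B => ∃ s', StepsTo r m s s' ∧ e = e₀ ∧ B = D s') := by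
  induction m generalizing T s with
  | zero =>
    refine (spec_loop (t' := 0) (R' := fun _ _ _ => False) (hexit s) ?_).mono (by simp) ?_
    · rintro B ⟨h, -⟩
      cases h
    · intro e B
      simp [StepsTo]
  | succ m ih =>
    have ih' := fun s => ih (T := fun i => T (i + 1)) (fun i hi => hbody (i + 1) (by omega)) hexit s
    refine (spec_loop (t' := (m + 1) * t) (R' := fun B e B' =>
      (loop c).Reach (.inl (loop c).start, B) (.inr e, B')) (hbody 0 (by omega) s) ?_).mono
      (by linarith) ?_
    · rintro B ⟨s', -, -, rfl⟩
      exact ⟨(ih' s').1, fun e B => Iff.rfl⟩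
    · intro e B
      simp only [StepsTo]
      constructor
      · rintro (⟨_, _, h, _⟩ | ⟨B', ⟨s', hs', -, rfl⟩, h⟩)
        · cases h
        · obtain ⟨s'', h1, h2⟩ := ((ih' s').2 e B).1 h
          exact ⟨s'', ⟨s', hs', h1⟩, h2⟩
      · rintro ⟨s'', ⟨s', hs', h1⟩, h2⟩
        exact .inr ⟨_, ⟨s', hs', trivial, rfl⟩, ((ih' s').2 e B).2 ⟨s'', h1, h2⟩⟩

/-- Relational step followed by a deterministic one. -/
theorem spec_bind_det [Finite E] {c : Frag K Γ E} {k : E → Frag K Γ E'} {A : K → ATape Γ}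
    {t t' : ℕ} {σ : Type} {P : σ → Prop} {e : E} {T D : σ → K → ATape Γ} {e' : E'}
    (h : c.Spec A t (fun e₁ B => ∃ s, P s ∧ e₁ = e ∧ B = T s))
    (h' : ∀ s, P s → (k e).Det (T s) t' e' (D s)) :
    (Frag.bind c k).Spec A (t + t') (fun e₁ B => ∃ s, P s ∧ e₁ = e' ∧ B = D s) := by
  refine (spec_bind h (t' := t') (R' := fun e B e' B' =>
      (k e).Reach (.inl (k e).start, B) (.inr e', B')) ?_).mono le_rfl ?_
  · rintro e B ⟨s, hs, rfl, rfl⟩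
    exact ⟨(h' s hs).1, fun _ _ => Iff.rfl⟩
  · intro e₁ B
    constructor
    · rintro ⟨_, _, ⟨s, hs, rfl, rfl⟩, h⟩
      exact ⟨s, hs, ((h' s hs).2 _ _).1 h⟩
    · rintro ⟨s, hs, h⟩
      exact ⟨_, _, ⟨s, hs, rfl, rfl⟩, ((h' s hs).2 _ _).2 h⟩

/-- A single deterministic step. -/
def dprim (f : (K → Option Γ) → E × (K → Option Γ × Option Dir)) : Frag K Γ E :=
  prim fun h => {f h}

theorem det_dprim (f : (K → Option Γ) → E × (K → Option Γ × Option Dir)) (A : K → ATape Γ) :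
    (dprim f).Det A 1 (f fun k => A k 0).1
      (fun k => aact (A k) ((f fun k => A k 0).2 k)) := by
  refine (spec_prim _ A).mono le_rfl fun e B => ?_
  constructor
  · rintro ⟨a, h, rfl⟩
    have h : (e, a) = f fun k => A k 0 := h
    rw [← h]
    exact ⟨rfl, rfl⟩
  · rintro ⟨rfl, rfl⟩
    exact ⟨_, rfl, rfl⟩

end

/-! ### Counters: several heads on copies of one word -/

section
variable {C Rr Γ E : Type}

/-- Counter tapes with common contents `W` and heads at `x`; the other tapes are `s`. -/
def tp (W : ATape Γ) (x : C → ℤ) (s : Rr → ATape Γ) : C ⊕ Rr → ATape Γ :=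
  Sum.elim (fun c => shift W (x c)) s

/-- Move the counters, leaving with `e`. -/
def mv (m : C → Option Dir) (e : E) : Frag (C ⊕ Rr) Γ E :=
  dprim fun h => (e, fun k => (h k, Sum.elim m (fun _ => none) k))

/-- Positions after moving `i` times. -/
def adv (x : C → ℤ) (m : C → Option Dir) (i : ℕ) : C → ℤ := fun c => x c + i * dirOff (m c)

theorem adv_zero (x : C → ℤ) (m : C → Option Dir) : adv x m 0 = x := by
  funext c; simp [adv]

theorem adv_adv (x : C → ℤ) (m : C → Option Dir) (i j : ℕ) :
    adv (adv x m i) m j = adv x m (i + j) := by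
  funext c; simp only [adv]; push_cast; ring

theorem shift_none {Γ : Type} (f : ATape Γ) : shift f (dirOff none) = f := shift_zero f

theorem det_mv (m : C → Option Dir) (e : E) (W : ATape Γ) (x : C → ℤ) (s : Rr → ATape Γ) :
    (mv m e).Det (tp W x s) 1 e (tp W (adv x m 1) s) := by
  have h := det_dprim (fun h : C ⊕ Rr → Option Γ =>
    (e, fun k => (h k, Sum.elim m (fun _ => none) k))) (tp W x s)
  suffices h' : tp W (adv x m 1) s = fun k => aact (tp W x s k)
      (tp W x s k 0, Sum.elim m (fun _ => none) k) by
    rw [h']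
    exact h
  funext k
  rw [aact_same]
  rcases k with c | k
  · simp [tp, adv, shift_shift]
  · simp [tp, shift_none]

/-- Is the head of the counter `c` on a nonblank cell? -/
def test (c : C) : Frag (C ⊕ Rr) Γ Bool := dprim fun h => ((h (.inl c)).isSome, fun k => (h k, none))

theorem det_test (c : C) (W : ATape Γ) (x : C → ℤ) (s : Rr → ATape Γ) :
    (test c).Det (tp W x s) 1 (W (x c)).isSome (tp W x s) := by
  have h := det_dprim (fun h : C ⊕ Rr → Option Γ =>
    ((h (.inl c)).isSome, fun k => (h k, none))) (tp W x s)
  have e1 : (tp W x s (.inl c)) 0 = W (x c) := by simp [tp]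
  simp only [aact_same, shift_none, e1] at h
  exact h

/-- While `c` is on a nonblank cell, run `b` and move by `m₁`; finally move by `m₂`. -/
def whileDo (c : C) (b : Frag (C ⊕ Rr) Γ Unit) (m₁ m₂ : C → Option Dir) : Frag (C ⊕ Rr) Γ Unit :=
  loop (bind (test c) fun h => if h then bind b fun _ => mv m₁ none else mv m₂ (some ()))

/-- A round costs a test, the body and a move, hence `t + 2`. The effects of the body on the
remaining tapes accumulate in `StepsTo r n`; the final move `m₂` can correct the overshoot of the
counters. -/
theorem spec_whileDo {c : C} {b : Frag (C ⊕ Rr) Γ Unit} {m₁ m₂ : C → Option Dir} {W : ATape Γ}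
    {x : C → ℤ} {n t : ℕ} {r : (Rr → ATape Γ) → (Rr → ATape Γ) → Prop}
    (hn : ∀ i < n, (W (adv x m₁ i c)).isSome) (hn' : W (adv x m₁ n c) = none)
    (hb : ∀ i < n, ∀ s, b.Spec (tp W (adv x m₁ i) s) t
      (fun e B => ∃ s', r s s' ∧ e = () ∧ B = tp W (adv x m₁ i) s')) (s : Rr → ATape Γ) :
    (whileDo c b m₁ m₂).Spec (tp W x s) ((n + 1) * (t + 2)) (fun e B =>
      ∃ s', StepsTo r n s s' ∧ e = () ∧ B = tp W (adv (adv x m₁ n) m₂ 1) s') := by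
  have h := spec_loop_iter (c := bind (test c) fun h => if h then bind b fun _ => mv m₁ none
    else mv m₂ (some ())) (r := r) (T := fun i s => tp W (adv x m₁ i) s)
    (D := fun s => tp W (adv (adv x m₁ n) m₂ 1) s) (m := n) (t := 1 + (t + 1)) (e₀ := ()) ?_ ?_ s
  · rw [show tp W x s = tp W (adv x m₁ 0) s by rw [adv_zero]]
    exact h.mono (by rw [show 1 + (t + 1) = t + 2 by ring]) fun _ _ => Iff.rfl
  · intro i hi s
    have h1 := det_test (Rr := Rr) c W (adv x m₁ i) s
    rw [hn i hi] at h1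
    refine h1.bind ?_
    rw [if_pos rfl]
    exact spec_bind_det (hb i hi s) fun s' _ => by
      have := det_mv (E := Option Unit) m₁ none W (adv x m₁ i) s'
      rwa [adv_adv] at this
  · intro s
    have h1 := det_test (Rr := Rr) c W (adv x m₁ n) s
    rw [hn'] at h1
    refine h1.bind ?_
    exact (det_mv m₂ (some ()) W _ s).mono (by omega)

/-- `whileDo` without a body. -/
def whileMv (c : C) (m₁ m₂ : C → Option Dir) : Frag (C ⊕ Rr) Γ Unit :=
  loop (bind (test c) fun h => if h then mv m₁ none else mv m₂ (some ()))

theorem det_whileMv {c : C} {m₁ m₂ : C → Option Dir} {W : ATape Γ} {x : C → ℤ} (n : ℕ)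
    (hn : ∀ i < n, (W (adv x m₁ i c)).isSome) (hn' : W (adv x m₁ n c) = none) (s : Rr → ATape Γ) :
    (whileMv c m₁ m₂).Det (tp W x s) ((n + 1) * 2) () (tp W (adv (adv x m₁ n) m₂ 1) s) := by
  have h := spec_loop_iter (c := bind (test c) fun h => if h then mv m₁ none
    else mv m₂ (some ())) (r := fun _ _ : Unit => True) (T := fun i _ => tp W (adv x m₁ i) s)
    (D := fun _ => tp W (adv (adv x m₁ n) m₂ 1) s) (m := n) (t := 2) (e₀ := ()) ?_ ?_ ()
  · rw [show tp W x s = tp W (adv x m₁ 0) s by rw [adv_zero]]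
    refine h.mono le_rfl fun e B => ⟨?_, ?_⟩
    · rintro ⟨_, -, h⟩
      exact h
    · intro h
      refine ⟨(), ?_, h⟩
      clear * -
      induction n with
      | zero => rfl
      | succ n ih => exact ⟨(), trivial, ih⟩
  · intro i hi _
    have h1 := det_test (Rr := Rr) c W (adv x m₁ i) s
    rw [hn i hi] at h1
    refine (h1.bind (t' := 1) (R := fun e B => e = none ∧ B = tp W (adv x m₁ (i + 1)) s)
      ?_).mono le_rfl fun e B => ⟨?_, ?_⟩
    · rw [if_pos rfl, ← adv_adv]
      exact det_mv (E := Option Unit) m₁ none W (adv x m₁ i) s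
    · rintro ⟨rfl, rfl⟩
      exact ⟨(), trivial, rfl, rfl⟩
    · rintro ⟨_, -, h⟩
      exact h
  · intro _
    have h1 := det_test (Rr := Rr) c W (adv x m₁ n) s
    rw [hn'] at h1
    refine Det.mono (t := 1 + 1) ?_ le_rfl
    refine h1.bind ?_
    exact det_mv m₂ (some ()) W _ s

/-- The tape `W` holds a word of length `N`, starting at position `0`. -/
def IsWord (W : ATape Γ) (N : ℕ) : Prop := ∀ i : ℤ, (W i).isSome ↔ 0 ≤ i ∧ i < N

theorem IsWord.none {W : ATape Γ} {N : ℕ} (h : IsWord W N) {i : ℤ} (hi : i < 0 ∨ N ≤ i) :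
    W i = none := by
  by_contra hne
  have := (h i).1 (Option.isSome_iff_ne_none.2 hne)
  omega

theorem adv_none (x : C → ℤ) (i : ℕ) : adv x (fun _ => none) i = x := by
  funext c; simp [adv, dirOff]

variable [DecidableEq C]

/-- Move the counter `c` in direction `d`. -/
def one (c : C) (d : Dir) : C → Option Dir := fun c' => if c' = c then some d else none

theorem adv_one_left (x : C → ℤ) (c : C) (i : ℕ) :
    adv x (one c .left) i = Function.update x c (x c - i) := by
  funext c'
  by_cases h : c' = c
  · subst h; simp [adv, one, dirOff, sub_eq_add_neg]
  · simp [adv, one, h, dirOff]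

theorem adv_one_right (x : C → ℤ) (c : C) (i : ℕ) :
    adv x (one c .right) i = Function.update x c (x c + i) := by
  funext c'
  by_cases h : c' = c
  · subst h; simp [adv, one, dirOff]
  · simp [adv, one, h, dirOff]

/-- Move the counter `c` back to position `0`. -/
def rewind (c : C) : Frag (C ⊕ Rr) Γ Unit :=
  bind (mv (one c .left) ()) fun _ => whileMv c (one c .left) (one c .right)

/-- One step to the left precedes the first test because the counter may stand at `N`, on a blank
cell. The loop then runs to position `-1`, and its final move leads to `0`. -/
theorem det_rewind {W : ATape Γ} {N : ℕ} (hW : IsWord W N) (c : C) (x : C → ℤ) (s : Rr → ATape Γ)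
    {p : ℕ} (hp : x c = p) (hpN : p ≤ N) :
    (rewind c).Det (tp W x s) (2 * N + 3) () (tp W (Function.update x c 0) s) := by
  have h1 := det_mv (one c .left) () W x s
  rw [adv_one_left] at h1
  have h2 := det_whileMv (c := c) (m₁ := one c .left) (m₂ := one c .right) (W := W)
    (x := Function.update x c (x c - (1 : ℕ))) p ?_ ?_ s
  · have := h1.bind (k := fun _ => whileMv c (one c .left) (one c .right)) h2
    rw [adv_one_left, adv_one_right] at this
    refine this.mono (by omega) ?_
    simp [hp]
  · intro i hi
    rw [adv_one_left, hW]
    simp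
    omega
  · rw [adv_one_left]
    apply hW.none
    left
    simp
    omega

/-- Run `b` once for every position of the counter `y`. -/
def forLoop (y : C) (b : Frag (C ⊕ Rr) Γ Unit) : Frag (C ⊕ Rr) Γ Unit :=
  bind (whileDo y b (one y .right) (fun _ => none)) fun _ => rewind y

theorem spec_forLoop {W : ATape Γ} {N : ℕ} (hW : IsWord W N) {y : C}
    {b : Frag (C ⊕ Rr) Γ Unit} {x : C → ℤ} {t : ℕ} {r : (Rr → ATape Γ) → (Rr → ATape Γ) → Prop}
    (hy : x y = 0)
    (hb : ∀ i : ℕ, i < N → ∀ s, b.Spec (tp W (Function.update x y i) s) t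
      (fun e B => ∃ s', r s s' ∧ e = () ∧ B = tp W (Function.update x y i) s'))
    (s : Rr → ATape Γ) :
    (forLoop y b).Spec (tp W x s) ((N + 1) * (t + 2) + (2 * N + 3)) (fun e B =>
      ∃ s', StepsTo r N s s' ∧ e = () ∧ B = tp W x s') := by
  have key : ∀ i : ℕ, adv x (one y .right) i = Function.update x y (i : ℤ) := fun i => by
    rw [adv_one_right, hy, zero_add]
  refine spec_bind_det (T := fun s' => tp W (Function.update x y (N : ℤ)) s') (e := ()) ?_ ?_
  · have := spec_whileDo (c := y) (b := b) (m₁ := one y .right) (m₂ := fun _ => none) (W := W)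
      (x := x) (n := N) (t := t) (r := r) ?_ ?_ ?_ s
    · simpa only [adv_none, key] using this
    · intro i hi
      rw [key, hW]
      simpa using hi
    · rw [key]
      apply hW.none
      simp
    · intro i hi
      rw [key]
      exact hb i hi
  · intro s' _
    have := det_rewind hW y (Function.update x y (N : ℤ)) s' (p := N) (by simp) le_rfl
    rw [Function.update_idem, ← hy, Function.update_eq_self] at this
    exact this

/-- `N ^ ys.length`-fold repetition of `b`. -/
def nest (ys : List C) (b : Frag (C ⊕ Rr) Γ Unit) : Frag (C ⊕ Rr) Γ Unit := ys.foldr forLoop b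

def nestTime (N t : ℕ) : ℕ → ℕ
  | 0 => t
  | l + 1 => (N + 1) * (nestTime N t l + 2) + (2 * N + 3)

/-- The body is specified uniformly in the counter positions, so the nested loops merely count: each
contributes a factor `N`. -/
theorem spec_nest {W : ATape Γ} {N : ℕ} (hW : IsWord W N) {ys : List C} (hys : ys.Nodup)
    {b : Frag (C ⊕ Rr) Γ Unit} {t : ℕ} {r : (Rr → ATape Γ) → (Rr → ATape Γ) → Prop}
    (hb : ∀ x s, b.Spec (tp W x s) t (fun e B => ∃ s', r s s' ∧ e = () ∧ B = tp W x s'))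
    (x : C → ℤ) (hx : ∀ y ∈ ys, x y = 0) (s : Rr → ATape Γ) :
    (nest ys b).Spec (tp W x s) (nestTime N t ys.length) (fun e B =>
      ∃ s', StepsTo r (N ^ ys.length) s s' ∧ e = () ∧ B = tp W x s') := by
  induction ys generalizing x s with
  | nil =>
    exact (hb x s).mono le_rfl fun e B => by rw [List.length_nil, pow_zero]; simp only [stepsTo_one]
  | cons y ys ih =>
    rw [List.nodup_cons] at hys
    refine (spec_forLoop hW (hx y (by simp)) (r := StepsTo r (N ^ ys.length))
      (fun i _ s => ih hys.2 (Function.update x y i) ?_ s) s).mono le_rfl fun e B => ?_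
    · intro z hz
      rw [Function.update_of_ne (by rintro rfl; exact hys.1 hz)]
      exact hx z (by simp [hz])
    · simp only [StepsTo.mul, List.length_cons, pow_succ, mul_comm]

end

end Frag
-- Polynomial bounds
/-- Growth bounded by a polynomial. -/
def PolyBdd (t : ℕ → ℕ) : Prop := ∃ p : Polynomial ℕ, ∀ n, t n ≤ p.eval n

namespace PolyBdd

theorem const (c : ℕ) : PolyBdd fun _ => c := ⟨.C c, fun n => by simp⟩

theorem id : PolyBdd fun n => n := ⟨.X, fun n => by simp⟩

theorem add {f g : ℕ → ℕ} (hf : PolyBdd f) (hg : PolyBdd g) : PolyBdd fun n => f n + g n := by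
  obtain ⟨p, hp⟩ := hf
  obtain ⟨q, hq⟩ := hg
  exact ⟨p + q, fun n => by rw [Polynomial.eval_add]; exact add_le_add (hp n) (hq n)⟩

theorem mul {f g : ℕ → ℕ} (hf : PolyBdd f) (hg : PolyBdd g) : PolyBdd fun n => f n * g n := by
  obtain ⟨p, hp⟩ := hf
  obtain ⟨q, hq⟩ := hg
  exact ⟨p * q, fun n => by rw [Polynomial.eval_mul]; exact Nat.mul_le_mul (hp n) (hq n)⟩

end PolyBdd

/-! ### Access to a cell whose index is given by base-`N` digits -/

namespace Frag

section
variable {K Γ E E' : Type}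

theorem Det.loop_next {c : Frag K Γ (Option E)} {A B D : K → ATape Γ} {t t' : ℕ} {e : E}
    (h : c.Det A t none B) (h' : (loop c).Det B t' e D) : (loop c).Det A (t + t') e D := by
  refine (spec_loop h (t' := t') (R' := fun _ e' B' => e' = e ∧ B' = D) ?_).mono le_rfl ?_
  · rintro B ⟨-, rfl⟩
    exact h'
  · intro e' B'
    constructor
    · rintro (⟨h, -⟩ | ⟨_, _, h⟩)
      · cases h
      · exact h
    · exact fun h => .inr ⟨B, ⟨rfl, rfl⟩, h⟩

theorem Det.loop_exit {c : Frag K Γ (Option E)} {A D : K → ATape Γ} {t : ℕ} {e : E}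
    (h : c.Det A t (some e) D) : (loop c).Det A t e D := by
  refine (spec_loop h (t' := 0) (R' := fun _ _ _ => False) ?_).mono le_rfl ?_
  · rintro B ⟨h, -⟩
    cases h
  · intro e' B'
    constructor
    · rintro (⟨h', rfl⟩ | ⟨_, _, h'⟩)
      · exact ⟨Option.some.inj h', rfl⟩
      · exact h'.elim
    · rintro ⟨rfl, rfl⟩
      exact .inl ⟨rfl, rfl⟩

theorem Det.then [Finite E] {c : Frag K Γ E} {k : E → Frag K Γ E'} {A B D : K → ATape Γ} {t t' : ℕ}
    {e : E} {e' : E'} (h : c.Det A t e B) (h' : (k e).Det B t' e' D) :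
    (Frag.bind c k).Det A (t + t') e' D :=
  Det.bind h h'

theorem Spec.det {c : Frag K Γ E} {A : K → ATape Γ} {t : ℕ} {σ : Type} {P : σ → Prop} {e : E}
    {T : σ → K → ATape Γ} {s : σ} (h : c.Spec A t (fun e₁ B => ∃ s, P s ∧ e₁ = e ∧ B = T s))
    (hs : ∀ s', P s' ↔ s' = s) : c.Det A t e (T s) := by
  refine h.mono le_rfl fun e' B => ?_
  constructor
  · rintro ⟨s', h1, h2, h3⟩
    rw [(hs s').1 h1] at h3
    exact ⟨h2, h3⟩
  · exact fun ⟨h2, h3⟩ => ⟨s, (hs s).2 rfl, h2, h3⟩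

end

section
variable {C Rr Γ E : Type} [DecidableEq C]

/-- Move `c` and `c'` simultaneously. -/
def two (c : C) (d : Dir) (c' : C) (d' : Dir) : C → Option Dir :=
  fun t => if t = c then some d else if t = c' then some d' else none

/-- Run `b` as many times as the position of `c` tells, using the scratch counter `z`. -/
def times (c z : C) (b : Frag (C ⊕ Rr) Γ Unit) : Frag (C ⊕ Rr) Γ Unit :=
  bind (mv (one c .left) ()) fun _ =>
    bind (whileDo c b (two c .left z .right) (two c .right z .left)) fun _ =>
      whileMv z (two c .right z .left) (one z .right)

def timesTime (N t : ℕ) : ℕ := 1 + ((N + 1) * (t + 2) + (N + 1) * 2)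

/-- While `c` descends from `m - 1` to `-1`, the scratch counter `z` ascends and records the
distance; the second loop carries it back to `c`. The initial step to the left makes the number of
rounds equal to `m` rather than `m + 1`. -/
theorem spec_times {W : ATape Γ} {N : ℕ} (hW : IsWord W N) {c z : C} (hcz : c ≠ z)
    {b : Frag (C ⊕ Rr) Γ Unit} {x : C → ℤ} {t m : ℕ} (hc : x c = m) (hm : m < N) (hz : x z = 0)
    {r : (Rr → ATape Γ) → (Rr → ATape Γ) → Prop}
    (hb : ∀ x' : C → ℤ, (∀ y, y ≠ c → y ≠ z → x' y = x y) → ∀ s, b.Spec (tp W x' s) t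
      (fun e B => ∃ s', r s s' ∧ e = () ∧ B = tp W x' s')) (s : Rr → ATape Γ) :
    (times c z b).Spec (tp W x s) (timesTime N t) (fun e B =>
      ∃ s', StepsTo r m s s' ∧ e = () ∧ B = tp W x s') := by
  set x₁ := adv x (one c .left) 1 with hx₁
  have hx₁c : x₁ c = m - 1 := by simp [hx₁, adv, one, dirOff, hc]; ring
  have hx₁z : x₁ z = 0 := by simp [hx₁, adv, one, dirOff, hz, hcz.symm]
  have hx₁y : ∀ y, y ≠ c → x₁ y = x y := fun y hy => by simp [hx₁, adv, one, dirOff, hy]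
  refine (det_mv (one c .left) () W x s).bind ?_
  set x₂ := adv (adv x₁ (two c .left z .right) m) (two c .right z .left) 1 with hx₂
  have hx₂c : x₂ c = 0 := by simp [hx₂, adv, two, dirOff, hx₁c]; ring
  have hx₂z : x₂ z = m - 1 := by simp [hx₂, adv, two, dirOff, hx₁z, hcz.symm]; ring
  have hx₂y : ∀ y, y ≠ c → y ≠ z → x₂ y = x y := fun y hy hy' => by
    simp [hx₂, adv, two, dirOff, hy, hy', hx₁y]
  refine spec_bind_det (T := fun s' => tp W x₂ s') (e := ()) (t := (N + 1) * (t + 2))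
    (t' := (N + 1) * 2) ?_ ?_
  · refine (spec_whileDo (c := c) (b := b) (m₁ := two c .left z .right) (m₂ := two c .right z .left)
      (W := W) (x := x₁) (n := m) (t := t) (r := r) ?_ ?_ ?_ s).mono (by gcongr) fun _ _ => Iff.rfl
    · intro i hi
      rw [hW]
      simp [adv, two, dirOff, hx₁c]
      omega
    · apply hW.none
      simp [adv, two, dirOff, hx₁c]
    · intro i _
      refine hb _ fun y h1 h2 => ?_
      simp [adv, two, dirOff, h1, h2, hx₁y]
  · intro s' _
    have := det_whileMv (c := z) (m₁ := two c .right z .left) (m₂ := one z .right) (W := W)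
      (x := x₂) m ?_ ?_ s'
    · convert this.mono (t' := (N + 1) * 2) (by gcongr) using 2
      funext y
      by_cases h1 : y = c
      · subst h1; simp [adv, two, one, dirOff, hx₂c, hc, hcz]
      · by_cases h2 : y = z
        · subst h2; simp [adv, two, one, dirOff, hx₂z, hz, h1]; ring
        · simp [adv, two, one, dirOff, h1, h2, hx₂y]
    · intro i hi
      rw [hW]
      simp [adv, two, dirOff, hx₂z, hcz.symm]
      omega
    · apply hW.none
      simp [adv, two, dirOff, hx₂z, hcz.symm]

/-- Run `b` as often as the number with the base-`N` digits given by the counters `cs`. -/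
def idx (ys : List C) (z : C) (b : Frag (C ⊕ Rr) Γ Unit) : List C → ℕ → Frag (C ⊕ Rr) Γ Unit
  | [], _ => mv (fun _ => none) ()
  | c :: cs, j => bind (times c z (nest (ys.take j) b)) fun _ => idx ys z b cs (j + 1)

theorem nestTime_mono (N t : ℕ) : Monotone (nestTime N t) :=
  monotone_nat_of_le_succ fun l => by simp only [nestTime]; nlinarith [Nat.zero_le (nestTime N t l)]

def idxTime (N t k : ℕ) : ℕ → ℕ
  | 0 => 1
  | l + 1 => timesTime N (nestTime N t k) + idxTime N t k l

/-- A digit `v` of weight `N ^ j` repeats `v` times a nest of `j` loops, so the repetitions add up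
to the number with the given digits, lowest digit first. The index itself is never stored. -/
theorem spec_idx {W : ATape Γ} {N : ℕ} (hW : IsWord W N) {ys : List C} (hys : ys.Nodup) {z : C}
    (hzy : z ∉ ys) {b : Frag (C ⊕ Rr) Γ Unit} {t : ℕ} {r : (Rr → ATape Γ) → (Rr → ATape Γ) → Prop}
    (hb : ∀ x s, b.Spec (tp W x s) t (fun e B => ∃ s', r s s' ∧ e = () ∧ B = tp W x s'))
    {x : C → ℤ} (hz : x z = 0) (hx : ∀ y ∈ ys, x y = 0) {cs : List C} {vs : List ℕ}
    (hcv : List.Forall₂ (fun c v => c ≠ z ∧ c ∉ ys ∧ x c = (v : ℕ) ∧ v < N) cs vs) {j : ℕ}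
    (hj : j + cs.length ≤ ys.length) (s : Rr → ATape Γ) :
    (idx ys z b cs j).Spec (tp W x s) (idxTime N t ys.length cs.length) (fun e B =>
      ∃ s', StepsTo r (N ^ j * Nat.ofDigits N vs) s s' ∧ e = () ∧ B = tp W x s') := by
  induction hcv generalizing j s with
  | nil =>
    refine Spec.mono (det_mv (fun _ => none) () W x s) le_rfl fun e B => ?_
    rw [adv_none]
    simp only [Nat.ofDigits_nil, mul_zero, StepsTo]
    constructor
    · rintro ⟨h, h'⟩
      exact ⟨s, rfl, h, h'⟩
    · rintro ⟨s', rfl, h, h'⟩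
      exact ⟨h, h'⟩
  | @cons c v cs vs h _ ih =>
    obtain ⟨h1, h2, h3, h4⟩ := h
    rw [List.length_cons] at hj
    have hlen : (ys.take j).length = j := by simp; omega
    have hn := spec_times hW h1 (t := nestTime N t ys.length) h3 h4 hz
      (r := StepsTo r (N ^ j)) (b := nest (ys.take j) b) (fun x' hx' s =>
        (spec_nest hW (hys.sublist (List.take_sublist _ _)) hb x' (fun y hy => by
          have hy' := List.mem_of_mem_take hy
          rw [hx' y (by rintro rfl; exact h2 hy') (by rintro rfl; exact hzy hy')]
          exact hx y hy') s).mono (nestTime_mono N t (by omega)) fun e B => by rw [hlen]) s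
    have hd : ∀ s s', StepsTo r (N ^ j * Nat.ofDigits N (v :: vs)) s s' ↔
        ∃ s₁, StepsTo (StepsTo r (N ^ j)) v s s₁ ∧
          StepsTo r (N ^ (j + 1) * Nat.ofDigits N vs) s₁ s' := by
      intro s s'
      simp only [StepsTo.mul]
      rw [← StepsTo.add]
      congr! 1
      rw [Nat.ofDigits_cons]
      ring
    refine (spec_bind hn (t' := idxTime N t ys.length cs.length) (R' := fun _ B e B' =>
      (idx ys z b cs (j + 1)).Reach (.inl (idx ys z b cs (j + 1)).start, B) (.inr e, B'))
      ?_).mono le_rfl fun e B => ?_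
    · rintro _ _ ⟨s', -, -, rfl⟩
      exact ⟨(ih (j := j + 1) (by omega) s').1, fun _ _ => Iff.rfl⟩
    · constructor
      · rintro ⟨_, _, ⟨s₁, h5, -, rfl⟩, h6⟩
        obtain ⟨s', h7, h8⟩ := ((ih (j := j + 1) (by omega) s₁).2 _ _).1 h6
        exact ⟨s', (hd _ _).2 ⟨s₁, h5, h7⟩, h8⟩
      · rintro ⟨s', h5, h6⟩
        obtain ⟨s₁, h7, h8⟩ := (hd _ _).1 h5
        exact ⟨(), _, ⟨s₁, h7, rfl, rfl⟩, ((ih (j := j + 1) (by omega) s₁).2 _ _).2 ⟨s', h8, h6⟩⟩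

variable [DecidableEq Rr]

/-- Move the head of the tape `k`. -/
def restMv (k : Rr) (d : Dir) : Frag (C ⊕ Rr) Γ Unit :=
  dprim fun h => ((), fun k' => (h k', if k' = .inr k then some d else none))

theorem det_restMv (k : Rr) (d : Dir) (W : ATape Γ) (x : C → ℤ) (s : Rr → ATape Γ) :
    (restMv k d).Det (tp W x s) 1 ()
      (tp W x (Function.update s k (shift (s k) (dirOff (some d))))) := by
  have h := det_dprim (fun h : C ⊕ Rr → Option Γ =>
    ((), fun k' => (h k', if k' = .inr k then some d else none))) (tp W x s)
  suffices h' : tp W x (Function.update s k (shift (s k) (dirOff (some d)))) =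
      fun k' => aact (tp W x s k') (tp W x s k' 0, if k' = .inr k then some d else none) by
    rw [h']
    exact h
  funext k'
  rw [aact_same]
  rcases k' with c | k'
  · simp [tp, shift_none]
  · by_cases hk : k' = k
    · subst hk; simp [tp]
    · simp [tp, hk, shift_none]

theorem stepsTo_update (k : Rr) (d : ℤ) (n : ℕ) (s s' : Rr → ATape Γ) :
    StepsTo (fun s s' => s' = Function.update s k (shift (s k) d)) n s s' ↔
      s' = Function.update s k (shift (s k) (n * d)) := by
  induction n generalizing s with
  | zero => simp [StepsTo, shift_zero, eq_comm]
  | succ n ih =>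
    simp only [StepsTo, exists_eq_left, ih, Function.update_idem, Function.update_self, shift_shift]
    congr! 3
    push_cast; ring

/-- Apply `p` to the symbol under the head of the tape `k`. -/
def readRest (k : Rr) (p : Option Γ → E) : Frag (C ⊕ Rr) Γ E :=
  dprim fun h => (p (h (.inr k)), fun k => (h k, none))

omit [DecidableEq C] [DecidableEq Rr] in
theorem det_readRest (k : Rr) (p : Option Γ → E) (W : ATape Γ) (x : C → ℤ) (s : Rr → ATape Γ) :
    (readRest k p).Det (tp W x s) 1 (p (s k 0)) (tp W x s) := by
  have h := det_dprim (fun h : C ⊕ Rr → Option Γ =>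
    (p (h (.inr k)), fun k => (h k, none))) (tp W x s)
  simp only [aact_same, shift_none] at h
  exact h

def readCtr (c : C) (p : Option Γ → E) : Frag (C ⊕ Rr) Γ E :=
  dprim fun h => (p (h (.inl c)), fun k => (h k, none))

omit [DecidableEq C] [DecidableEq Rr] in
theorem det_readCtr (c : C) (p : Option Γ → E) (W : ATape Γ) (x : C → ℤ) (s : Rr → ATape Γ) :
    (readCtr c p).Det (tp W x s) 1 (p (W (x c))) (tp W x s) := by
  have h := det_dprim (fun h : C ⊕ Rr → Option Γ =>
    (p (h (.inl c)), fun k => (h k, none))) (tp W x s)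
  have e1 : (tp W x s (.inl c)) 0 = W (x c) := by simp [tp]
  simp only [aact_same, shift_none, e1] at h
  exact h

/-- Look up the cell of the tape `k` with the index given by the counters `cs`. -/
def lookup (ys : List C) (z : C) (k : Rr) (p : Option Γ → Bool) (cs : List C) :
    Frag (C ⊕ Rr) Γ Bool :=
  bind (idx ys z (restMv k .right) cs 0) fun _ => bind (readRest k p) fun b =>
    bind (idx ys z (restMv k .left) cs 0) fun _ => mv (fun _ => none) b

/-- The walk to the cell is undone by the same number of steps in the opposite direction, since the
digits are intact; thus all tapes are restored. -/
theorem det_lookup {W : ATape Γ} {N : ℕ} (hW : IsWord W N) {ys : List C} (hys : ys.Nodup) {z : C}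
    (hzy : z ∉ ys) (k : Rr) (p : Option Γ → Bool)
    {x : C → ℤ} (hz : x z = 0) (hx : ∀ y ∈ ys, x y = 0) {cs : List C} {vs : List ℕ}
    (hcv : List.Forall₂ (fun c v => c ≠ z ∧ c ∉ ys ∧ x c = (v : ℕ) ∧ v < N) cs vs)
    (hj : cs.length ≤ ys.length) (s : Rr → ATape Γ) :
    (lookup ys z k p cs).Det (tp W x s) (2 * idxTime N 1 ys.length cs.length + 2)
      (p (s k (Nat.ofDigits N vs : ℕ))) (tp W x s) := by
  have key : ∀ d s, (idx ys z (restMv k d) cs 0).Det (tp W x s) (idxTime N 1 ys.length cs.length) ()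
      (tp W x (Function.update s k (shift (s k) ((Nat.ofDigits N vs : ℕ) * dirOff (some d))))) := by
    intro d s
    refine Spec.det (spec_idx hW hys hzy
      (r := fun s s' => s' = Function.update s k (shift (s k) (dirOff (some d))))
      (fun x s => ?_) hz hx hcv (by omega) s) fun s' => ?_
    · refine Spec.mono (det_restMv k d W x s) le_rfl fun e B => ?_
      constructor
      · exact fun h => ⟨_, rfl, h⟩
      · rintro ⟨_, rfl, h⟩
        exact h
    · rw [stepsTo_update, pow_zero, one_mul]
  have h1 := key .right s
  have h2 := det_readRest (C := C) k p W x
    (Function.update s k (shift (s k) ((Nat.ofDigits N vs : ℕ) * dirOff (some .right))))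
  have h3 := key .left
    (Function.update s k (shift (s k) ((Nat.ofDigits N vs : ℕ) * dirOff (some .right))))
  have h4 := h1.then (k := fun _ => bind (readRest k p) fun b =>
    bind (idx ys z (restMv k .left) cs 0) fun _ => mv (fun _ => none) b)
    (h2.then (h3.then (det_mv (fun _ => none) _ W x _)))
  simp only [Function.update_self, Function.update_idem, shift_shift, adv_none, shift_head,
    dirOff, mul_one, mul_neg, add_neg_cancel, shift_zero, Function.update_eq_self] at h4
  exact h4.mono (by omega)

end

end Frag
-- Comparing counters, and testing a condition at all positions
namespace Frag

section
variable {C Rr Γ E : Type} [DecidableEq C]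

/-- The moves of three counters. -/
def three (c c' : C) (d : Dir) (z : C) (d' : Dir) : C → Option Dir :=
  fun t => if t = z then some d' else if t = c ∨ t = c' then some d else none

/-- Is the position of `c` smaller than that of `c'`? The counter `z` is used as scratch. -/
def ltTest (c c' z : C) : Frag (C ⊕ Rr) Γ Bool :=
  bind (loop (bind (test c) fun h => bind (test c') fun h' =>
    if h && h' then mv (three c c' .left z .right) none else mv (one z .left) (some h'))) fun b =>
    bind (whileMv z (three c c' .right z .left) (one z .right)) fun _ => mv (fun _ => none) b

/-- Both counters descend together until one falls off the word, after `min m m' + 1` rounds; then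
`c'` is still on the word exactly when `m < m'`. The counter `z` records the number of rounds for
the way back. -/
theorem det_ltTest {W : ATape Γ} {N : ℕ} (hW : IsWord W N) {c c' z : C} (hc : c ≠ z) (hc' : c' ≠ z)
    {x : C → ℤ} {m m' : ℕ} (hm : x c = m) (hm' : x c' = m') (hmN : m < N) (hmN' : m' < N)
    (hz : x z = 0) (s : Rr → ATape Γ) :
    (ltTest c c' z).Det (tp W x s) (5 * N + 6) (decide (m < m')) (tp W x s) := by
  set n := min m m' + 1 with hn
  set c₀ : Frag (C ⊕ Rr) Γ (Option Bool) := bind (test c) fun h => bind (test c') fun h' =>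
    if h && h' then mv (three c c' .left z .right) none else mv (one z .left) (some h') with hc₀
  set M := three c c' .left z .right with hM
  have hMc : ∀ i, adv x M i c = m - i := fun i => by
    simp [adv, hM, three, hc, dirOff, hm, sub_eq_add_neg]
  have hMc' : ∀ i, adv x M i c' = m' - i := fun i => by
    simp [adv, hM, three, hc', dirOff, hm', sub_eq_add_neg]
  have hstep : ∀ i < n, c₀.Det (tp W (adv x M i) s) 3 none (tp W (adv x M (i + 1)) s) := by
    intro i hi
    have h1 : (W (adv x M i c)).isSome = true := (hW _).2 (by rw [hMc]; omega)
    have h2 : (W (adv x M i c')).isSome = true := (hW _).2 (by rw [hMc']; omega)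
    have e1 := det_test (Rr := Rr) c W (adv x M i) s
    have e2 := det_test (Rr := Rr) c' W (adv x M i) s
    have e3 := det_mv (Rr := Rr) (E := Option Bool) M none W (adv x M i) s
    rw [h1] at e1
    rw [h2] at e2
    rw [adv_adv] at e3
    exact e1.then (t' := 1 + 1) (e2.then e3)
  have hlast : c₀.Det (tp W (adv x M n) s) 3 (some (decide (m < m')))
      (tp W (adv (adv x M n) (one z .left) 1) s) := by
    have e1 := det_test (Rr := Rr) c W (adv x M n) s
    have e2 := det_test (Rr := Rr) c' W (adv x M n) s
    have h1 : (W (adv x M n c')).isSome = decide (m < m') := by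
      by_cases h : m < m'
      · rw [decide_eq_true h, hW, hMc']; omega
      · rw [decide_eq_false h, hW.none (by rw [hMc']; omega)]; rfl
    have h2 : ((W (adv x M n c)).isSome && (W (adv x M n c')).isSome) = false := by
      rw [h1]
      by_cases h : m < m'
      · rw [hW.none (by rw [hMc]; omega)]; rfl
      · simp [h]
    refine e1.then (t' := 1 + 1) (e2.then ?_)
    rw [h2, h1]
    exact det_mv (Rr := Rr) (one z .left) _ W (adv x M n) s
  have hloop : ∀ k i, i + k = n → (loop c₀).Det (tp W (adv x M i) s) (3 * k + 3) (decide (m < m'))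
      (tp W (adv (adv x M n) (one z .left) 1) s) := by
    intro k
    induction k with
    | zero =>
      rintro i rfl
      exact hlast.loop_exit
    | succ k ih =>
      intro i hi
      exact ((hstep i (by omega)).loop_next (ih (i + 1) (by omega))).mono (by omega)
  have h0 := hloop n 0 (by omega)
  rw [adv_zero] at h0
  set x₁ := adv (adv x M n) (one z .left) 1 with hx₁
  have hx₁z : x₁ z = n - 1 := by
    simp [hx₁, adv, hM, three, one, dirOff, hz]; ring
  have h1 := det_whileMv (c := z) (m₁ := three c c' .right z .left) (m₂ := one z .right) (W := W)
    (x := x₁) n ?_ ?_ s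
  · have hx : adv (adv x₁ (three c c' .right z .left) n) (one z .right) 1 = x := by
      funext y
      by_cases h1 : y = z
      · subst h1; simp [adv, hx₁, three, hM, one, dirOff, hz]
      · by_cases h2 : y = c ∨ y = c'
        · simp [adv, hx₁, three, hM, one, dirOff, h1, h2]
        · simp [adv, hx₁, three, hM, one, dirOff, h1, h2]
    rw [hx] at h1
    have h2 := det_mv (Rr := Rr) (fun _ => none) (decide (m < m')) W x s
    rw [adv_none] at h2
    exact (h0.then (k := fun b => bind (whileMv z (three c c' .right z .left) (one z .right))
      fun _ => mv (fun _ => none) b) (h1.then h2)).mono (by omega)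
  · intro i hi
    rw [hW]
    simp [adv, three, dirOff, hx₁z]
    omega
  · apply hW.none
    simp [adv, three, dirOff, hx₁z]

open Classical in
/-- Does `b` succeed for all positions of the counter `y`? -/
def allF (y : C) (b : Frag (C ⊕ Rr) Γ Bool) : Frag (C ⊕ Rr) Γ Bool :=
  bind (loop (bind (test y) fun h => if h then
      bind b fun r => if r then mv (one y .right) none else mv (fun _ => none) (some false)
    else mv (fun _ => none) (some true))) fun r =>
    bind (rewind y) fun _ => mv (fun _ => none) r

-- The first failure leaves the loop early, with `y` at some `p ≤ N` that depends on the data;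
-- rewinding works from each such position.
open Classical in
theorem det_allF {W : ATape Γ} {N : ℕ} (hW : IsWord W N) {y : C} {b : Frag (C ⊕ Rr) Γ Bool}
    {x : C → ℤ} (hy : x y = 0) {t : ℕ} {P : ℕ → Prop} {s : Rr → ATape Γ}
    (hb : ∀ i : ℕ, i < N → b.Det (tp W (Function.update x y i) s) t (decide (P i))
      (tp W (Function.update x y i) s)) :
    (allF y b).Det (tp W x s) ((N + 1) * (t + 2) + (2 * N + 3) + 1) (decide (∀ i < N, P i))
      (tp W x s) := by
  set c₀ : Frag (C ⊕ Rr) Γ (Option Bool) := bind (test y) fun h => if h then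
      bind b fun r => if r then mv (one y .right) none else mv (fun _ => none) (some false)
    else mv (fun _ => none) (some true) with hc₀
  have hloop : ∀ k i, i + k = N → ∃ p ≤ N, (loop c₀).Det (tp W (Function.update x y (i : ℤ)) s)
      ((k + 1) * (t + 2)) (decide (∀ j < N, i ≤ j → P j))
      (tp W (Function.update x y (p : ℤ)) s) := by
    intro k
    induction k with
    | zero =>
      rintro i rfl
      refine ⟨i, le_rfl, ?_⟩
      have e1 := det_test (Rr := Rr) y W (Function.update x y (i : ℤ)) s
      rw [hW.none (by simp)] at e1
      have e2 := det_mv (Rr := Rr) (fun _ => none) (some true) W (Function.update x y (i : ℤ)) s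
      rw [adv_none] at e2
      have e3 : c₀.Det _ (1 + 1) _ _ := e1.then e2
      rw [decide_eq_true (by intro j h1 h2; omega)]
      exact e3.loop_exit.mono (by omega)
    | succ k ih =>
      intro i hi
      have e1 := det_test (Rr := Rr) y W (Function.update x y (i : ℤ)) s
      rw [(hW _).2 (by simp; omega)] at e1
      have e2 := hb i (by omega)
      by_cases hP : P i
      · obtain ⟨p, hp, e4⟩ := ih (i + 1) (by omega)
        refine ⟨p, hp, ?_⟩
        rw [decide_eq_true hP] at e2
        have e3 := det_mv (Rr := Rr) (E := Option Bool) (one y .right) none W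
          (Function.update x y (i : ℤ)) s
        rw [adv_one_right, Function.update_idem, Function.update_self] at e3
        have e5 : c₀.Det _ (1 + (t + 1)) _ _ := e1.then (e2.then e3)
        have e6 := e5.loop_next e4
        have hiff : (∀ j < N, i + 1 ≤ j → P j) ↔ ∀ j < N, i ≤ j → P j := by
          refine ⟨fun h j h1 h2 => ?_, fun h j h1 h2 => h j h1 (by omega)⟩
          rcases h2.eq_or_lt with rfl | h2
          · exact hP
          · exact h j h1 h2
        simp only [hiff] at e6
        exact e6.mono (by ring_nf; omega)
      · refine ⟨i, by omega, ?_⟩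
        rw [decide_eq_false hP] at e2
        have e3 := det_mv (Rr := Rr) (fun _ => none) (some false) W (Function.update x y (i : ℤ)) s
        rw [adv_none] at e3
        have e5 : c₀.Det _ (1 + (t + 1)) _ _ := e1.then (e2.then e3)
        rw [decide_eq_false (by intro h; exact hP (h i (by omega) le_rfl))]
        exact e5.loop_exit.mono (by nlinarith)
  obtain ⟨p, hp, h1⟩ := hloop N 0 (by omega)
  have h2 := det_rewind hW y (Function.update x y (p : ℤ)) s (p := p) (by simp) hp
  rw [Function.update_idem, ← hy, Function.update_eq_self] at h2
  have h3 := det_mv (Rr := Rr) (fun _ => none) (decide (∀ i < N, P i)) W x s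
  rw [adv_none] at h3
  simp only [Nat.zero_le, true_imp_iff, Nat.cast_zero] at h1
  have h4 := h1.then (k := fun r => bind (rewind y) fun _ => mv (fun _ => none) r) (h2.then h3)
  rw [← hy, Function.update_eq_self] at h4
  exact h4.mono (by omega)

end

end Frag

/-! ### First-order formulas over words with additional relations -/

/-- Formulas with `d` free variables, which range over the positions of a word over `Λ`. There are
two families of additional relations, both with arities `ar`. -/
inductive Fml (Λ X : Type) (ar : X → ℕ) : ℕ → Type
  | letter {d : ℕ} (i : Fin d) (a : Λ) : Fml Λ X ar d
  | lt {d : ℕ} (i j : Fin d) : Fml Λ X ar d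
  | so {d : ℕ} (b : Bool) (x : X) (f : Fin (ar x) → Fin d) : Fml Λ X ar d
  | not {d : ℕ} (φ : Fml Λ X ar d) : Fml Λ X ar d
  | and {d : ℕ} (φ ψ : Fml Λ X ar d) : Fml Λ X ar d
  | all {d : ℕ} (φ : Fml Λ X ar (d + 1)) : Fml Λ X ar d

/-- Relations on positions. -/
abbrev Rels (X : Type) (ar : X → ℕ) : Type := (x : X) → (Fin (ar x) → ℕ) → Prop

structure Mdl (Λ X : Type) (ar : X → ℕ) where
  w : List Λ
  so : Bool → Rels X ar

section
variable {Λ X : Type} {ar : X → ℕ}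

def Fml.eval (M : Mdl Λ X ar) : {d : ℕ} → Fml Λ X ar d → (Fin d → ℕ) → Prop
  | _, .letter i a, ρ => M.w[ρ i]? = some a
  | _, .lt i j, ρ => ρ i < ρ j
  | _, .so b x f, ρ => M.so b x fun k => ρ (f k)
  | _, .not φ, ρ => ¬ φ.eval M ρ
  | _, .and φ ψ, ρ => φ.eval M ρ ∧ ψ.eval M ρ
  | _, .all φ, ρ => ∀ a < M.w.length, φ.eval M (Fin.snoc (α := fun _ => ℕ) ρ a)

/-- Quantifier depth. -/
def Fml.depth : {d : ℕ} → Fml Λ X ar d → ℕ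
  | _, .letter _ _ => 0
  | _, .lt _ _ => 0
  | _, .so _ _ _ => 0
  | _, .not φ => φ.depth
  | _, .and φ ψ => max φ.depth ψ.depth
  | _, .all φ => φ.depth + 1

/-- The tape with contents `w`. -/
def wordTape {Γ : Type} (w : List Γ) : ATape Γ := fun i => if 0 ≤ i then w[i.toNat]? else none

theorem isWord_wordTape {Γ : Type} (w : List Γ) : Frag.IsWord (wordTape w) w.length := by
  intro i
  unfold wordTape
  split_ifs with h
  · simp; omega
  · simp [h]

theorem wordTape_natCast {Γ : Type} (w : List Γ) (i : ℕ) : wordTape w i = w[i]? := by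
  simp [wordTape]

/-- The tape alphabet. -/
abbrev TSym (Λ X : Type) : Type := Λ ⊕ (X → Bool)

/-- A cell holds one bit for each relation name, so that a single tape carries all relations of a
family. -/
def bitAt (x : X) : Option (TSym Λ X) → Bool
  | some (.inr u) => u x
  | _ => false

/-- The relations represented by a tape, for words of length `N`. -/
def relsOf (ar : X → ℕ) (N : ℕ) (T : ATape (TSym Λ X)) : Rels X ar :=
  fun x q => bitAt x (T (Nat.ofDigits N (List.ofFn q) : ℕ)) = true

section
variable {C Rr : Type} [DecidableEq C] [DecidableEq Rr]

open Classical Frag in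
/-- The evaluation of a formula. The variables are kept in the counters `v`. -/
noncomputable def ev (ys : List C) (z : C) (sot : Bool → Rr) : {d : ℕ} → Fml Λ X ar d →
    (Fin d → C) → List C → Frag (C ⊕ Rr) (TSym Λ X) Bool
  | _, .letter i a, v, _ => readCtr (v i) fun h => decide (h = some (.inl a))
  | _, .lt i j, v, _ => ltTest (v i) (v j) z
  | _, .so b x f, v, _ => lookup ys z (sot b) (bitAt x) (List.ofFn fun k => v (f k))
  | _, .not φ, v, fr => bind (ev ys z sot φ v fr) fun r => mv (fun _ => none) (!r)
  | _, .and φ ψ, v, fr => bind (ev ys z sot φ v fr) fun r =>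
      if r then ev ys z sot ψ v fr else mv (fun _ => none) false
  | _, .all φ, v, fr => match fr with
    | [] => mv (fun _ => none) false
    | y :: fr => allF y (ev ys z sot φ (Fin.snoc (α := fun _ => C) v y) fr)

theorem PolyBdd.nestTime {t : ℕ → ℕ} (ht : PolyBdd t) (l : ℕ) :
    PolyBdd fun N => Frag.nestTime N (t N) l := by
  induction l with
  | zero => exact ht
  | succ l ih =>
    exact ((PolyBdd.id.add (.const 1)).mul (ih.add (.const 2))).add
      (((PolyBdd.const 2).mul .id).add (.const 3))

theorem PolyBdd.timesTime {t : ℕ → ℕ} (ht : PolyBdd t) : PolyBdd fun N => Frag.timesTime N (t N) :=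
  (PolyBdd.const 1).add (((PolyBdd.id.add (.const 1)).mul (ht.add (.const 2))).add
    ((PolyBdd.id.add (.const 1)).mul (.const 2)))

theorem PolyBdd.idxTime {t : ℕ → ℕ} (ht : PolyBdd t) (k l : ℕ) :
    PolyBdd fun N => Frag.idxTime N (t N) k l := by
  induction l with
  | zero => exact .const 1
  | succ l ih => exact (ht.nestTime k).timesTime.add ih

-- Letters, comparisons and relation atoms are decided in polynomial time, and each quantifier is a
-- loop over all positions with its own counter from `fr`. As the formula is fixed, polynomial
-- bounds are combined only a fixed number of times. By `hfr` the fresh counters do not run out, so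
-- the default value of `ev` is never reached.
open Classical Frag in
theorem det_ev (ys : List C) (hys : ys.Nodup) (z : C) (hz : z ∉ ys) (sot : Bool → Rr)
    (har : ∀ x, ar x ≤ ys.length) {d : ℕ} (φ : Fml Λ X ar d) (v : Fin d → C) (fr : List C)
    (hfr : φ.depth ≤ fr.length) (hnd : fr.Nodup) (hfz : ∀ y ∈ fr, y ≠ z ∧ y ∉ ys)
    (hv : ∀ i, v i ≠ z ∧ v i ∉ ys ∧ v i ∉ fr) :
    ∃ t, PolyBdd t ∧ ∀ (w : List Λ) (ρ : Fin d → ℕ) (x : C → ℤ) (s : Rr → ATape (TSym Λ X)),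
      (∀ i, ρ i < w.length) → (∀ i, x (v i) = ρ i) → x z = 0 → (∀ y ∈ ys, x y = 0) →
      (∀ y ∈ fr, x y = 0) → (ev ys z sot φ v fr).Det (tp (wordTape (w.map .inl)) x s) (t w.length)
        (decide (φ.eval ⟨w, fun b => relsOf ar w.length (s (sot b))⟩ ρ))
        (tp (wordTape (w.map .inl)) x s) := by
  have hW : ∀ w : List Λ, IsWord (wordTape (w.map (Sum.inl (β := X → Bool)))) w.length := fun w => by
    simpa using isWord_wordTape (w.map (Sum.inl (β := X → Bool)))
  induction φ generalizing fr with
  | letter i a =>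
    refine ⟨_, .const 1, fun w ρ x s hρ hx _ _ _ => ?_⟩
    have := det_readCtr (Rr := Rr) (v i) (fun h => decide (h = some (.inl a)))
      (wordTape (w.map (Sum.inl (β := X → Bool)))) x s
    rw [hx, wordTape_natCast] at this
    simp only [ev, Fml.eval]
    convert this using 2
    refine decide_eq_decide.2 ?_
    simp [Option.map_eq_some_iff]
  | lt i j =>
    refine ⟨_, ((PolyBdd.const 5).mul .id).add (.const 6), fun w ρ x s hρ hx hz' _ _ => ?_⟩
    have := det_ltTest (hW w) (hv i).1 (hv j).1 (hx i) (hx j) (hρ i) (hρ j) hz' s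
    simp only [ev, Fml.eval]
    convert this using 2
    exact decide_eq_decide.2 Iff.rfl
  | so b x f =>
    refine ⟨_, ((PolyBdd.const 2).mul (.idxTime (.const 1) ys.length (ar x))).add (.const 2),
      fun w ρ xx s hρ hx hz' hy _ => ?_⟩
    have := det_lookup (hW w) hys hz (sot b) (bitAt x) hz' hy (cs := List.ofFn fun k => v (f k))
      (vs := List.ofFn fun k => ρ (f k)) ?_ (by simpa using har x) s
    · simp only [ev, Fml.eval, relsOf]
      convert this using 2
      · rw [List.length_ofFn]
      · exact Bool.decide_eq_true
    · rw [List.forall₂_iff_get]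
      refine ⟨by simp, fun i h1 h2 => ?_⟩
      simp only [List.get_eq_getElem, List.getElem_ofFn]
      exact ⟨(hv _).1, (hv _).2.1, hx _, hρ _⟩
  | not φ ih =>
    obtain ⟨t, ht, h⟩ := ih v fr hfr hnd hfz hv
    refine ⟨_, ht.add (.const 1), fun w ρ x s h1 h2 h3 h4 h5 => ?_⟩
    have e1 := (h w ρ x s h1 h2 h3 h4 h5).then (k := fun r => mv (fun _ => none) (!r))
      (det_mv _ _ _ _ _)
    rw [adv_none] at e1
    simp only [ev, Fml.eval]
    convert e1 using 2
    exact (decide_eq_decide.2 Iff.rfl).trans decide_not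
  | and φ ψ ihφ ihψ =>
    simp only [Fml.depth, max_le_iff] at hfr
    obtain ⟨t, ht, h⟩ := ihφ v fr hfr.1 hnd hfz hv
    obtain ⟨t', ht', h'⟩ := ihψ v fr hfr.2 hnd hfz hv
    refine ⟨_, ht.add (ht'.add (.const 1)), fun w ρ x s h1 h2 h3 h4 h5 => ?_⟩
    have e1 := h w ρ x s h1 h2 h3 h4 h5
    have e2 := h' w ρ x s h1 h2 h3 h4 h5
    show Det _ _ (t w.length + (t' w.length + 1)) _ _
    simp only [ev, Fml.eval]
    by_cases hp : φ.eval ⟨w, fun b => relsOf ar w.length (s (sot b))⟩ ρ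
    · rw [decide_eq_true hp] at e1
      simp only [hp, true_and]
      exact e1.then (t' := t' w.length + 1)
        (k := fun r => if r then ev ys z sot ψ v fr else mv (fun _ => none) false)
        (e2.mono (by omega))
    · rw [decide_eq_false hp] at e1
      simp only [hp, false_and, decide_false]
      have e3 := det_mv (Rr := Rr) (fun _ => none) false (wordTape (w.map (Sum.inl (β := X → Bool))))
        x s
      rw [adv_none] at e3
      exact e1.then (t' := t' w.length + 1)
        (k := fun r => if r then ev ys z sot ψ v fr else mv (fun _ => none) false)
        (e3.mono (by omega))
  | @all d φ ih =>
    obtain _ | ⟨y, fr⟩ := fr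
    · simp [Fml.depth] at hfr
    simp only [Fml.depth, List.length_cons, Nat.add_le_add_iff_right] at hfr
    rw [List.nodup_cons] at hnd
    have hy := hfz y (by simp)
    obtain ⟨t, ht, h⟩ := ih (Fin.snoc (α := fun _ => C) v y) fr hfr hnd.2
      (fun y hy => hfz y (by simp [hy])) (by
        intro i
        refine Fin.lastCases ?_ (fun i => ?_) i
        · simp only [Fin.snoc_last]
          exact ⟨hy.1, hy.2, hnd.1⟩
        · simp only [Fin.snoc_castSucc]
          exact ⟨(hv i).1, (hv i).2.1, fun h => (hv i).2.2 (by simp [h])⟩)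
    refine ⟨_, (((PolyBdd.id.add (.const 1)).mul (ht.add (.const 2))).add
      (((PolyBdd.const 2).mul .id).add (.const 3))).add (.const 1), fun w ρ x s h1 h2 h3 h4 h5 => ?_⟩
    simp only [ev, Fml.eval]
    suffices hs : ∀ i < w.length, (ev ys z sot φ (Fin.snoc (α := fun _ => C) v y) fr).Det
        (tp (wordTape (w.map .inl)) (Function.update x y (i : ℤ)) s) (t w.length)
        (decide (φ.eval ⟨w, fun b => relsOf ar w.length (s (sot b))⟩
          (Fin.snoc (α := fun _ => ℕ) ρ i)))
        (tp (wordTape (w.map .inl)) (Function.update x y (i : ℤ)) s) by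
      convert det_allF (hW w) (h5 y (by simp)) hs using 2
      exact decide_eq_decide.2 Iff.rfl
    intro i hi
    refine h w _ _ s ?_ ?_ ?_ ?_ ?_
    · intro j
      refine Fin.lastCases ?_ (fun j => ?_) j
      · simpa using hi
      · simpa using h1 j
    · intro j
      refine Fin.lastCases ?_ (fun j => ?_) j
      · simp
      · have : v j ≠ y := fun h => (hv j).2.2 (by simp [h])
        simpa [this] using h2 j
    · rw [Function.update_of_ne (Ne.symm hy.1)]
      exact h3
    · intro y' hy'
      rw [Function.update_of_ne (by rintro rfl; exact hy.2 hy')]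
      exact h4 y' hy'
    · intro y' hy'
      rw [Function.update_of_ne (by rintro rfl; exact hnd.1 hy')]
      exact h5 y' (by simp [hy'])

end
end
/-! ### From fragments to machines -/

theorem mk₁_nth {Γ : Type} (w : List Γ) :
    (Tape.mk₁ (w.map some) : Tape (Option Γ)).nth = wordTape w := by
  funext i
  unfold wordTape
  split_ifs with h
  · obtain ⟨n, rfl⟩ := Int.eq_ofNat_of_zero_le h
    rw [Int.toNat_natCast]
    rw [Tape.mk₁, Tape.mk₂, Tape.mk'_nth_nat, ListBlank.nth_mk, List.getI_eq_getElem?_getD]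
    cases hw : w[n]? <;> simp [hw]; rfl
  · obtain ⟨n, rfl⟩ := Int.eq_negSucc_of_lt_zero (not_le.1 h)
    show ListBlank.nth (Tape.mk₁ (w.map some)).left n = none
    simp [Tape.mk₁, Tape.mk₂, Tape.mk', ListBlank.nth_mk]
    rfl

namespace NTM

variable {α : Type} {M : NTM α}

/-- The tapes of a configuration, as functions. -/
def Cfg.abs (c : M.Cfg) : M.K → ATape M.Γ := fun k => (c.tapes k).nth

theorem step_iff {c c' : M.Cfg} : M.Step c c' ↔ ∃ a, (c'.state, a) ∈ M.δ c.state (fun k => c.abs k 0) ∧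
    c'.abs = fun k => aact (c.abs k) (a k) := by
  refine exists_congr fun a => and_congr Iff.rfl ⟨fun h => ?_, fun h => ?_⟩
  · funext k
    rw [Cfg.abs, h, act_nth]
    rfl
  · funext k
    apply Tape.nth_injective
    rw [act_nth]
    exact congrFun h k

theorem exists_next (c : M.Cfg) (q : M.Q) (a : M.K → Option M.Γ × Option Dir) :
    ∃ c' : M.Cfg, c'.state = q ∧ c'.abs = fun k => aact (c.abs k) (a k) :=
  ⟨⟨q, fun k => act (c.tapes k) (a k)⟩, rfl, by funext k; rw [Cfg.abs, act_nth]; rfl⟩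

theorem init_abs (w : List α) : (M.init w).abs = fun k => if k = M.inTape then
    wordTape (w.map M.inSym) else fun _ => none := by
  funext k
  simp only [Cfg.abs, init]
  split_ifs with h
  · rw [← mk₁_nth, List.map_map]; rfl
  · have := mk₁_nth (Γ := M.Γ) []
    rw [List.map_nil] at this
    rw [this]
    funext i
    simp [wordTape]

end NTM

section
variable {K Γ α : Type} [DecidableEq K] [Finite K] [Finite Γ]

/-- The machine that accepts in the exit `true` of `c`. -/
def Frag.toNTM (c : Frag K Γ Bool) (inTape : K) (inSym : α → Γ)
    (hin : Function.Injective inSym) : NTM α where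
  K := K
  decEq_K := inferInstance
  finite_K := inferInstance
  Γ := Γ
  finite_Γ := inferInstance
  Q := c.Q ⊕ Bool
  finite_Q := by have := c.finite_Q; infer_instance
  inTape := inTape
  inSym := inSym
  inSym_injective := hin
  start := .inl c.start
  accept := .inr true
  δ q h := Sum.elim (fun q => c.δ q h) (fun _ => ∅) q

theorem Frag.toNTM_step {c : Frag K Γ Bool} {inTape : K} {inSym : α → Γ}
    {hin : Function.Injective inSym} {x x' : (c.toNTM inTape inSym hin).Cfg} :
    (c.toNTM inTape inSym hin).Step x x' ↔ c.Step (x.state, x.abs) (x'.state, x'.abs) := by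
  rw [NTM.step_iff]
  obtain ⟨q | e, T⟩ := x
  · constructor
    · rintro ⟨a, h1, h2⟩
      exact ⟨q, rfl, a, h1, h2⟩
    · rintro ⟨q', h, a, h1, h2⟩
      obtain rfl := Sum.inl.inj h
      exact ⟨a, h1, h2⟩
  · constructor
    · rintro ⟨a, h1, h2⟩
      exact h1.elim
    · rintro ⟨q', h, -⟩
      cases h

/-- An arbitrary abstract tape need not come from a machine tape, but the successors of one that
does come from machine tapes again; hence abstract runs lift to runs of the machine. -/
theorem Frag.toNTM_next {c : Frag K Γ Bool} {inTape : K} {inSym : α → Γ}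
    {hin : Function.Injective inSym} {x : (c.toNTM inTape inSym hin).Cfg} {y : c.Cfg}
    (h : c.Step (x.state, x.abs) y) : ∃ x' : (c.toNTM inTape inSym hin).Cfg,
      (x'.state, x'.abs) = y ∧ (c.toNTM inTape inSym hin).Step x x' := by
  obtain ⟨q, h1, a, h2, h3⟩ := id h
  obtain ⟨x', h4, h5⟩ := NTM.exists_next (M := c.toNTM inTape inSym hin) x y.1 a
  have h6 : (x'.state, x'.abs) = y := Prod.ext h4 (h5.trans h3.symm)
  exact ⟨x', h6, Frag.toNTM_step.2 (h6 ▸ h)⟩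

theorem Frag.Bnd.le {c : Frag K Γ Bool} {inTape : K} {inSym : α → Γ}
    {hin : Function.Injective inSym} {t n : ℕ} {x x' : (c.toNTM inTape inSym hin).Cfg}
    (h : c.Bnd t (x.state, x.abs)) (h' : StepsTo (c.toNTM inTape inSym hin).Step n x x') : n ≤ t := by
  induction t generalizing x n with
  | zero =>
    cases n with
    | zero => rfl
    | succ n =>
      obtain ⟨y, h1, -⟩ := h'
      exact absurd (toNTM_step.1 h1) (h _)
  | succ t ih =>
    cases n with
    | zero => omega
    | succ n =>
      obtain ⟨y, h1, h2⟩ := h'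
      have := ih (h _ (toNTM_step.1 h1)) h2
      omega

theorem exists_stepsTo_iff {X : Type} {r : X → X → Prop} {a b : X} :
    (∃ n, StepsTo r n a b) ↔ Relation.ReflTransGen r a b := by
  constructor
  · rintro ⟨n, h⟩
    induction n generalizing a with
    | zero =>
      obtain rfl : a = b := h
      exact .refl
    | succ n ih =>
      obtain ⟨c, h1, h2⟩ := h
      exact .head h1 (ih h2)
  · intro h
    induction h using Relation.ReflTransGen.head_induction_on with
    | refl => exact ⟨0, rfl⟩
    | head h _ ih =>
      obtain ⟨n, hn⟩ := ih
      exact ⟨n + 1, _, h, hn⟩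

theorem Frag.toNTM_reach {c : Frag K Γ Bool} {inTape : K} {inSym : α → Γ}
    {hin : Function.Injective inSym} (x : (c.toNTM inTape inSym hin).Cfg) :
    (∃ n x', StepsTo (c.toNTM inTape inSym hin).Step n x x' ∧ x'.state = .inr true) ↔
      ∃ B, c.Reach (x.state, x.abs) (.inr true, B) := by
  rw [exists_comm]
  simp only [exists_and_right, exists_stepsTo_iff]
  constructor
  · rintro ⟨x', h, hx'⟩
    refine ⟨x'.abs, ?_⟩
    rw [← hx']
    clear hx'
    induction h with
    | refl => exact .refl
    | tail _ h ih => exact ih.tail (toNTM_step.1 h)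
  · rintro ⟨B, h⟩
    obtain ⟨s, hs⟩ : ∃ s : c.Cfg, s = (x.state, x.abs) := ⟨_, rfl⟩
    replace h : c.Reach s (.inr true, B) := hs ▸ h
    induction h using Relation.ReflTransGen.head_induction_on generalizing x with
    | refl => exact ⟨x, .refl, (Prod.ext_iff.1 hs).1.symm⟩
    | head h _ ih =>
      subst hs
      obtain ⟨x', h1, h2⟩ := toNTM_next h
      obtain ⟨x'', h3, h4⟩ := ih x' h1.symm
      exact ⟨x'', .head h2 h3, h4⟩

theorem Frag.toNTM_decides {c : Frag K Γ Bool} {inTape : K} {inSym : α → Γ}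
    (hin : Function.Injective inSym) {L : Set (List α)} {t : ℕ → ℕ} (ht : PolyBdd t)
    {R : List α → Bool → (K → ATape Γ) → Prop}
    (h : ∀ w, c.Spec (fun k => if k = inTape then wordTape (w.map inSym) else fun _ => none)
      (t w.length) (R w)) (hR : ∀ w, w ∈ L ↔ ∃ B, R w true B) : L ∈ NP α := by
  obtain ⟨p, hp⟩ := ht
  have hinit : ∀ w, ((c.toNTM inTape inSym hin).init w).abs =
      fun k => if k = inTape then wordTape (w.map inSym) else fun _ => none := fun w =>
    NTM.init_abs (M := c.toNTM inTape inSym hin) w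
  refine ⟨c.toNTM inTape inSym hin, ⟨p, fun w n x hx => (Bnd.le ?_ hx).trans (hp _)⟩, fun w => ?_⟩
  · rw [hinit]
    exact (h w).1
  · rw [hR]
    refine Iff.trans (exists_congr fun B => ?_) (toNTM_reach _).symm
    rw [hinit]
    exact ((h w).2 true B).symm

/-- The oracle machine that queries the oracle in the exit of `c`, accepting if the answer is
negative. -/
def Frag.toOracle {β : Type} (c : Frag K Γ Unit) (inTape : K) (inSym : α → Γ)
    (hin : Function.Injective inSym) (oracleTape : K) (oracleSym : β → Γ)
    (ho : Function.Injective oracleSym) : OracleNTM α β where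
  K := K
  decEq_K := inferInstance
  finite_K := inferInstance
  Γ := Γ
  finite_Γ := inferInstance
  Q := (c.Q ⊕ Unit) ⊕ Bool
  finite_Q := by have := c.finite_Q; infer_instance
  inTape := inTape
  inSym := inSym
  inSym_injective := hin
  start := .inl (.inl c.start)
  accept := .inr false
  δ q h := Sum.elim (Sum.elim (fun q => (fun p => (.inl p.1, p.2)) '' c.δ q h) (fun _ => ∅))
    (fun _ => ∅) q
  oracleTape := oracleTape
  oracleSym := oracleSym
  oracleSym_injective := ho
  query := .inl (.inr ())
  yes := .inr true
  no := .inr false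

section
variable {β : Type} {c : Frag K Γ Unit} {inTape : K} {inSym : α → Γ}
  {hin : Function.Injective inSym} {oracleTape : K} {oracleSym : β → Γ}
  {ho : Function.Injective oracleSym} {A : Set (List β)}

local notation "MO" => Frag.toOracle c inTape inSym hin oracleTape oracleSym ho

theorem Frag.toOracle_step {x x' : (MO).Cfg} {q : c.Q} (hx : x.state = .inl (.inl q)) :
    (MO).Step A x x' ↔ ∃ y : c.Cfg, c.Step (.inl q, x.abs) y ∧ x'.state = .inl y.1 ∧ x'.abs = y.2 := by
  have h1 : (MO).Step A x x' ↔ (MO).toNTM.Step x x' := by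
    constructor
    · rintro (⟨-, h⟩ | ⟨h, -⟩)
      · exact h
      · rw [hx] at h
        simp [toOracle] at h
    · intro h
      exact .inl ⟨by rw [hx]; simp [toOracle], h⟩
  rw [h1, NTM.step_iff]
  constructor
  · rintro ⟨a, h2, h3⟩
    rw [hx] at h2
    obtain ⟨⟨r, b⟩, h4, h5⟩ := h2
    obtain ⟨h6, rfl⟩ := Prod.mk.inj h5
    exact ⟨(r, _), ⟨q, rfl, b, h4, rfl⟩, h6.symm, h3⟩
  · rintro ⟨⟨r, B⟩, ⟨q', h2, a, h3, h4⟩, h5, h6⟩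
    obtain rfl := Sum.inl.inj h2
    refine ⟨a, ?_, h6.trans h4⟩
    rw [hx]
    exact ⟨(r, a), h3, Prod.ext h5.symm rfl⟩

theorem Frag.toOracle_next {x : (MO).Cfg} {q : c.Q} (hx : x.state = .inl (.inl q)) {y : c.Cfg}
    (h : c.Step (.inl q, x.abs) y) :
    ∃ x' : (MO).Cfg, x'.state = .inl y.1 ∧ x'.abs = y.2 ∧ (MO).Step A x x' := by
  obtain ⟨q', h1, a, h2, h3⟩ := id h
  obtain ⟨x', h4, h5⟩ := NTM.exists_next (M := (MO).toNTM) x (.inl y.1) a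
  exact ⟨x', h4, h5.trans h3.symm, (toOracle_step hx).2 ⟨y, h, h4, h5.trans h3.symm⟩⟩

theorem Frag.toOracle_positive {x : (MO).Cfg} : (MO).Positive A x ↔
    ∃ u ∈ A, x.abs oracleTape = wordTape (u.map oracleSym) := by
  refine exists_congr fun u => and_congr Iff.rfl ?_
  rw [← mk₁_nth, List.map_map]
  exact ⟨fun h => congrArg Tape.nth h, fun h => Tape.nth_injective h⟩

theorem Frag.toOracle_halt {x x' : (MO).Cfg} {b : Bool} (hx : x.state = .inr b) :
    ¬ (MO).Step A x x' := by
  rintro (⟨-, h⟩ | ⟨h, -⟩)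
  · obtain ⟨a, h1, -⟩ := h
    rw [hx] at h1
    exact h1.elim
  · rw [hx] at h
    simp [toOracle] at h

theorem Frag.toOracle_query {x x' : (MO).Cfg} (hx : x.state = .inl (.inr ()))
    (h : (MO).Step A x x') : x'.abs = x.abs ∧ (((MO).Positive A x ∧ x'.state = .inr true) ∨
      (¬ (MO).Positive A x ∧ x'.state = .inr false)) := by
  rcases h with ⟨h, -⟩ | ⟨-, h, h'⟩
  · exact absurd hx h
  · refine ⟨?_, h'⟩
    funext k
    rw [NTM.Cfg.abs, h]
    rfl

/-- The additional step is the single oracle query, after which the machine halts. -/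
theorem Frag.Bnd.oracle_le {t n : ℕ} {s : c.Cfg} {x x' : (MO).Cfg} (h : c.Bnd t s)
    (hs : x.state = .inl s.1) (hs' : x.abs = s.2) (h' : StepsTo ((MO).Step A) n x x') :
    n ≤ t + 1 := by
  have hq : ∀ x y : (MO).Cfg, x.state = .inl (.inr ()) → (MO).Step A x y → ∀ m,
      StepsTo ((MO).Step A) m y x' → m = 0 := by
    intro x y hx hxy m hm
    cases m with
    | zero => rfl
    | succ m =>
      obtain ⟨z, hz, -⟩ := hm
      rcases (toOracle_query hx hxy).2 with ⟨-, h⟩ | ⟨-, h⟩ <;> exact absurd hz (toOracle_halt h)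
  induction t generalizing x n s with
  | zero =>
    cases n with
    | zero => omega
    | succ n =>
      obtain ⟨y, h1, h2⟩ := h'
      obtain ⟨q | _, B⟩ := s
      · subst hs'
        obtain ⟨y', h3, -⟩ := (toOracle_step hs).1 h1
        exact absurd h3 (h _)
      · have := hq x y hs h1 n h2
        omega
  | succ t ih =>
    cases n with
    | zero => omega
    | succ n =>
      obtain ⟨y, h1, h2⟩ := h'
      obtain ⟨q | _, B⟩ := s
      · subst hs'
        obtain ⟨y', h3, h4, h5⟩ := (toOracle_step hs).1 h1
        have := ih (h _ h3) h4 h5 h2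
        omega
      · have := hq x y hs h1 n h2
        omega

theorem Frag.toOracle_reach {s : c.Cfg} (x : (MO).Cfg) (hs : x.state = .inl s.1)
    (hs' : x.abs = s.2) :
    (∃ n x', StepsTo ((MO).Step A) n x x' ∧ x'.state = .inr false) ↔
      ∃ B, c.Reach s (.inr (), B) ∧ ¬ ∃ u ∈ A, B oracleTape = wordTape (u.map oracleSym) := by
  rw [exists_comm]
  simp only [exists_and_right, exists_stepsTo_iff]
  constructor
  · rintro ⟨x', h, hx'⟩
    induction h using Relation.ReflTransGen.head_induction_on generalizing s with
    | refl =>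
      rw [hx'] at hs
      cases hs
    | @head x y h h' ih =>
      obtain ⟨q | _, B⟩ := s
      · subst hs'
        obtain ⟨y', h3, h4, h5⟩ := (toOracle_step hs).1 h
        obtain ⟨B, h6, h7⟩ := ih h4 h5
        exact ⟨B, .head h3 h6, h7⟩
      · refine ⟨B, .refl, ?_⟩
        subst hs'
        rcases toOracle_query hs h with ⟨-, ⟨-, h1⟩ | ⟨h1, -⟩⟩
        · rcases Relation.ReflTransGen.cases_head h' with rfl | ⟨z, hz, -⟩
          · rw [hx'] at h1
            cases h1
          · exact absurd hz (toOracle_halt h1)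
        · rwa [toOracle_positive] at h1
  · rintro ⟨B, h, hB⟩
    generalize hu : ((.inr (), B) : c.Cfg) = u at h
    induction h using Relation.ReflTransGen.head_induction_on generalizing x with
    | refl =>
      subst hu
      subst hs'
      refine ⟨⟨.inr false, x.tapes⟩, .single (.inr ⟨hs, rfl, .inr ⟨?_, rfl⟩⟩), rfl⟩
      rwa [toOracle_positive]
    | @head s s' h _ ih =>
      obtain ⟨q | _, B⟩ := s
      · subst hs'
        obtain ⟨x', h1, h2, h3⟩ := toOracle_next hs h
        obtain ⟨x'', h4, h5⟩ := ih x' h1 h2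
        exact ⟨x'', .head h3 h4, h5⟩
      · exact absurd h (not_step_exit c _ _ _)

end

theorem Frag.toOracle_decides {β : Type} {c : Frag K Γ Unit} {inTape : K} {inSym : α → Γ}
    (hin : Function.Injective inSym) {oracleTape : K} {oracleSym : β → Γ}
    (ho : Function.Injective oracleSym) {A : Set (List β)} (hA : A ∈ NP β)
    {L : Set (List α)} {t : ℕ → ℕ} (ht : PolyBdd t)
    {R : List α → Unit → (K → ATape Γ) → Prop}
    (h : ∀ w, c.Spec (fun k => if k = inTape then wordTape (w.map inSym) else fun _ => none)
      (t w.length) (R w))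
    (hR : ∀ w, w ∈ L ↔ ∃ B, R w () B ∧ ¬ ∃ u ∈ A, B oracleTape = wordTape (u.map oracleSym)) :
    L ∈ NPwithNPOracle α := by
  obtain ⟨p, hp⟩ := ht.add (.const 1)
  have hinit : ∀ w, ((c.toOracle inTape inSym hin oracleTape oracleSym ho).init w).abs =
      fun k => if k = inTape then wordTape (w.map inSym) else fun _ => none := fun w =>
    NTM.init_abs (M := (c.toOracle inTape inSym hin oracleTape oracleSym ho).toNTM) w
  refine ⟨β, A, c.toOracle inTape inSym hin oracleTape oracleSym ho, hA,
    ⟨p, fun w n x hx => (Bnd.oracle_le (h w).1 rfl (hinit w) hx).trans (hp _)⟩, fun w => ?_⟩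
  rw [hR]
  refine Iff.trans (exists_congr fun B => and_congr_left' ?_) (toOracle_reach (s := (.inl c.start, _)) _ rfl (hinit w)).symm
  exact ((h w).2 () B).symm

end

/-! ### Descriptive characterizations of languages in `NP` and `NP^NP` -/

theorem aact_append {Γ : Type} (u : List Γ) (a : Γ) :
    aact (shift (wordTape u) u.length) (some a, some .right) =
      shift (wordTape (u ++ [a])) (u ++ [a]).length := by
  rw [aact_shift]
  have h : Function.update (wordTape u) (u.length : ℤ) (some a) = wordTape (u ++ [a]) := by
    funext i
    rcases lt_or_ge i 0 with hi | hi
    · rw [Function.update_of_ne (by omega)]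
      simp [wordTape, not_le.2 hi]
    · obtain ⟨n, rfl⟩ := Int.eq_ofNat_of_zero_le hi
      rw [wordTape_natCast]
      by_cases hn : n = u.length
      · subst hn; simp
      · rw [Function.update_of_ne (by exact_mod_cast hn), wordTape_natCast]
        rcases lt_or_gt_of_ne hn with h | h
        · rw [List.getElem?_append_left h]
        · rw [List.getElem?_eq_none (by omega), List.getElem?_eq_none (by simp; omega)]
  rw [h]
  simp [dirOff]

theorem shift_wordTape_nil {Γ : Type} (p : ℤ) : shift (wordTape ([] : List Γ)) p = fun _ => none := by
  funext i; simp [shift, wordTape]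

/-! ### Preparing the tapes and guessing -/

section
variable {Λ X : Type}

/-- The maximal prefix over `Λ`. -/
def pre : List (TSym Λ X) → List Λ
  | .inl a :: z => a :: pre z
  | _ => []

theorem pre_map_append (w : List Λ) (l : List (X → Bool)) :
    pre (w.map .inl ++ l.map .inr) = w := by
  induction w with
  | nil => cases l <;> rfl
  | cons a w ih => simp [pre, ih]

theorem pre_map (w : List Λ) : pre (w.map (Sum.inl (β := X → Bool))) = w := by
  simpa using pre_map_append w ([] : List (X → Bool))

theorem pre_length_le (z : List (TSym Λ X)) : (pre z).length ≤ z.length := by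
  induction z with
  | nil => rfl
  | cons a z ih =>
    cases a with
    | inl a => simp only [pre, List.length_cons]; omega
    | inr a => exact Nat.zero_le _

namespace Frag
variable {C E : Type}

/-- The non-counter tapes while the word `u` is being written; `cp` tells whether it is also
written on the tape `true`. -/
def restTapes {Γ : Type} (u : List Γ) (I : ATape Γ) (cp : Bool) : Bool → ATape Γ :=
  fun b => if b then (if cp then shift (wordTape u) u.length else fun _ => none) else I

def writing (C : Type) {Γ : Type} (u : List Γ) (I : ATape Γ) (cp : Bool) : C ⊕ Bool → ATape Γ :=
  tp (wordTape u) (fun _ => u.length) (restTapes u I cp)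

/-- The actions writing `a`, with the input head moving by `d`. -/
def writeAct {Γ : Type} (cp : Bool) (a : Γ) (d : Option Dir) (h : C ⊕ Bool → Option Γ) :
    C ⊕ Bool → Option Γ × Option Dir
  | .inl _ => (some a, some .right)
  | .inr false => (h (.inr false), d)
  | .inr true => if cp then (some a, some .right) else (h (.inr true), none)

theorem writing_act {Γ : Type} (cp : Bool) (a : Γ) (d : Option Dir) (u : List Γ) (I : ATape Γ) :
    (fun k => aact (writing C u I cp k) (writeAct cp a d (fun k => writing C u I cp k 0) k)) =
      writing C (u ++ [a]) (shift I (dirOff d)) cp := by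
  funext k
  rcases k with c | b
  · exact aact_append u a
  · cases b
    · simp only [writeAct, aact_same]
      rfl
    · cases cp
      · simp only [writeAct, Bool.false_eq_true, if_false, aact_same, shift_none]
        rfl
      · exact aact_append u a

/-- A step of `copyIn`, depending on the symbol on the input tape. -/
def copyStep (cp : Bool) (h : C ⊕ Bool → Option (TSym Λ X)) : Option (TSym Λ X) →
    Option Unit × (C ⊕ Bool → Option (TSym Λ X) × Option Dir)
  | some (.inl a) => (none, writeAct cp (.inl a) (some .right) h)
  | _ => (some (), fun k => (h k, none))

/-- Copy the maximal prefix over `Λ` of the input to the counters. -/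
def copyIn (C : Type) (Λ X : Type) (cp : Bool) : Frag (C ⊕ Bool) (TSym Λ X) Unit :=
  loop (dprim fun h => copyStep cp h (h (.inr false)))

/-- The words `u` (already written) and `v` (already read) are kept general for the induction on the
unread part `z`. The input head stops behind the prefix over `Λ`, that is, at the start of a
relation word if one follows; this is how the oracle machine receives its first family of relations.
-/
theorem det_copyIn (cp : Bool) (u v z : List (TSym Λ X)) :
    (copyIn C Λ X cp).Det (writing C u (shift (wordTape (v ++ z)) v.length) cp)
      ((pre z).length + 1) ()
      (writing C (u ++ (pre z).map .inl)
        (shift (wordTape (v ++ z)) (v.length + (pre z).length : ℕ)) cp) := by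
  have hread : ∀ u v z : List (TSym Λ X), writing C u (shift (wordTape (v ++ z)) v.length) cp
      (.inr false) 0 = z[0]? := by
    intro u v z
    show shift (wordTape (v ++ z)) v.length 0 = _
    rw [shift_head, wordTape_natCast, List.getElem?_append_right le_rfl, Nat.sub_self]
  have hstep := fun u v z : List (TSym Λ X) => det_dprim (fun h : C ⊕ Bool → Option (TSym Λ X) =>
    copyStep cp h (h (.inr false))) (writing C u (shift (wordTape (v ++ z)) v.length) cp)
  simp only [hread] at hstep
  have hblank : ∀ u v z : List (TSym Λ X), pre z = [] → (∀ a, z[0]? ≠ some (.inl a)) →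
      (copyIn C Λ X cp).Det (writing C u (shift (wordTape (v ++ z)) v.length) cp)
      ((pre z).length + 1) ()
      (writing C (u ++ (pre z).map .inl)
        (shift (wordTape (v ++ z)) (v.length + (pre z).length : ℕ)) cp) := by
    intro u v z hz hz'
    have h1 := hstep u v z
    rw [hz]
    simp only [List.map_nil, List.append_nil, List.length_nil, Nat.add_zero, Nat.zero_add]
    have h2 : ∀ h : C ⊕ Bool → Option (TSym Λ X),
        copyStep cp h z[0]? = (some (), fun k => (h k, none)) := by
      intro h
      rcases h : z[0]? with _ | a | b
      · rfl
      · exact absurd h (hz' a)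
      · rfl
    simp only [h2, aact_same, shift_none] at h1
    exact h1.loop_exit
  induction z generalizing u v with
  | nil => exact hblank u v [] rfl (by simp)
  | cons a z ih =>
    rcases a with a | b
    · have h1 := hstep u v (.inl a :: z)
      simp only [List.getElem?_cons_zero, copyStep, writing_act, shift_shift] at h1
      have h2 := ih (u ++ [.inl a]) (v ++ [.inl a])
      have e1 : v ++ [Sum.inl a] ++ z = v ++ Sum.inl a :: z := by simp
      have e2 : u ++ [Sum.inl a] ++ (pre z).map Sum.inl = u ++ (pre (Sum.inl a :: z)).map .inl := by
        simp [pre]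
      have e3 : (v ++ [Sum.inl a]).length + (pre z).length =
          v.length + (pre (Sum.inl a :: z)).length := by simp [pre]; omega
      have e4 : ((v ++ [.inl a] : List (TSym Λ X)).length : ℤ) = v.length + dirOff (some .right) := by
        simp [dirOff]
      rw [e1, e2, e3, e4] at h2
      exact (h1.loop_next h2).mono (by simp [pre]; omega)
    · exact hblank u v (.inr b :: z) rfl (by simp)

/-- Write `e` on the counters. -/
def appendWord (C : Type) (X : Type) (cp : Bool) : List Λ → Frag (C ⊕ Bool) (TSym Λ X) Unit
  | [] => mv (fun _ => none) ()
  | a :: e => bind (dprim fun h => ((), writeAct cp (.inl a) none h)) fun _ => appendWord C X cp e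

theorem det_appendWord (cp : Bool) (e : List Λ) (u : List (TSym Λ X)) (I : ATape (TSym Λ X)) :
    (appendWord C X cp e).Det (writing C u I cp) (e.length + 1) ()
      (writing C (u ++ e.map .inl) I cp) := by
  induction e generalizing u with
  | nil =>
    have := det_mv (fun _ => none) () (wordTape u) (fun _ : C => (u.length : ℤ)) (restTapes u I cp)
    rw [adv_none] at this
    rw [List.map_nil, List.append_nil]
    exact this
  | cons a e ih =>
    have h1 := det_dprim (fun h : C ⊕ Bool → Option (TSym Λ X) =>
      ((), writeAct cp (.inl a) none h)) (writing C u I cp)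
    rw [writing_act, shift_none] at h1
    have h2 := ih (u ++ [.inl a])
    rw [List.append_assoc, List.singleton_append, ← List.map_cons] at h2
    exact (h1.then (k := fun _ => appendWord C X cp e) h2).mono (by simp; omega)

/-- Move all counters back to position `0`. -/
def rewindAll (C : Type) {Γ : Type} (z : C) : Frag (C ⊕ Bool) Γ Unit :=
  bind (mv (fun _ => some .left) ()) fun _ => whileMv z (fun _ => some .left) (fun _ => some .right)

/-- All counters are at the same position, so testing one of them controls the common movement. -/
theorem det_rewindAll {Γ : Type} (z : C) (u : List Γ) (s : Bool → ATape Γ) :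
    (rewindAll C z).Det (tp (wordTape u) (fun _ => u.length) s) (2 * u.length + 3) ()
      (tp (wordTape u) (fun _ => 0) s) := by
  have h1 := det_mv (fun _ => some .left) () (wordTape u) (fun _ : C => (u.length : ℤ)) s
  have hW := isWord_wordTape u
  have h2 := det_whileMv (c := z) (m₁ := fun _ => some .left) (m₂ := fun _ => some .right)
    (W := wordTape u) (x := adv (fun _ : C => (u.length : ℤ)) (fun _ => some .left) 1)
    u.length ?_ ?_ s
  · have h3 := (h1.then (k := fun _ => whileMv z (fun _ => some .left) (fun _ => some .right)) h2).mono
      (t' := 2 * u.length + 3) (by omega)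
    have h4 : adv (adv (adv (fun _ : C => (u.length : ℤ)) (fun _ => some .left) 1)
        (fun _ => some .left) u.length) (fun _ => some .right) 1 = fun _ => 0 := by
      funext c
      simp [adv, dirOff]
    rw [h4] at h3
    exact h3
  · intro i hi
    rw [hW]
    simp [adv, dirOff]
    omega
  · apply hW.none
    simp [adv, dirOff]

/-- Copy the input, append `e`, and rewind. -/
def prepare (C X : Type) (z : C) (e : List Λ) (cp : Bool) : Frag (C ⊕ Bool) (TSym Λ X) Unit :=
  bind (copyIn C Λ X cp) fun _ => bind (appendWord C X cp e) fun _ => rewindAll C z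

theorem det_prepare (z : C) (e : List Λ) (cp : Bool) (w : List (TSym Λ X)) :
    (prepare C X z e cp).Det (writing C [] (wordTape w) cp)
      ((pre w).length + 1 + (e.length + 1 + (2 * ((pre w).length + e.length) + 3))) ()
      (tp (wordTape ((pre w ++ e).map .inl)) (fun _ => 0) (restTapes ((pre w ++ e).map .inl)
        (shift (wordTape w) (pre w).length) cp)) := by
  have h1 := det_copyIn (C := C) cp [] [] w
  simp only [List.nil_append, List.length_nil, Nat.cast_zero, shift_zero, Nat.zero_add] at h1
  have h2 := det_appendWord (C := C) cp e ((pre w).map .inl) (shift (wordTape w) (pre w).length)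
  rw [← List.map_append] at h2
  have h3 := det_rewindAll z ((pre w ++ e).map (Sum.inl (β := X → Bool)))
    (restTapes ((pre w ++ e).map .inl) (shift (wordTape w) (pre w).length) cp)
  refine h1.then (h2.then (k := fun _ => rewindAll C z) (h3.mono ?_))
  simp

def guessAct {Γ : Type} (a : Γ) (h : C ⊕ Bool → Option Γ) : C ⊕ Bool → Option Γ × Option Dir
  | .inl c => (h (.inl c), none)
  | .inr false => (h (.inr false), none)
  | .inr true => (some a, some .right)

/-- Write an arbitrary symbol on the tape `true`. -/
def guess (C Λ X : Type) : Frag (C ⊕ Bool) (TSym Λ X) Unit :=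
  prim fun h => {p | ∃ u, p = ((), guessAct (.inr u) h)}

def GuessRel (s s' : Bool → ATape (TSym Λ X)) : Prop :=
  ∃ u, s' = Function.update s true (aact (s true) (some (.inr u), some .right))

theorem spec_guess (W : ATape (TSym Λ X)) (x : C → ℤ) (s : Bool → ATape (TSym Λ X)) :
    (guess C Λ X).Spec (tp W x s) 1 (fun e B => ∃ s', GuessRel s s' ∧ e = () ∧ B = tp W x s') := by
  refine (spec_prim _ _).mono le_rfl fun e B => ?_
  have key : ∀ u, (fun k => aact (tp W x s k) (guessAct (.inr u) (fun k => tp W x s k 0) k)) =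
      tp W x (Function.update s true (aact (s true) (some (.inr u), some .right))) := by
    intro u
    funext k
    rcases k with c | _ | _ <;> simp only [guessAct, aact_same, shift_none] <;> simp [tp]
  constructor
  · rintro ⟨a, ⟨u, h⟩, rfl⟩
    obtain ⟨-, rfl⟩ := Prod.mk.inj h
    exact ⟨_, ⟨u, rfl⟩, rfl, key u⟩
  · rintro ⟨_, ⟨u, rfl⟩, -, rfl⟩
    exact ⟨_, ⟨u, rfl⟩, (key u).symm⟩

theorem stepsTo_guessRel (n : ℕ) (s s' : Bool → ATape (TSym Λ X)) (t : List (TSym Λ X)) :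
    StepsTo GuessRel n (Function.update s true (shift (wordTape t) t.length)) s' ↔
      ∃ l : List (X → Bool), l.length = n ∧ s' = Function.update s true
        (shift (wordTape (t ++ l.map .inr)) (t.length + n)) := by
  induction n generalizing t with
  | zero => simp [StepsTo, eq_comm (a := s'), List.length_eq_zero_iff]
  | succ n ih =>
    simp only [StepsTo, GuessRel]
    constructor
    · rintro ⟨_, ⟨u, rfl⟩, h⟩
      rw [Function.update_self, Function.update_idem, aact_append, ih] at h
      obtain ⟨l, rfl, rfl⟩ := h
      refine ⟨u :: l, rfl, ?_⟩
      simp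
      congr 2
      ring
    · rintro ⟨_ | ⟨u, l⟩, h, rfl⟩
      · simp at h
      · refine ⟨_, ⟨u, rfl⟩, ?_⟩
        rw [Function.update_self, Function.update_idem, aact_append, ih]
        refine ⟨l, by simpa using h, ?_⟩
        simp
        congr 2
        ring

end Frag
end
-- Second-order sentences and the machines for them
section
variable {Λ X : Type} {ar : X → ℕ}

theorem Fml.eval_congr {M M' : Mdl Λ X ar} (hw : M.w = M'.w)
    (hso : ∀ b x q, (∀ i, q i < M.w.length) → (M.so b x q ↔ M'.so b x q)) {d : ℕ}
    (φ : Fml Λ X ar d) (ρ : Fin d → ℕ) (hρ : ∀ i, ρ i < M.w.length) :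
    φ.eval M ρ ↔ φ.eval M' ρ := by
  induction φ with
  | letter i a => simp only [eval, hw]
  | lt i j => rfl
  | so b x f => exact hso b x _ fun i => hρ _
  | not φ ih => exact not_congr (ih ρ hρ)
  | and φ ψ ih ih' => exact and_congr (ih ρ hρ) (ih' ρ hρ)
  | all φ ih =>
    simp only [eval, ← hw]
    refine forall₂_congr fun a ha => ih _ fun i => ?_
    refine Fin.lastCases ?_ (fun j => ?_) i
    · simpa using ha
    · simpa using hρ j

/-- For `1 < N`, tuples of one length with entries below `N` are determined by the number whose
base-`N` digits they are, and this number is below `N ^ k`. Tuples for different names may share a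
cell, but use different bits of it. -/
theorem exists_word_relsOf (ar : X → ℕ) {N k : ℕ} (hN : 1 < N) (hk : ∀ x, ar x ≤ k)
    (G : Rels X ar) : ∃ l : List (X → Bool), l.length = N ^ k ∧ ∀ x q, (∀ i, q i < N) →
      (relsOf ar N (wordTape (l.map (Sum.inr (α := Λ)))) x q ↔ G x q) := by
  classical
  refine ⟨List.ofFn (n := N ^ k) fun c x => decide (∃ q, (∀ i, q i < N) ∧
    Nat.ofDigits N (List.ofFn q) = c ∧ G x q), by simp, fun x q hq => ?_⟩
  have hmem : ∀ q' : Fin (ar x) → ℕ, (∀ i, q' i < N) → ∀ d ∈ List.ofFn q', d < N := by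
    intro q' hq' d hd
    obtain ⟨i, rfl⟩ := (List.mem_ofFn' _ _).1 hd
    exact hq' i
  have hlt : Nat.ofDigits N (List.ofFn q) < N ^ k :=
    (Nat.ofDigits_lt_base_pow_length hN (hmem q hq)).trans_le
      (Nat.pow_le_pow_right (by omega) (by simpa using hk x))
  rw [relsOf, wordTape_natCast, List.getElem?_map, List.getElem?_eq_getElem (by simpa using hlt)]
  simp only [Option.map_some, List.getElem_ofFn, bitAt, decide_eq_true_eq]
  constructor
  · rintro ⟨q', h1, h2, h3⟩
    have := Nat.ofDigits_inj_of_len_eq hN (by simp) (hmem q' h1) (hmem q hq) h2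
    rwa [← List.ofFn_injective this]
  · exact fun h => ⟨q, hq, rfl, h⟩

/-- The model with the given word and relations. -/
def mdl (w : List Λ) (G H : Rels X ar) : Mdl Λ X ar := ⟨w, fun b => if b then H else G⟩

theorem Fml.eval_mdl_congr {w : List Λ} {G G' H H' : Rels X ar}
    (hG : ∀ x q, (∀ i, q i < w.length) → (G x q ↔ G' x q))
    (hH : ∀ x q, (∀ i, q i < w.length) → (H x q ↔ H' x q)) (φ : Fml Λ X ar 0) :
    φ.eval (mdl w G H) Fin.elim0 ↔ φ.eval (mdl w G' H') Fin.elim0 := by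
  refine eval_congr (M := mdl w G H) (M' := mdl w G' H') rfl ?_ φ _ fun i => i.elim0
  rintro (_ | _)
  · exact hG
  · exact hH

namespace Frag

abbrev Ctr (k D : ℕ) : Type := Fin k ⊕ Fin D ⊕ Unit

/-- Prepare the tapes, guess a relation, and evaluate `φ`. -/
noncomputable def guessEval (k : ℕ) (e : List Λ) (φ : Fml Λ X ar 0) :
    Frag (Ctr k φ.depth ⊕ Bool) (TSym Λ X) Bool :=
  bind (bind (prepare _ X (.inr (.inr ())) e false) fun _ =>
      nest ((List.finRange k).map .inl) (guess _ Λ X)) fun _ =>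
    bind (nest ((List.finRange k).map .inl) (restMv true .left)) fun _ =>
      ev ((List.finRange k).map .inl) (.inr (.inr ())) id φ Fin.elim0
        ((List.finRange φ.depth).map fun i => .inr (.inl i))

/-- The words whose extension by some relation satisfies `φ`. -/
def guessLang (k : ℕ) (e : List Λ) (φ : Fml Λ X ar 0) : Set (List (TSym Λ X)) :=
  {z | ∃ l : List (X → Bool), l.length = (pre z ++ e).length ^ k ∧
    φ.eval (mdl (pre z ++ e) (relsOf ar (pre z ++ e).length (shift (wordTape z) (pre z).length))
      (relsOf ar (pre z ++ e).length (wordTape (l.map (Sum.inr (α := Λ)))))) Fin.elim0}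

theorem spec_nest_restMv {C : Type} [DecidableEq C] {W : ATape (TSym Λ X)} {N : ℕ}
    (hW : IsWord W N) {ys : List C} (hys : ys.Nodup) (x : C → ℤ) (hx : ∀ y ∈ ys, x y = 0)
    (k : Bool) (s : Bool → ATape (TSym Λ X)) :
    (nest ys (restMv k .left)).Det (tp W x s) (nestTime N 1 ys.length) ()
      (tp W x (Function.update s k (shift (s k) ((N ^ ys.length : ℕ) * (-1 : ℤ))))) := by
  refine Spec.det (spec_nest hW hys (t := 1) (r := fun s s' => s' =
    Function.update s k (shift (s k) (-1))) (fun x s => ?_) x hx s) fun s' => stepsTo_update _ _ _ _ _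
  refine Spec.mono (det_restMv k .left W x s) le_rfl fun e B => ?_
  constructor
  · exact fun h => ⟨_, rfl, h⟩
  · rintro ⟨_, rfl, h⟩
    exact h

theorem writing_nil {C Γ : Type} [DecidableEq C] (z : List Γ) (cp : Bool) :
    (fun k : C ⊕ Bool => if k = .inr false then wordTape z else fun _ => none) =
      writing C [] (wordTape z) cp := by
  funext k
  rcases k with c | _ | _
  · simp [writing, tp, shift_wordTape_nil]
  · simp [writing, tp, restTapes]
  · cases cp <;> simp [writing, tp, restTapes, shift_wordTape_nil]

/-- The word written on the tape `true` before guessing. -/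
def written (X : Type) (cp : Bool) (W : List Λ) : List (TSym Λ X) := if cp then W.map .inl else []

/-- The non-counter tapes after guessing `l`. -/
def guessed (cp : Bool) (W : List Λ) (I : ATape (TSym Λ X)) (p : ℤ) (l : List (X → Bool)) :
    Bool → ATape (TSym Λ X) :=
  fun b => if b then shift (wordTape (written X cp W ++ l.map .inr)) p else I

/-- Serves both kinds of machine. With `cp` the guess follows a copy of the extended word on the
tape `true`, which together form the oracle query; without `cp` the guess stands there alone. -/
theorem spec_prepare_guess {C : Type} [DecidableEq C] {ys : List C} (hys : ys.Nodup) (c : C)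
    (e : List Λ) (cp : Bool) (z : List (TSym Λ X)) {W : List Λ} (hW : pre z ++ e = W) :
    (bind (prepare C X c e cp) fun _ => nest ys (guess C Λ X)).Spec (writing C [] (wordTape z) cp)
      (((pre z).length + 1 + (e.length + 1 + (2 * ((pre z).length + e.length) + 3))) +
        nestTime W.length 1 ys.length)
      (fun e B => ∃ l : List (X → Bool), l.length = W.length ^ ys.length ∧ e = () ∧
        B = tp (wordTape (W.map .inl)) (fun _ => 0)
          (guessed cp W (shift (wordTape z) (pre z).length)
            ((written X cp W).length + (W.length ^ ys.length : ℕ)) l)) := by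
  subst hW
  set W := pre z ++ e with hWdef
  have hWord : IsWord (wordTape (W.map (Sum.inl (β := X → Bool)))) W.length := by
    simpa using isWord_wordTape (W.map (Sum.inl (β := X → Bool)))
  have h1 := det_prepare (C := C) c e cp z
  set I := shift (wordTape z) (pre z).length with hI
  have hs₀ : restTapes (W.map .inl) I cp = Function.update (fun _ => I) true
      (shift (wordTape (written X cp W)) (written X cp W).length) := by
    funext b
    cases b <;> cases cp <;> simp [restTapes, written, shift_wordTape_nil]
  rw [hs₀] at h1
  refine h1.bind (k := fun _ => nest ys (guess C Λ X)) ?_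
  refine (spec_nest hWord hys (spec_guess (wordTape (W.map .inl))) (fun _ => 0) (fun _ _ => rfl)
    (Function.update (fun _ => I) true (shift (wordTape (written X cp W))
      (written X cp W).length))).mono le_rfl fun e B => ?_
  simp only [stepsTo_guessRel]
  have key : ∀ l : List (X → Bool), Function.update (fun _ => I) true
      (shift (wordTape (written X cp W ++ l.map .inr)) ((written X cp W).length +
        (W.length ^ ys.length : ℕ))) = guessed cp W I
        ((written X cp W).length + (W.length ^ ys.length : ℕ)) l := by
    intro l
    funext b
    cases b <;> simp [guessed]
  constructor
  · rintro ⟨_, ⟨l, hl, rfl⟩, h, rfl⟩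
    exact ⟨l, hl, h, by rw [key]⟩
  · rintro ⟨l, hl, h, rfl⟩
    exact ⟨_, ⟨l, hl, rfl⟩, h, by rw [key]⟩

theorem shift_guessed {cp : Bool} {W : List Λ} {I : ATape (TSym Λ X)} {p q : ℤ}
    {l : List (X → Bool)} : Function.update (guessed cp W I p l) true
      (shift (guessed cp W I p l true) q) = guessed cp W I (p + q) l := by
  funext b
  cases b <;> simp [guessed, shift_shift]

theorem eval_monotone (p : Polynomial ℕ) : Monotone fun n => p.eval n := by
  intro a b hab
  simp only [Polynomial.eval_eq_sum]
  exact Finset.sum_le_sum fun i _ => Nat.mul_le_mul_left _ (Nat.pow_le_pow_left hab i)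

variable [Finite X] [Finite Λ]

/-- The only nondeterministic part is the guess of `N ^ k` cells, where `N` is the length of the
extended word. After it the head returns to the first guessed cell and the deterministic evaluation
takes over. -/
theorem guessLang_mem_NP {k : ℕ} (hk : ∀ x, ar x ≤ k) (e : List Λ) (φ : Fml Λ X ar 0) {α : Type}
    {ι : α → TSym Λ X} (hι : Function.Injective ι) :
    {z : List α | z.map ι ∈ guessLang k e φ} ∈ NP α := by
  classical
  set ys : List (Ctr k φ.depth) := (List.finRange k).map .inl with hys
  set fr : List (Ctr k φ.depth) := (List.finRange φ.depth).map fun i => .inr (.inl i) with hfr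
  set zz : Ctr k φ.depth := .inr (.inr ()) with hzz
  have hlen : ys.length = k := by simp [hys]
  have hnd : ys.Nodup := (List.nodup_finRange k).map Sum.inl_injective
  obtain ⟨t, ht, hev⟩ := det_ev ys hnd zz (by simp [hys, hzz]) (Rr := Bool) id
    (fun x => by rw [hlen]; exact hk x) φ Fin.elim0 fr (by simp [hfr])
    ((List.nodup_finRange φ.depth).map fun i j h => by simpa using h) (by simp [hfr, hys, hzz])
    (fun i => i.elim0)
  obtain ⟨p, hp⟩ := (((ht.add (PolyBdd.nestTime (.const 1) k)).add
    (PolyBdd.nestTime (.const 1) k)))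
  have hpm := eval_monotone p
  have : Finite (TSym Λ X) := by
    have : Finite (X → Bool) := inferInstance
    infer_instance
  refine toNTM_decides (c := guessEval k e φ) (inTape := .inr false) hι
    (t := fun n => n + 1 + (e.length + 1 + (2 * (n + e.length) + 3)) + p.eval (n + e.length)) ?_
    (R := fun w b B => ∃ l : List (X → Bool), l.length = (pre (w.map ι) ++ e).length ^ k ∧
      b = decide (φ.eval (mdl (pre (w.map ι) ++ e) (relsOf ar (pre (w.map ι) ++ e).length
        (shift (wordTape (w.map ι)) (pre (w.map ι)).length))
        (relsOf ar (pre (w.map ι) ++ e).length (wordTape (l.map (Sum.inr (α := Λ)))))) Fin.elim0) ∧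
      B = tp (wordTape ((pre (w.map ι) ++ e).map .inl)) (fun _ => 0)
        (guessed false (pre (w.map ι) ++ e) (shift (wordTape (w.map ι)) (pre (w.map ι)).length) 0 l))
    ?_ ?_
  · refine PolyBdd.add (PolyBdd.add (PolyBdd.id.add (.const 1)) (.add (.const _)
      (.add (.mul (.const 2) (PolyBdd.id.add (.const _))) (.const 3)))) ?_
    exact ⟨p.comp (.X + .C e.length), fun n => by simp⟩
  · intro w
    set z := w.map ι with hz
    set W := pre z ++ e with hWdef
    have hN : W.length ≤ w.length + e.length := by
      have := pre_length_le z
      simp only [hWdef, List.length_append]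
      rw [show z.length = w.length by simp [hz]] at this
      omega
    have hWord : IsWord (wordTape (W.map (Sum.inl (β := X → Bool)))) W.length := by
      simpa using isWord_wordTape (W.map (Sum.inl (β := X → Bool)))
    rw [writing_nil z false]
    set I := shift (wordTape z) (pre z).length with hI
    have h1 := spec_prepare_guess hnd zz e false z hWdef.symm
    rw [hlen] at h1
    have h3 : ∀ l : List (X → Bool), (nest ys (restMv true .left)).Det
        (tp (wordTape (W.map .inl)) (fun _ => 0) (guessed false W I
          ((written X false W).length + (W.length ^ k : ℕ)) l)) (nestTime W.length 1 k) ()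
        (tp (wordTape (W.map .inl)) (fun _ => 0) (guessed false W I 0 l)) := by
      intro l
      have := spec_nest_restMv hWord hnd (fun _ => 0) (fun _ _ => rfl) true (guessed false W I
          ((written X false W).length + (W.length ^ k : ℕ)) l)
      rw [hlen, shift_guessed] at this
      convert this using 3
      simp [written]
    have h4 : ∀ l : List (X → Bool), _ := fun l => hev W Fin.elim0 (fun _ => 0)
      (guessed false W I 0 l) (fun i => i.elim0) (fun i => i.elim0) rfl
      (fun _ _ => rfl) (fun _ _ => rfl)
    have h5 : ∀ l : List (X → Bool), (⟨W, fun b => relsOf ar W.length (guessed false W I 0 l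
        (id b))⟩ : Mdl Λ X ar) =
        mdl W (relsOf ar W.length I) (relsOf ar W.length (wordTape (l.map (Sum.inr (α := Λ))))) := by
      intro l
      simp only [mdl, Mdl.mk.injEq, true_and]
      funext b
      cases b <;> simp [guessed, written, shift_zero]
    simp only [h5] at h4
    have h6 := spec_bind h1 (t' := nestTime W.length 1 k + t W.length)
      (k := fun _ => bind (nest ys (restMv true .left)) fun _ => ev ys zz id φ Fin.elim0 fr)
      (R' := fun _ B e B' => (bind (nest ys (restMv true .left)) fun _ =>
        ev ys zz id φ Fin.elim0 fr).Reach (.inl (bind (nest ys (restMv true .left)) fun _ =>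
        ev ys zz id φ Fin.elim0 fr).start, B) (.inr e, B')) (by
        rintro _ _ ⟨l, hl, rfl, rfl⟩
        exact ⟨((h3 l).then (h4 l)).1, fun _ _ => Iff.rfl⟩)
    refine h6.mono ?_ fun b B => ?_
    · have e1 := pre_length_le z
      have e2 : z.length = w.length := by simp [hz]
      have e3 := hp W.length
      have e4 : p.eval W.length ≤ p.eval (w.length + e.length) := hpm hN
      simp only at e3
      omega
    · constructor
      · rintro ⟨_, _, ⟨l, hl, -, rfl⟩, h⟩
        exact ⟨l, hl, (((h3 l).then (h4 l)).2 _ _).1 h⟩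
      · rintro ⟨l, hl, h⟩
        exact ⟨_, _, ⟨l, hl, rfl, rfl⟩, (((h3 l).then (h4 l)).2 _ _).2 h⟩
  · intro w
    constructor
    · rintro ⟨l, hl, h⟩
      exact ⟨_, l, hl, (decide_eq_true h).symm, rfl⟩
    · rintro ⟨B, l, hl, h, -⟩
      exact ⟨l, hl, of_decide_eq_true h.symm⟩

end Frag

variable [Finite X] [Finite Λ]

/-- The easy direction of Fagin's theorem. No relation word follows the input, so the first family
of relations is empty. The length of `e` ensures a base of at least two for coding tuples. -/
theorem mem_NP_of_fml {α : Type} {ι : α → Λ} (hι : Function.Injective ι) (e : List Λ)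
    (he : 1 < e.length) (φ : Fml Λ X ar 0) : ∃ L ∈ NP α, ∀ w, w ∈ L ↔
      ∃ H, φ.eval (mdl (w.map ι ++ e) (fun _ _ => False) H) Fin.elim0 := by
  obtain ⟨k, hk⟩ : ∃ k, ∀ x, ar x ≤ k := by
    have := Fintype.ofFinite X
    exact ⟨Finset.univ.sup ar, fun x => Finset.le_sup (Finset.mem_univ x)⟩
  refine ⟨_, Frag.guessLang_mem_NP hk e φ (Sum.inl_injective.comp hι), fun w => ?_⟩
  have h1 : w.map (Sum.inl (β := X → Bool) ∘ ι) = (w.map ι).map .inl := by simp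
  have h2 : 1 < (w.map ι ++ e).length := by simp; omega
  simp only [Set.mem_ofPred_eq, Frag.guessLang, h1, pre_map]
  have h3 : ∀ x q, ¬ relsOf ar (w.map ι ++ e).length (shift (wordTape ((w.map ι).map
      (Sum.inl (β := X → Bool)))) (w.map ι).length) x q := by
    intro x q
    simp only [relsOf, shift, ← Nat.cast_add, wordTape_natCast]
    rw [List.getElem?_eq_none (by simp)]
    simp [bitAt]
  constructor
  · rintro ⟨l, -, h⟩
    exact ⟨_, (Fml.eval_mdl_congr (fun x q _ => iff_of_false (h3 x q) id)
      (fun x q _ => Iff.rfl) φ).1 h⟩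
  · rintro ⟨H, h⟩
    obtain ⟨l, hl, hl'⟩ := exists_word_relsOf (Λ := Λ) ar h2 hk H
    exact ⟨l, hl, (Fml.eval_mdl_congr (fun x q _ => iff_of_false (h3 x q) id) hl' φ).2 h⟩

/-- Prepare the tapes and write the query: the input with `e`, followed by a guessed word. -/
def oracleQuery (X : Type) (k : ℕ) (e : List Λ) : Frag (Frag.Ctr k 0 ⊕ Bool) (TSym Λ X) Unit :=
  Frag.bind (Frag.bind (Frag.prepare _ X (.inr (.inr ())) e true) fun _ =>
      Frag.nest ((List.finRange k).map .inl) (Frag.guess _ Λ X)) fun _ =>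
    Frag.bind (Frag.nest ((List.finRange k).map .inl) (Frag.restMv true .left)) fun _ =>
      Frag.nest [.inr (.inr ())] (Frag.restMv true .left)

-- The machine only writes the extended word and a guessed `G` on the oracle tape. The oracle
-- decides whether some `H` violates `φ`, and a negative answer means acceptance.
open Frag in
theorem mem_NPwithNPOracle_of_fml {α : Type} {ι : α → Λ} (hι : Function.Injective ι) (e : List Λ)
    (he : 1 < e.length) (φ : Fml Λ X ar 0) : ∃ L ∈ NPwithNPOracle α, ∀ w, w ∈ L ↔
      ∃ G, ∀ H, φ.eval (mdl (w.map ι ++ e) G H) Fin.elim0 := by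
  obtain ⟨k, hk⟩ : ∃ k, ∀ x, ar x ≤ k := by
    have := Fintype.ofFinite X
    exact ⟨Finset.univ.sup ar, fun x => Finset.le_sup (Finset.mem_univ x)⟩
  -- Nothing is appended on the side of the oracle, as the query already contains `e`.
  set A := {z : List (TSym Λ X) | z.map id ∈ guessLang k [] φ.not} with hA
  have hANP : A ∈ NP (TSym Λ X) := guessLang_mem_NP hk [] φ.not Function.injective_id
  have hAmem : ∀ (W : List Λ) (l : List (X → Bool)), 1 < W.length →
      (W.map .inl ++ l.map .inr ∈ A ↔
        ∃ H, ¬ φ.eval (mdl W (relsOf ar W.length (wordTape (l.map (Sum.inr (α := Λ))))) H)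
          Fin.elim0) := by
    intro W l hW
    have h2 : ∀ x q, relsOf ar W.length (shift (wordTape (W.map (Sum.inl (β := X → Bool)) ++
        l.map .inr)) W.length) x q ↔
        relsOf ar W.length (wordTape (l.map (Sum.inr (α := Λ)))) x q := by
      intro x q
      simp only [relsOf, shift, ← Nat.cast_add, wordTape_natCast]
      rw [List.getElem?_append_right (by simp)]
      simp
    simp only [hA, Set.mem_ofPred_eq, guessLang, List.map_id, pre_map_append, List.append_nil,
      Fml.eval]
    constructor
    · rintro ⟨l', -, h⟩
      exact ⟨_, fun h' => h ((Fml.eval_mdl_congr (fun x q _ => h2 x q)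
        (fun x q _ => Iff.rfl) φ).2 h')⟩
    · rintro ⟨H, h⟩
      obtain ⟨l', hl, hl'⟩ := exists_word_relsOf (Λ := Λ) ar hW hk H
      exact ⟨l', hl, fun h' => h ((Fml.eval_mdl_congr (fun x q _ => h2 x q) hl' φ).1 h')⟩
  set ys : List (Ctr k 0) := (List.finRange k).map .inl with hys
  set zz : Ctr k 0 := .inr (.inr ()) with hzz
  have hlen : ys.length = k := by simp [hys]
  have hnd : ys.Nodup := (List.nodup_finRange k).map Sum.inl_injective
  obtain ⟨p, hp⟩ := (((PolyBdd.nestTime (.const 1) k).add (PolyBdd.nestTime (.const 1) k)).add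
    (PolyBdd.nestTime (.const 1) 1))
  have : Finite (TSym Λ X) := by
    have : Finite (X → Bool) := inferInstance
    infer_instance
  have hlang : ∀ w : List α, (∃ G, ∀ H, φ.eval (mdl (w.map ι ++ e) G H) Fin.elim0) ↔
      ∃ B : Ctr k 0 ⊕ Bool → ATape (TSym Λ X), (∃ l : List (X → Bool),
        l.length = (w.map ι ++ e).length ^ k ∧ B = tp (wordTape ((w.map ι ++ e).map .inl))
          (fun _ => 0) (guessed true (w.map ι ++ e)
            (shift (wordTape ((w.map ι).map .inl)) (w.map ι).length) 0 l)) ∧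
        ¬ ∃ u ∈ A, B (.inr true) = wordTape (u.map id) := by
    intro w
    set W := w.map ι ++ e with hWdef
    have hW1 : 1 < W.length := by simp [hWdef]; omega
    have hu : ∀ l : List (X → Bool), (∃ u ∈ A, wordTape (W.map (Sum.inl (β := X → Bool)) ++
        l.map .inr) = wordTape (u.map id)) ↔ W.map .inl ++ l.map .inr ∈ A := by
      intro l
      constructor
      · rintro ⟨u, hu, h⟩
        rw [List.map_id] at h
        have : W.map .inl ++ l.map .inr = u := by
          apply List.ext_getElem?
          intro i
          rw [← wordTape_natCast, ← wordTape_natCast, h]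
        rwa [this]
      · exact fun h => ⟨_, h, by rw [List.map_id]⟩
    constructor
    · rintro ⟨G, hG⟩
      obtain ⟨l, hl, hl'⟩ := exists_word_relsOf (Λ := Λ) ar hW1 hk G
      refine ⟨_, ⟨l, hl, rfl⟩, ?_⟩
      simp only [tp, guessed, written, if_true, shift_zero, Sum.elim_inr]
      rw [hu, hAmem W l hW1]
      rintro ⟨H, hH⟩
      exact hH ((Fml.eval_mdl_congr hl' (fun x q _ => Iff.rfl) φ).2 (hG H))
    · rintro ⟨_, ⟨l, hl, rfl⟩, h⟩
      simp only [tp, guessed, written, if_true, shift_zero, Sum.elim_inr] at h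
      rw [hu, hAmem W l hW1] at h
      push Not at h
      exact ⟨_, h⟩
  refine ⟨{w | ∃ G, ∀ H, φ.eval (mdl (w.map ι ++ e) G H) Fin.elim0}, ?_, fun w => Iff.rfl⟩
  refine toOracle_decides (c := oracleQuery X k e) (inTape := .inr false) (oracleTape := .inr true)
    (Sum.inl_injective.comp hι) Function.injective_id hANP
    (t := fun n => n + 1 + (e.length + 1 + (2 * (n + e.length) + 3)) + p.eval (n + e.length)) ?_
    (R := fun w _ B => ∃ l : List (X → Bool),
        l.length = (w.map ι ++ e).length ^ k ∧ B = tp (wordTape ((w.map ι ++ e).map .inl))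
          (fun _ => 0) (guessed true (w.map ι ++ e)
            (shift (wordTape ((w.map ι).map .inl)) (w.map ι).length) 0 l)) ?_ hlang
  · refine PolyBdd.add (PolyBdd.add (PolyBdd.id.add (.const 1)) (.add (.const _)
      (.add (.mul (.const 2) (PolyBdd.id.add (.const _))) (.const 3)))) ?_
    exact ⟨p.comp (.X + .C e.length), fun n => by simp⟩
  · intro w
    rw [← List.map_map]
    set W := w.map ι ++ e with hWdef
    have hWord : IsWord (wordTape (W.map (Sum.inl (β := X → Bool)))) W.length := by
      simpa using isWord_wordTape (W.map (Sum.inl (β := X → Bool)))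
    rw [writing_nil _ true]
    set I : ATape (TSym Λ X) := shift (wordTape ((w.map ι).map .inl)) (w.map ι).length with hI
    have h1 := spec_prepare_guess hnd zz e true ((w.map ι).map (Sum.inl (β := X → Bool))) (W := W)
      (by rw [pre_map])
    rw [hlen, pre_map] at h1
    have h3 : ∀ (ys : List (Ctr k 0)), ys.Nodup → ∀ (l : List (X → Bool)) (q : ℤ),
        (nest ys (restMv true .left)).Det
        (tp (wordTape (W.map .inl)) (fun _ => 0) (guessed true W I (q + (W.length ^ ys.length : ℕ)) l))
        (nestTime W.length 1 ys.length) ()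
        (tp (wordTape (W.map .inl)) (fun _ => 0) (guessed true W I q l)) := by
      intro ys hnd l q
      have := spec_nest_restMv hWord hnd (fun _ => 0) (fun _ _ => rfl) true (guessed true W I
          (q + (W.length ^ ys.length : ℕ)) l)
      rw [shift_guessed] at this
      convert this using 3
      ring
    -- The head of the oracle tape is behind a word of length `N ^ k + N`. Two nests, of `k` loops
    -- and of one loop, bring it back to the first symbol, where the query expects it.
    have h4 : ∀ l : List (X → Bool), (bind (nest ys (restMv true .left)) fun _ =>
        nest [zz] (restMv true .left)).Det _ _ _ _ := fun l =>
      (h3 ys hnd l (0 + (W.length ^ [zz].length : ℕ))).then (h3 [zz] (by simp) l 0)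
    have h5 := spec_bind_det (k := fun _ => bind (nest ys (restMv true .left)) fun _ =>
        nest [zz] (restMv true .left)) (P := fun l : List (X → Bool) => l.length = W.length ^ k) h1
        (e' := ()) (D := fun l => tp (wordTape (W.map .inl)) (fun _ => 0) (guessed true W I 0 l))
        (t' := nestTime W.length 1 k + nestTime W.length 1 1) (fun l _ => by
          convert h4 l using 3
          · congr 1
            · simp [written]
            · rw [hlen]
          · exact hlen.symm
          · rfl)
    refine h5.mono ?_ fun _ B => ?_
    · have e3 := hp W.length
      have e4 : W.length = w.length + e.length := by simp [hWdef]
      rw [← e4]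
      simp only [List.length_map] at e3 ⊢
      omega
    · simp

end
/-! ### Definable properties -/

section
variable {Λ X : Type} {ar : X → ℕ}

/-- In the models satisfying `C`, the property `P` of `d` positions is definable. -/
def Dfn (C : Mdl Λ X ar → Prop) {d : ℕ} (P : Mdl Λ X ar → (Fin d → ℕ) → Prop) : Prop :=
  ∃ φ : Fml Λ X ar d, ∀ M, C M → ∀ ρ : Fin d → ℕ, (∀ i, ρ i < M.w.length) → (φ.eval M ρ ↔ P M ρ)

variable {C : Mdl Λ X ar → Prop} {d : ℕ} {P Q : Mdl Λ X ar → (Fin d → ℕ) → Prop}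

namespace Dfn

theorem congr (h : Dfn C P)
    (hPQ : ∀ M, C M → ∀ ρ : Fin d → ℕ, (∀ i, ρ i < M.w.length) → (P M ρ ↔ Q M ρ)) : Dfn C Q :=
  let ⟨φ, hφ⟩ := h
  ⟨φ, fun M hM ρ hρ => (hφ M hM ρ hρ).trans (hPQ M hM ρ hρ)⟩

theorem letter (a : Λ) (i : Fin d) : Dfn C fun M ρ => M.w[ρ i]? = some a :=
  ⟨.letter i a, fun _ _ _ _ => Iff.rfl⟩

theorem lt (i j : Fin d) : Dfn C fun _ ρ => ρ i < ρ j :=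
  ⟨.lt i j, fun _ _ _ _ => Iff.rfl⟩

theorem so (b : Bool) (x : X) (f : Fin (ar x) → Fin d) :
    Dfn C fun M ρ => M.so b x fun k => ρ (f k) :=
  ⟨.so b x f, fun _ _ _ _ => Iff.rfl⟩

theorem not (h : Dfn C P) : Dfn C fun M ρ => ¬ P M ρ :=
  let ⟨φ, hφ⟩ := h
  ⟨.not φ, fun M hM ρ hρ => not_congr (hφ M hM ρ hρ)⟩

theorem and (h : Dfn C P) (h' : Dfn C Q) : Dfn C fun M ρ => P M ρ ∧ Q M ρ :=
  let ⟨φ, hφ⟩ := h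
  let ⟨ψ, hψ⟩ := h'
  ⟨.and φ ψ, fun M hM ρ hρ => and_congr (hφ M hM ρ hρ) (hψ M hM ρ hρ)⟩

theorem or (h : Dfn C P) (h' : Dfn C Q) : Dfn C fun M ρ => P M ρ ∨ Q M ρ :=
  (h.not.and h'.not).not.congr fun _ _ _ _ => by tauto

theorem imp (h : Dfn C P) (h' : Dfn C Q) : Dfn C fun M ρ => P M ρ → Q M ρ :=
  (h.not.or h').congr fun _ _ _ _ => by tauto

theorem iff (h : Dfn C P) (h' : Dfn C Q) : Dfn C fun M ρ => (P M ρ ↔ Q M ρ) :=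
  ((h.imp h').and (h'.imp h)).congr fun _ _ _ _ => by tauto

theorem all {P : Mdl Λ X ar → (Fin d → ℕ) → ℕ → Prop}
    (h : Dfn C (d := d + 1) fun M ρ => P M (fun i => ρ i.castSucc) (ρ (Fin.last d))) :
    Dfn C fun M ρ => ∀ a < M.w.length, P M ρ a := by
  obtain ⟨φ, hφ⟩ := h
  refine ⟨.all φ, fun M hM ρ hρ => forall₂_congr fun a ha => ?_⟩
  rw [hφ M hM]
  · simp
  · intro i
    refine Fin.lastCases ?_ (fun j => ?_) i
    · simpa using ha
    · simpa using hρ j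

theorem ex {P : Mdl Λ X ar → (Fin d → ℕ) → ℕ → Prop}
    (h : Dfn C (d := d + 1) fun M ρ => P M (fun i => ρ i.castSucc) (ρ (Fin.last d))) :
    Dfn C fun M ρ => ∃ a < M.w.length, P M ρ a :=
  (Dfn.all (P := fun M ρ a => ¬ P M ρ a) h.not).not.congr fun _ _ _ _ => by push Not; rfl

theorem eq (i j : Fin d) : Dfn C fun _ ρ => ρ i = ρ j :=
  ((Dfn.lt i j).not.and (Dfn.lt j i).not).congr fun _ _ _ _ => by omega

theorem le (i j : Fin d) : Dfn C fun _ ρ => ρ i ≤ ρ j :=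
  (Dfn.lt j i).not.congr fun _ _ _ _ => by omega

theorem succ (i j : Fin d) : Dfn C fun _ ρ => ρ j = ρ i + 1 := by
  refine ((Dfn.lt i j).and (Dfn.all (P := fun _ ρ a => ¬ (ρ i < a ∧ a < ρ j))
    ((Dfn.lt _ _).and (Dfn.lt _ _)).not)).congr fun M _ ρ hρ => ?_
  constructor
  · rintro ⟨h1, h2⟩
    by_contra h
    exact h2 (ρ i + 1) (by have := hρ j; omega) (by omega)
  · intro h
    exact ⟨by omega, fun a _ => by omega⟩

theorem zero (i : Fin d) : Dfn C fun _ ρ => ρ i = 0 := by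
  refine (Dfn.all (P := fun _ ρ a => ¬ a < ρ i) (Dfn.lt _ _).not).congr fun M _ ρ hρ => ?_
  constructor
  · intro h
    by_contra h0
    exact h 0 (by have := hρ i; omega) (by omega)
  · intro h a _
    omega

/-- Substitution of positions for positions. -/
theorem subst {d' : ℕ} {P : Mdl Λ X ar → (Fin d → ℕ) → Prop} (h : Dfn C P) (f : Fin d → Fin d') :
    Dfn C fun M (ρ : Fin d' → ℕ) => P M fun i => ρ (f i) := by
  obtain ⟨φ, hφ⟩ := h
  suffices H : ∀ {d d' : ℕ} (φ : Fml Λ X ar d) (f : Fin d → Fin d'), ∃ ψ : Fml Λ X ar d', ∀ M ρ,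
      ψ.eval M ρ ↔ φ.eval M fun i => ρ (f i) by
    obtain ⟨ψ, hψ⟩ := H φ f
    exact ⟨ψ, fun M hM ρ hρ => (hψ M ρ).trans (hφ M hM _ fun i => hρ _)⟩
  intro d d' φ
  clear hφ f
  induction φ generalizing d' with
  | letter i a => exact fun f => ⟨.letter (f i) a, fun M ρ => Iff.rfl⟩
  | lt i j => exact fun f => ⟨.lt (f i) (f j), fun M ρ => Iff.rfl⟩
  | so b x g => exact fun f => ⟨.so b x (f ∘ g), fun M ρ => Iff.rfl⟩
  | not φ ih =>
    intro f
    obtain ⟨ψ, hψ⟩ := ih f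
    exact ⟨.not ψ, fun M ρ => not_congr (hψ M ρ)⟩
  | and φ φ' ih ih' =>
    intro f
    obtain ⟨ψ, hψ⟩ := ih f
    obtain ⟨ψ', hψ'⟩ := ih' f
    exact ⟨.and ψ ψ', fun M ρ => and_congr (hψ M ρ) (hψ' M ρ)⟩
  | all φ ih =>
    intro f
    obtain ⟨ψ, hψ⟩ := ih (Fin.snoc (α := fun _ => Fin (d' + 1)) (fun i => (f i).castSucc)
      (Fin.last d'))
    refine ⟨.all ψ, fun M ρ => forall₂_congr fun a _ => (hψ M _).trans (iff_of_eq ?_)⟩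
    congr 1
    funext i
    refine Fin.lastCases ?_ (fun j => ?_) i <;> simp

/-- Quantification over tuples of positions. -/
theorem allTuple {m : ℕ} {P : Mdl Λ X ar → (Fin d → ℕ) → (Fin m → ℕ) → Prop}
    (h : Dfn C (d := d + m) fun M ρ => P M (fun i => ρ (i.castAdd m)) (fun k => ρ (k.natAdd d))) :
    Dfn C fun M ρ => ∀ q : Fin m → ℕ, (∀ k, q k < M.w.length) → P M ρ q := by
  induction m with
  | zero =>
    refine h.congr fun M hM ρ hρ => ⟨fun h q _ => ?_, fun h => h _ fun k => k.elim0⟩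
    rwa [Subsingleton.elim q]
  | succ m ih =>
    have h2 := ih (P := fun M ρ q => ∀ a < M.w.length,
      P M ρ (Fin.snoc (α := fun _ => ℕ) q a)) (Dfn.all (P := fun M ρ a => P M
        (fun i => ρ (i.castAdd m)) (Fin.snoc (α := fun _ => ℕ) (fun k => ρ (k.natAdd d)) a)) (by
          refine h.congr fun M hM ρ hρ => iff_of_eq ?_
          congr 1
          funext k
          refine Fin.lastCases ?_ (fun j => ?_) k
          · simp
          · simp))
    refine h2.congr fun M hM ρ hρ => ⟨fun h q hq => ?_, fun h q hq a ha => h _ fun k => ?_⟩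
    · have := h (Fin.init q) (fun k => hq _) (q (Fin.last m)) (hq _)
      rwa [Fin.snoc_init_self] at this
    · refine Fin.lastCases ?_ (fun j => ?_) k
      · simpa using ha
      · simpa using hq j

theorem exTuple {m : ℕ} {P : Mdl Λ X ar → (Fin d → ℕ) → (Fin m → ℕ) → Prop}
    (h : Dfn C (d := d + m) fun M ρ => P M (fun i => ρ (i.castAdd m)) (fun k => ρ (k.natAdd d))) :
    Dfn C fun M ρ => ∃ q : Fin m → ℕ, (∀ k, q k < M.w.length) ∧ P M ρ q :=
  (Dfn.allTuple (P := fun M ρ q => ¬ P M ρ q) h.not).not.congr fun _ _ _ _ => by push Not; rfl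

theorem true : Dfn C fun _ (_ : Fin d → ℕ) => True :=
  (Dfn.all (P := fun _ (_ : Fin d → ℕ) a => a < a) (Dfn.lt _ _) |>.or
    (Dfn.all (P := fun _ (_ : Fin d → ℕ) a => a < a) (Dfn.lt _ _)).not).congr
      fun _ _ _ _ => by tauto

/-- A property that does not depend on the model or on the positions. -/
theorem const (p : Prop) : Dfn C fun _ (_ : Fin d → ℕ) => p := by
  by_cases h : p
  · exact Dfn.true.congr fun _ _ _ _ => by tauto
  · exact Dfn.true.not.congr fun _ _ _ _ => by tauto

theorem list_all {ι : Type} (l : List ι) {P : ι → Mdl Λ X ar → (Fin d → ℕ) → Prop}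
    (h : ∀ x ∈ l, Dfn C (P x)) : Dfn C fun M ρ => ∀ x ∈ l, P x M ρ := by
  induction l with
  | nil => exact Dfn.true.congr fun _ _ _ _ => by simp
  | cons x l ih =>
    exact ((h x (by simp)).and (ih fun y hy => h y (by simp [hy]))).congr fun _ _ _ _ => by simp

theorem forall_finite {ι : Type} [Finite ι] {P : ι → Mdl Λ X ar → (Fin d → ℕ) → Prop}
    (h : ∀ x, Dfn C (P x)) : Dfn C fun M ρ => ∀ x, P x M ρ := by
  have := Fintype.ofFinite ι
  exact (list_all (Finset.univ.toList) fun x _ => h x).congr fun _ _ _ _ => by simp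

theorem exists_finite {ι : Type} [Finite ι] {P : ι → Mdl Λ X ar → (Fin d → ℕ) → Prop}
    (h : ∀ x, Dfn C (P x)) : Dfn C fun M ρ => ∃ x, P x M ρ :=
  (forall_finite fun x => (h x).not).not.congr fun _ _ _ _ => by push Not; rfl

/-- The first conjunct may be assumed when the second is defined. Thus a sentence can check the
guessed auxiliary relations and rely on them afterwards. -/
theorem and_of_weaken {B : Mdl Λ X ar → Prop} (hB : Dfn C (d := d) fun M _ => B M)
    (hP : Dfn (fun M => C M ∧ B M) P) : Dfn C fun M ρ => B M ∧ P M ρ := by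
  obtain ⟨φ, hφ⟩ := hB
  obtain ⟨ψ, hψ⟩ := hP
  refine ⟨.and φ ψ, fun M hM ρ hρ => ⟨fun h => ?_, fun h => ?_⟩⟩
  · have := (hφ M hM ρ hρ).1 h.1
    exact ⟨this, (hψ M ⟨hM, this⟩ ρ hρ).1 h.2⟩
  · exact ⟨(hφ M hM ρ hρ).2 h.1, (hψ M ⟨hM, h.1⟩ ρ hρ).2 h.2⟩

end Dfn

end

/-! ### Reading constants off a word -/

/-- The number with a given binary expansion, least significant bit first. -/
def ofBits (l : List Bool) : ℕ := l.foldr (fun b n => Nat.bit b n) 0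

@[simp] theorem ofBits_nil : ofBits [] = 0 := rfl

theorem ofBits_cons (b : Bool) (l : List Bool) : ofBits (b :: l) = b.toNat + 2 * ofBits l := by
  show Nat.bit b (ofBits l) = _
  rw [Nat.bit_val]
  ring

theorem ofBits_bits (n : ℕ) : ofBits n.bits = n := by
  induction n using Nat.binaryRec' with
  | zero => simp
  | bit b n h ih =>
    rw [Nat.bits_append_bit n b h, ofBits_cons, ih, Nat.bit_val]
    ring

theorem testBit_ofBits (l : List Bool) (t : ℕ) :
    (ofBits l).testBit t = true ↔ l[t]? = some true := by
  induction l generalizing t with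
  | nil => simp
  | cons b l ih =>
    rw [ofBits_cons, show b.toNat + 2 * ofBits l = Nat.bit b (ofBits l) by rw [Nat.bit_val]; ring]
    cases t with
    | zero => simp
    | succ t => rw [Nat.testBit_bit_succ]; simpa using ih t

theorem ofBits_lt (l : List Bool) : ofBits l < 2 ^ l.length := by
  induction l with
  | nil => simp
  | cons b l ih =>
    rw [ofBits_cons, List.length_cons, pow_succ]
    cases b <;> simp <;> omega

/-- The alphabet of the models: the symbols of the encoding, and markers for constants. -/
abbrev Ltr (S : Schema) (Cst : Type) : Type := Sym S ⊕ Cst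

section
variable {S : Schema} {Cst : Type}

/-- The longest prefix consisting of bits. -/
def bitsOf : List (Ltr S Cst) → List Bool
  | .inl (.bit b) :: l => b :: bitsOf l
  | _ => []

/-- The maximal block of bits at a position. -/
def bitsAt (w : List (Ltr S Cst)) (p : ℕ) : List Bool := bitsOf (w.drop p)

def IsBit (w : List (Ltr S Cst)) (p : ℕ) : Prop := ∃ b, w[p]? = some (.inl (.bit b))

variable {w : List (Ltr S Cst)} {p : ℕ}

theorem bitsAt_of_bit {b : Bool} (h : w[p]? = some (.inl (.bit b))) :
    bitsAt w p = b :: bitsAt w (p + 1) := by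
  obtain ⟨hp, e⟩ := List.getElem?_eq_some_iff.1 h
  rw [bitsAt, List.drop_eq_getElem_cons hp, e]
  rfl

theorem bitsAt_of_not (h : ¬ IsBit w p) : bitsAt w p = [] := by
  by_cases hp : p < w.length
  · rw [bitsAt, List.drop_eq_getElem_cons hp]
    unfold bitsOf
    split
    · rename_i b l e
      exact (h ⟨b, by rw [← List.head?_drop, List.drop_eq_getElem_cons hp, e]; rfl⟩).elim
    · rfl
  · rw [bitsAt, List.drop_eq_nil_of_le (by omega)]
    rfl

theorem bitsAt_getElem?_zero (b : Bool) :
    (bitsAt w p)[0]? = some b ↔ w[p]? = some (.inl (.bit b)) := by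
  by_cases h : IsBit w p
  · obtain ⟨c, h⟩ := h
    rw [bitsAt_of_bit h, h]
    simp
  · rw [bitsAt_of_not h]
    simp only [List.getElem?_nil, reduceCtorEq, false_iff]
    exact fun h' => h ⟨b, h'⟩

theorem bitsAt_getElem?_succ (b : Bool) (t : ℕ) :
    (bitsAt w p)[t + 1]? = some b ↔ IsBit w p ∧ (bitsAt w (p + 1))[t]? = some b := by
  by_cases h : IsBit w p
  · have h' := h
    obtain ⟨c, h⟩ := h
    rw [bitsAt_of_bit h]
    simp [h']
  · rw [bitsAt_of_not h]
    simp [h]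

theorem IsBit.lt (h : IsBit w p) : p < w.length := by
  obtain ⟨b, h⟩ := h
  exact (List.getElem?_eq_some_iff.1 h).1

theorem bitsAt_length_le : (bitsAt w p).length ≤ w.length - p := by
  unfold bitsAt
  rw [← List.length_drop]
  generalize w.drop p = l
  induction l with
  | nil => simp [bitsOf]
  | cons a l ih =>
    unfold bitsOf
    split <;> simp_all

/-- The maximal block of bits at `x` ends before `y`. -/
def Blk (w : List (Ltr S Cst)) (x y : ℕ) : Prop :=
  x ≤ y ∧ (∀ r < w.length, x ≤ r → r < y → IsBit w r) ∧ ¬ IsBit w y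

theorem Blk.unique {x y y' : ℕ} (h : Blk w x y) (h' : Blk w x y') (hy : y < w.length)
    (hy' : y' < w.length) : y = y' := by
  obtain ⟨h1, h2, h3⟩ := h
  obtain ⟨h1', h2', h3'⟩ := h'
  rcases lt_trichotomy y y' with h | h | h
  · exact (h3 (h2' y (by omega) h1 h)).elim
  · exact h
  · exact (h3' (h2 y' (by omega) h1' h)).elim

theorem Blk.length {x y : ℕ} (h : Blk w x y) (hy : y < w.length) :
    (bitsAt w x).length = y - x := by
  obtain ⟨k, rfl⟩ := Nat.exists_eq_add_of_le h.1
  induction k generalizing x with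
  | zero => rw [bitsAt_of_not (by simpa using h.2.2)]; simp
  | succ k ih =>
    obtain ⟨b, hb⟩ := h.2.1 x (by omega) le_rfl (by omega)
    have := ih (x := x + 1) ⟨by omega, fun r hr h1 h2 => h.2.1 r hr (by omega) (by omega),
      by rw [show x + 1 + k = x + (k + 1) by omega]; exact h.2.2⟩ (by omega)
    rw [bitsAt_of_bit hb]
    simp only [List.length_cons]
    omega

/-- A maximal block of bits that is followed by a further letter. -/
theorem blk_of_drop {x : ℕ} {u : List Bool} {c : Ltr S Cst} {rest : List (Ltr S Cst)}
    (hc : ∀ b, c ≠ .inl (.bit b)) (h : w.drop x = u.map (fun b => .inl (.bit b)) ++ c :: rest) :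
    Blk w x (x + u.length) ∧ bitsAt w x = u ∧ w[x + u.length]? = some c ∧
      w.drop (x + u.length + 1) = rest := by
  have hx : ∀ i, w[x + i]? = (u.map (fun b => (.inl (.bit b) : Ltr S Cst)) ++ c :: rest)[i]? :=
    fun i => by rw [← h, List.getElem?_drop]
  have hc' : w[x + u.length]? = some c := by
    rw [hx, List.getElem?_append_right (by simp)]
    simp
  refine ⟨⟨by omega, fun r _ h1 h2 => ?_, fun ⟨b, hb⟩ => ?_⟩, ?_, hc', ?_⟩
  · obtain ⟨i, rfl⟩ := Nat.exists_eq_add_of_le h1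
    refine ⟨u[i]'(by omega), ?_⟩
    rw [hx, List.getElem?_append_left (by simp; omega)]
    simp [List.getElem?_eq_getElem (show i < u.length by omega)]
  · rw [hc'] at hb
    exact hc b (by simpa using hb)
  · rw [bitsAt, h]
    clear hx hc' h
    induction u with
    | nil =>
      show bitsOf (c :: rest) = []
      unfold bitsOf
      split
      · rename_i e
        exact (hc _ (List.cons.inj e).1).elim
      · rfl
    | cons b u ih => simp [bitsOf, ih]
  · rw [add_assoc, ← List.drop_drop, h]
    simp [List.drop_append]

/-- At `p` there is a fraction, with an optional sign at `p`, the numerator between `x` and `y` and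
the denominator between `y + 1` and `z`. -/
structure RatAt (w : List (Ltr S Cst)) (p x y z : ℕ) : Prop where
  sign : w[p]? = some (.inl .minus) ∧ x = p + 1 ∨ ¬ w[p]? = some (.inl .minus) ∧ x = p
  num : Blk w x y
  slash : w[y]? = some (.inl .slash)
  den : Blk w (y + 1) z
  endMark : w[z]? = some (.inl .endMark)
  ne_zero : ∃ t < w.length, (bitsAt w (y + 1))[t]? = some true

open Classical in
/-- The constant of type `s` at the position `p`. -/
def Den (w : List (Ltr S Cst)) : (s : Srt) → ℕ → Dom s → Prop
  | .rat, p, a => ∃ x y z, RatAt w p x y z ∧ (show ℚ from a) =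
      (if w[p]? = some (.inl .minus) then -1 else 1) * ofBits (bitsAt w x) /
        ofBits (bitsAt w (y + 1))
  | .name, p, a => bitsAt w p = a

theorem RatAt.lt {x y z : ℕ} (h : RatAt w p x y z) : p ≤ x ∧ x ≤ y ∧ y < z ∧ z < w.length := by
  have h1 := (List.getElem?_eq_some_iff.1 h.endMark).1
  have h2 := h.num.1
  have h3 := h.den.1
  rcases h.sign with ⟨_, h⟩ | ⟨_, h⟩ <;> omega

theorem RatAt.unique {x y z x' y' z' : ℕ} (h : RatAt w p x y z) (h' : RatAt w p x' y' z') :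
    x = x' ∧ y = y' ∧ z = z' := by
  have h1 := h.lt
  have h1' := h'.lt
  have e : x = x' := by
    rcases h.sign with ⟨a, b⟩ | ⟨a, b⟩ <;> rcases h'.sign with ⟨a', b'⟩ | ⟨a', b'⟩ <;>
      first | omega | exact (a a').elim | exact (a' a).elim
  subst e
  have e := h.num.unique h'.num (by omega) (by omega)
  subst e
  exact ⟨rfl, rfl, h.den.unique h'.den (by omega) (by omega)⟩

theorem RatAt.den_pos {x y z : ℕ} (h : RatAt w p x y z) : 0 < ofBits (bitsAt w (y + 1)) := by
  obtain ⟨t, -, ht⟩ := h.ne_zero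
  rw [← testBit_ofBits] at ht
  rw [Nat.pos_iff_ne_zero]
  rintro e
  simp [e] at ht

/-- A constant may be denoted at many positions, and a rational also by unreduced fractions, but a
position denotes at most one constant of each type. -/
theorem Den.unique {s : Srt} {a b : Dom s} (h : Den w s p a) (h' : Den w s p b) : a = b := by
  cases s with
  | rat =>
    obtain ⟨x, y, z, h1, h2⟩ := h
    obtain ⟨x', y', z', h1', h2'⟩ := h'
    obtain ⟨rfl, rfl, rfl⟩ := h1.unique h1'
    exact h2.trans h2'.symm
  | name => exact Eq.trans (Eq.symm h) h'

/-- The numerator of a fraction and the denominator of a fraction occupy different places. -/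
theorem RatAt.length_add_le {q x y z x' y' z' : ℕ} (h : RatAt w p x y z)
    (h' : RatAt w q x' y' z') :
    (bitsAt w x).length + (bitsAt w (y' + 1)).length ≤ w.length := by
  have h1 := h.lt
  have h1' := h'.lt
  rw [h.num.length (by omega), h'.den.length (by omega)]
  by_contra hlt
  rcases lt_or_ge y' y with hy | hy
  -- If the numerator block and the denominator block overlapped, a delimiter of one would lie
  -- inside the other, or the end marker at `z'` would coincide with the slash at `y`.
  · have hb : ¬ IsBit w y := h.num.2.2
    have h2 : z' ≤ y := by
      by_contra h3
      exact hb (h'.den.2.1 y (by omega) (by omega) (by omega))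
    have h3 : y' < x := by
      by_contra h3
      obtain ⟨b, hb⟩ := h.num.2.1 y' (by omega) (by omega) hy
      rw [h'.slash] at hb
      simp at hb
    have h4 : z' = y := by
      by_contra h4
      refine h'.den.2.2 (h.num.2.1 z' (by omega) ?_ (by omega))
      by_contra h5
      omega
    have := h'.endMark
    rw [h4, h.slash] at this
    simp at this
  · omega

/-- The encoding of a constant, read off the word. -/
theorem den_of_encodeConst {s : Srt} {a : Dom s} {rest : List (Ltr S Cst)}
    (h : w.drop p = (encodeConst S s a).map .inl ++ rest) : Den w s p a := by
  have hw0 : ∀ i, w[p + i]? = ((encodeConst S s a).map .inl ++ rest)[i]? :=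
    fun i => by rw [← h, List.getElem?_drop]
  cases s with
  | name =>
    change List Bool at a
    have h' : w.drop p = a.map (fun b => .inl (.bit b)) ++
        .inl .endMark :: rest := by
      rw [h]
      simp [encodeConst, encodeBits, Function.comp_def]
    exact (blk_of_drop (by simp) h').2.1
  | rat =>
    change ℚ at a
    obtain ⟨x, hx, hd⟩ : ∃ x, (w[p]? = some (.inl .minus) ∧ x = p + 1 ∧ a < 0 ∨
        ¬ w[p]? = some (.inl .minus) ∧ x = p ∧ ¬ a < 0) ∧
        w.drop x = a.num.natAbs.bits.map (fun b => .inl (.bit b)) ++ .inl .slash ::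
          (a.den.bits.map (fun b => .inl (.bit b)) ++ .inl .endMark :: rest) := by
      by_cases ha : a < 0
      · refine ⟨p + 1, .inl ⟨?_, rfl, ha⟩, ?_⟩
        · have := hw0 0
          simpa [encodeConst, ha] using this
        · rw [← List.drop_drop, h]
          simp [encodeConst, encodeBits, Function.comp_def, ha]
      · refine ⟨p, .inr ⟨?_, rfl, ha⟩, ?_⟩
        · have := hw0 0
          rw [add_zero] at this
          rw [this]
          simp only [encodeConst, ha, if_false, encodeBits]
          cases a.num.natAbs.bits <;> simp
        · rw [h]
          simp [encodeConst, encodeBits, Function.comp_def, ha]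
    obtain ⟨n1, n2, n3, n4⟩ := blk_of_drop (by simp) hd
    obtain ⟨d1, d2, d3, d4⟩ := blk_of_drop (by simp) n4
    have hden : ofBits a.den.bits ≠ 0 := by rw [ofBits_bits]; exact a.den_ne_zero
    refine ⟨x, _, _, ⟨by tauto, n1, n3, d1, d3, ?_⟩, ?_⟩
    · obtain ⟨t, ht⟩ := Nat.exists_testBit_of_ne_zero hden
      rw [testBit_ofBits, ← d2] at ht
      refine ⟨t, ?_, ht⟩
      have := (List.getElem?_eq_some_iff.1 ht).1
      have := bitsAt_length_le (w := w) (p := x + a.num.natAbs.bits.length + 1)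
      omega
    · rw [n2, d2, ofBits_bits, ofBits_bits]
      have hq : (a.num : ℚ) / a.den = a := a.num_div_den
      show a = _
      conv_lhs => rw [← hq]
      congr 1
      rcases hx with ⟨h1, -, h2⟩ | ⟨h1, -, h2⟩
      · rw [if_pos h1]
        have : a.num < 0 := Rat.num_neg.2 h2
        have e : (a.num : ℤ) = -(a.num.natAbs : ℤ) := by omega
        conv_lhs => rw [e]
        simp only [Int.cast_neg, Int.cast_natCast]
        ring
      · rw [if_neg h1]
        have : 0 ≤ a.num := Rat.num_nonneg.2 (not_lt.1 h2)
        have e : (a.num : ℤ) = (a.num.natAbs : ℤ) := by omega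
        conv_lhs => rw [e]
        simp only [Int.cast_natCast]
        ring

end

/-! ### Arithmetic of binary numbers by guessed relations -/

/-- The carry into the bit `t` of the sum `u + y`. -/
def Carry (u y t : ℕ) : Prop := 2 ^ t ≤ u % 2 ^ t + y % 2 ^ t

theorem carry_zero (u y : ℕ) : ¬ Carry u y 0 := by simp [Carry, Nat.mod_one]

theorem mod_two_pow_succ_eq (u t : ℕ) :
    u % 2 ^ (t + 1) = u % 2 ^ t + 2 ^ t * (u.testBit t).toNat := by
  rw [Nat.mod_pow_succ, Nat.toNat_testBit]

theorem carry_succ (u y t : ℕ) : Carry u y (t + 1) ↔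
    (u.testBit t = true ∧ y.testBit t = true) ∨ (u.testBit t = true ∧ Carry u y t) ∨
      (y.testBit t = true ∧ Carry u y t) := by
  unfold Carry
  rw [mod_two_pow_succ_eq, mod_two_pow_succ_eq]
  have h1 := Nat.mod_lt u (Nat.two_pow_pos t)
  have h2 := Nat.mod_lt y (Nat.two_pow_pos t)
  rw [pow_succ]
  cases u.testBit t <;> cases y.testBit t <;> simp <;> omega

/-- The nested equivalence expresses the parity of three bits: those of the two summands and the
carry. -/
theorem testBit_add_iff (u y t : ℕ) : (u + y).testBit t = true ↔
    (u.testBit t = true ↔ (y.testBit t = true ↔ Carry u y t)) := by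
  have h := mod_two_pow_succ_eq (u + y) t
  have h0 : (u + y) % 2 ^ (t + 1) = (u % 2 ^ (t + 1) + y % 2 ^ (t + 1)) % 2 ^ (t + 1) :=
    Nat.add_mod _ _ _
  have h0' : (u + y) % 2 ^ t = (u % 2 ^ t + y % 2 ^ t) % 2 ^ t := Nat.add_mod _ _ _
  have h1 := Nat.mod_lt u (Nat.two_pow_pos t)
  have h2 := Nat.mod_lt y (Nat.two_pow_pos t)
  have h3 := Nat.mod_lt (u + y) (Nat.two_pow_pos t)
  rw [mod_two_pow_succ_eq u, mod_two_pow_succ_eq y] at h0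
  unfold Carry
  generalize u % 2 ^ t = a at *
  generalize y % 2 ^ t = b at *
  rw [h0', h0] at h
  rw [pow_succ] at h
  generalize 2 ^ t = N at *
  have e1 : (a + b) % N = if N ≤ a + b then a + b - N else a + b := by
    split_ifs with hc
    · rw [Nat.mod_eq_sub_mod hc, Nat.mod_eq_of_lt (by omega)]
    · rw [Nat.mod_eq_of_lt (by omega)]
  rw [e1] at h
  have e2 : ∀ x, x < 4 * N → x % (N * 2) = if N * 2 ≤ x then x - N * 2 else x := by
    intro x hx
    split_ifs with hc
    · rw [Nat.mod_eq_sub_mod hc, Nat.mod_eq_of_lt (by omega)]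
    · rw [Nat.mod_eq_of_lt (by omega)]
  rw [e2 _ (by cases u.testBit t <;> cases y.testBit t <;> simp <;> omega)] at h
  clear h0 h0' e1 e2
  revert h
  cases u.testBit t <;> cases y.testBit t <;> cases (u + y).testBit t <;> simp <;>
    split_ifs <;> omega

/-- The witness is the most significant bit of `a ^^^ b`. The bound `n` will be the length of the
word, so that bit indices are positions and can be quantified. -/
theorem lt_iff_testBit {a b n : ℕ} (ha : a < 2 ^ n) (hb : b < 2 ^ n) :
    a < b ↔ ∃ t < n, ¬ a.testBit t = true ∧ b.testBit t = true ∧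
      ∀ r < n, t < r → (a.testBit r = true ↔ b.testBit r = true) := by
  constructor
  · intro h
    obtain ⟨t, h0, h3⟩ := Nat.exists_most_significant_bit (n := a ^^^ b)
      (by rw [Ne, Nat.xor_eq_zero_iff]; omega)
    have h3 : ∀ r, t < r → a.testBit r = b.testBit r := by
      intro r hr
      have := h3 r hr
      rwa [Nat.testBit_xor, bne_eq_false_iff_eq] at this
    obtain ⟨h1, h2⟩ : a.testBit t = false ∧ b.testBit t = true := by
      rw [Nat.testBit_xor] at h0
      cases h1 : a.testBit t
      · simpa [h1] using h0
      · have h2 : b.testBit t = false := by simpa [h1] using h0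
        have := Nat.lt_of_testBit t h2 h1 fun r hr => (h3 r hr).symm
        omega
    refine ⟨t, ?_, by simpa using h1, h2, fun r _ hr => by rw [h3 r hr]⟩
    by_contra htn
    rw [Nat.testBit_lt_two_pow (hb.trans_le (Nat.pow_le_pow_right (by omega) (by omega)))] at h2
    simp at h2
  · rintro ⟨t, -, h1, h2, h3⟩
    refine Nat.lt_of_testBit t (by simpa using h1) h2 fun r hr => ?_
    by_cases hrn : r < n
    · exact Bool.eq_iff_iff.2 (h3 r hrn hr)
    · rw [Nat.testBit_lt_two_pow (ha.trans_le (Nat.pow_le_pow_right (by omega) (by omega))),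
        Nat.testBit_lt_two_pow (hb.trans_le (Nat.pow_le_pow_right (by omega) (by omega)))]

/-! ### Products by shifting and adding -/

section
variable {S : Schema} {Cst : Type}

/-- The product of the numbers at two positions. -/
def prodAt (w : List (Ltr S Cst)) (i j : ℕ) : ℕ := ofBits (bitsAt w i) * ofBits (bitsAt w j)

open Classical in
/-- The contribution of the lowest bit of the first factor to a product. -/
noncomputable def lowPart (w : List (Ltr S Cst)) (i j : ℕ) : ℕ :=
  if w[i]? = some (.inl (.bit true)) then ofBits (bitsAt w j) else 0

open Classical in
/-- The contribution of the higher bits of the first factor to a product. -/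
noncomputable def highPart (w : List (Ltr S Cst)) (i j : ℕ) : ℕ :=
  if IsBit w i then 2 * prodAt w (i + 1) j else 0

variable {w : List (Ltr S Cst)}

/-- School multiplication: the lowest bit of the first factor contributes the second factor or
nothing, and the remaining bits, which form the number at `i + 1`, contribute twice their own
product. -/
theorem prodAt_eq (i j : ℕ) : prodAt w i j = lowPart w i j + highPart w i j := by
  unfold prodAt lowPart highPart
  by_cases h : IsBit w i
  · rw [if_pos h]
    obtain ⟨b, h⟩ := h
    rw [bitsAt_of_bit h, ofBits_cons, h, prodAt]
    cases b <;> simp <;> ring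
  · rw [if_neg h, if_neg fun h' => h ⟨_, h'⟩, bitsAt_of_not h]
    simp

/-- The digits in recursive form, with every quantifier bounded by the length of the word, as a
first-order formula requires. -/
theorem bitsAt_getElem?_iff {j t : ℕ} (ht : t < w.length) (b : Bool) :
    (bitsAt w j)[t]? = some b ↔ (t = 0 ∧ w[j]? = some (.inl (.bit b))) ∨
      (IsBit w j ∧ ∃ t' < w.length, t = t' + 1 ∧ ∃ j' < w.length, j' = j + 1 ∧
        (bitsAt w j')[t']? = some b) := by
  cases t with
  | zero => rw [bitsAt_getElem?_zero]; simp
  | succ t =>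
    rw [bitsAt_getElem?_succ]
    constructor
    · rintro ⟨h1, h2⟩
      refine .inr ⟨h1, t, by omega, rfl, j + 1, ?_, rfl, h2⟩
      by_contra h
      rw [bitsAt_of_not fun h' => h h'.lt] at h2
      simp at h2
    · rintro (⟨h, -⟩ | ⟨h1, t', -, h2, j', -, rfl, h4⟩)
      · simp at h
      · obtain rfl : t = t' := by omega
        exact ⟨h1, h4⟩

theorem testBit_lowPart (i j t : ℕ) : (lowPart w i j).testBit t = true ↔
    w[i]? = some (.inl (.bit true)) ∧ (bitsAt w j)[t]? = some true := by
  unfold lowPart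
  split_ifs with h <;> simp [h, testBit_ofBits]

theorem testBit_highPart {t : ℕ} (ht : t < w.length) (i j : ℕ) :
    (highPart w i j).testBit t = true ↔
    IsBit w i ∧ ∃ i' < w.length, i' = i + 1 ∧ ∃ t' < w.length, t = t' + 1 ∧
      (prodAt w i' j).testBit t' = true := by
  unfold highPart
  split_ifs with h
  · cases t with
    | zero => simp
    | succ t =>
      rw [show 2 * prodAt w (i + 1) j = Nat.bit false (prodAt w (i + 1) j) by simp [Nat.bit_val],
        Nat.testBit_bit_succ]
      constructor
      · intro h2
        refine ⟨h, i + 1, ?_, rfl, t, by omega, rfl, h2⟩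
        by_contra h3
        rw [prodAt, bitsAt_of_not fun h' => h3 h'.lt] at h2
        simp at h2
      · rintro ⟨-, i', -, rfl, t', -, h2, h3⟩
        obtain rfl : t = t' := by omega
        exact h3
  · simp [h]

/-- The relations `D`, `T`, `K` satisfy the recursion of the digits, of the bits of the products and
of the carries. -/
def ArithRec (w : List (Ltr S Cst)) (D : Bool → ℕ → ℕ → Prop) (T K : ℕ → ℕ → ℕ → Prop) : Prop :=
  (∀ b, ∀ j < w.length, ∀ t < w.length, (D b j t ↔ (t = 0 ∧ w[j]? = some (.inl (.bit b))) ∨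
    (IsBit w j ∧ ∃ t' < w.length, t = t' + 1 ∧ ∃ j' < w.length, j' = j + 1 ∧ D b j' t'))) ∧
  (∀ i < w.length, ∀ j < w.length, ∀ t < w.length,
    (T i j t ↔ ((w[i]? = some (.inl (.bit true)) ∧ D true j t) ↔
      ((IsBit w i ∧ ∃ i' < w.length, i' = i + 1 ∧ ∃ t' < w.length, t = t' + 1 ∧ T i' j t') ↔
        K i j t)))) ∧
  ∀ i < w.length, ∀ j < w.length, ∀ t < w.length, ∀ r < w.length, (t = 0 → ¬ K i j t) ∧
    (r = t + 1 → (K i j r ↔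
      ((w[i]? = some (.inl (.bit true)) ∧ D true j t) ∧
        (IsBit w i ∧ ∃ i' < w.length, i' = i + 1 ∧ ∃ t' < w.length, t = t' + 1 ∧ T i' j t')) ∨
      ((w[i]? = some (.inl (.bit true)) ∧ D true j t) ∧ K i j t) ∨
      ((IsBit w i ∧ ∃ i' < w.length, i' = i + 1 ∧ ∃ t' < w.length, t = t' + 1 ∧ T i' j t') ∧
        K i j t)))

theorem arithRec_self : ArithRec w (fun b j t => (bitsAt w j)[t]? = some b)
    (fun i j t => (prodAt w i j).testBit t = true)
    fun i j t => Carry (lowPart w i j) (highPart w i j) t := by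
  refine ⟨fun b j _ t ht => bitsAt_getElem?_iff ht b, fun i _ j _ t ht => ?_,
    fun i _ j _ t ht r _ => ⟨?_, ?_⟩⟩
  · beta_reduce
    rw [← testBit_lowPart, ← testBit_highPart ht, prodAt_eq i j, testBit_add_iff]
  · rintro rfl
    exact carry_zero _ _
  · rintro rfl
    beta_reduce
    rw [← testBit_lowPart, ← testBit_highPart ht, carry_succ]

theorem ArithRec.dig {D : Bool → ℕ → ℕ → Prop} {T K : ℕ → ℕ → ℕ → Prop} (h : ArithRec w D T K)
    {t : ℕ} (ht : t < w.length) {j : ℕ} (hj : j < w.length) (b : Bool) :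
    D b j t ↔ (bitsAt w j)[t]? = some b := by
  induction t generalizing j with
  | zero => rw [h.1 b j hj 0 ht, bitsAt_getElem?_iff ht]; simp
  | succ t ih =>
    rw [h.1 b j hj _ ht, bitsAt_getElem?_iff ht]
    refine or_congr_right (and_congr_right fun _ => exists_congr fun t' =>
      and_congr_right fun h1 => and_congr_right fun h2 => exists_congr fun j' =>
      and_congr_right fun h3 => and_congr_right fun h4 => ?_)
    obtain rfl : t = t' := by omega
    exact ih h1 h3

/-- The recursion determines its solution on positions. The bit `t` of the product at `i` depends on
digits, on the carry into `t`, and on the bit `t - 1` of the product at `i + 1`; the carry into `t`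
depends only on digits, product bits and carries of smaller index. Hence strong induction on `t`,
for all `i` at once. -/
theorem ArithRec.prod_carry {D : Bool → ℕ → ℕ → Prop} {T K : ℕ → ℕ → ℕ → Prop}
    (h : ArithRec w D T K) {t : ℕ} (ht : t < w.length) {i j : ℕ} (hi : i < w.length)
    (hj : j < w.length) :
    (T i j t ↔ (prodAt w i j).testBit t = true) ∧
      (K i j t ↔ Carry (lowPart w i j) (highPart w i j) t) := by
  induction t using Nat.strong_induction_on generalizing i with
  | _ t ih =>
    have hY : ∀ r ≤ t, ((IsBit w i ∧ ∃ i' < w.length, i' = i + 1 ∧ ∃ t' < w.length, r = t' + 1 ∧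
        T i' j t') ↔ (highPart w i j).testBit r = true) := by
      intro r hr
      rw [testBit_highPart (by omega)]
      refine and_congr_right fun _ => exists_congr fun i' => and_congr_right fun h1 =>
        and_congr_right fun h2 => exists_congr fun t' => and_congr_right fun h3 =>
        and_congr_right fun h4 => (ih t' (by omega) h3 h1).1
    have hK : K i j t ↔ Carry (lowPart w i j) (highPart w i j) t := by
      cases t with
      | zero =>
        have := (h.2.2 i hi j hj 0 ht 0 ht).1 rfl
        simp only [this, carry_zero]
      | succ t =>
        rw [(h.2.2 i hi j hj t (by omega) _ ht).2 rfl, carry_succ, hY t (by omega),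
          (ih t (by omega) (by omega) hi).2, h.dig (by omega) hj, testBit_lowPart]
    refine ⟨?_, hK⟩
    rw [h.2.1 i hi j hj t ht, hY t le_rfl, hK, h.dig ht hj, prodAt_eq i j, testBit_add_iff,
      testBit_lowPart]

end

/-! ### Definability of equality and order of the constants at given positions -/

/-- The auxiliary relations: digits, bits of products, and carries. -/
inductive Aux where
  | dig (b : Bool)
  | prod
  | carry

def Aux.arity : Aux → ℕ
  | .dig _ => 2
  | .prod => 3
  | .carry => 3

instance : Finite Aux :=
  Finite.of_injective (β := Option (Option Bool))
    (fun | .dig b => some (some b) | .prod => some none | .carry => none)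
    (by rintro (_ | _ | _) (_ | _ | _) <;> simp)

/-- The names of the guessed relations. -/
abbrev GRel (S : Schema) : Type := Aux ⊕ S.Rel

def GRel.arity (S : Schema) : GRel S → ℕ := Sum.elim Aux.arity S.arity

abbrev IMdl (S : Schema) (Cst : Type) : Type := Mdl (Ltr S Cst) (GRel S) (GRel.arity S)

section
variable {S : Schema} {Cst : Type}

def Mdl.dig (M : IMdl S Cst) (β : Bool) (b : Bool) (j t : ℕ) : Prop :=
  M.so β (.inl (.dig b)) (show Fin 2 → ℕ from ![j, t])

def Mdl.prod (M : IMdl S Cst) (β : Bool) (i j t : ℕ) : Prop :=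
  M.so β (.inl .prod) (show Fin 3 → ℕ from ![i, j, t])

def Mdl.carry (M : IMdl S Cst) (β : Bool) (i j t : ℕ) : Prop :=
  M.so β (.inl .carry) (show Fin 3 → ℕ from ![i, j, t])

/-- The auxiliary relations have their intended meaning. -/
def Mdl.AuxOK (M : IMdl S Cst) (β : Bool) : Prop :=
  ArithRec M.w (M.dig β) (M.prod β) (M.carry β)

/-- Auxiliary relations with the intended meaning. -/
def auxRels (w : List (Ltr S Cst)) : (x : Aux) → (Fin x.arity → ℕ) → Prop
  | .dig b => fun q : Fin 2 → ℕ => (bitsAt w (q 0))[q 1]? = some b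
  | .prod => fun q : Fin 3 → ℕ => (prodAt w (q 0) (q 1)).testBit (q 2) = true
  | .carry => fun q : Fin 3 → ℕ => Carry (lowPart w (q 0) (q 1)) (highPart w (q 0) (q 1)) (q 2)

theorem auxOK_of_eq {β : Bool} {M : IMdl S Cst} (h : ∀ x, M.so β (.inl x) = auxRels M.w x) :
    M.AuxOK β := by
  have e1 : M.dig β = fun b j t => (bitsAt M.w j)[t]? = some b := by
    funext b j t
    unfold Mdl.dig
    rw [h]
    rfl
  have e2 : M.prod β = fun i j t => (prodAt M.w i j).testBit t = true := by
    funext i j t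
    unfold Mdl.prod
    rw [h]
    rfl
  have e3 : M.carry β = fun i j t => Carry (lowPart M.w i j) (highPart M.w i j) t := by
    funext i j t
    unfold Mdl.carry
    rw [h]
    rfl
  rw [Mdl.AuxOK, e1, e2, e3]
  exact arithRec_self

namespace Dfn
variable {C : IMdl S Cst → Prop} {d : ℕ}

theorem dig (β b : Bool) (j t : Fin d) : Dfn C fun M ρ => M.dig β b (ρ j) (ρ t) :=
  (Dfn.so β (.inl (.dig b)) (show Fin 2 → Fin d from ![j, t])).congr fun M _ ρ _ => iff_of_eq (by
    unfold Mdl.dig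
    congr 1
    funext k
    change Fin 2 at k
    fin_cases k <;> rfl)

theorem prod (β : Bool) (i j t : Fin d) : Dfn C fun M ρ => M.prod β (ρ i) (ρ j) (ρ t) :=
  (Dfn.so β (.inl .prod) (show Fin 3 → Fin d from ![i, j, t])).congr fun M _ ρ _ => iff_of_eq (by
    unfold Mdl.prod
    congr 1
    funext k
    change Fin 3 at k
    fin_cases k <;> rfl)

theorem carry (β : Bool) (i j t : Fin d) : Dfn C fun M ρ => M.carry β (ρ i) (ρ j) (ρ t) :=
  (Dfn.so β (.inl .carry) (show Fin 3 → Fin d from ![i, j, t])).congr fun M _ ρ _ => iff_of_eq (by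
    unfold Mdl.carry
    congr 1
    funext k
    change Fin 3 at k
    fin_cases k <;> rfl)

theorem isBit (i : Fin d) : Dfn C fun M ρ => IsBit M.w (ρ i) :=
  Dfn.exists_finite fun _ => Dfn.letter _ _

theorem low (β : Bool) (i j t : Fin d) : Dfn C fun M ρ =>
    M.w[ρ i]? = some (.inl (.bit Bool.true)) ∧ M.dig β Bool.true (ρ j) (ρ t) :=
  (Dfn.letter _ _).and (Dfn.dig _ _ _ _)

theorem high (β : Bool) (i j t : Fin d) : Dfn C fun M ρ =>
    IsBit M.w (ρ i) ∧ ∃ i' < M.w.length, i' = ρ i + 1 ∧ ∃ t' < M.w.length, ρ t = t' + 1 ∧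
      M.prod β i' (ρ j) t' :=
  (Dfn.isBit _).and (Dfn.ex (P := fun M ρ i' => i' = ρ i + 1 ∧ ∃ t' < M.w.length, ρ t = t' + 1 ∧
    M.prod β i' (ρ j) t') ((Dfn.succ _ _).and (Dfn.ex (P := fun M ρ t' => ρ t.castSucc = t' + 1 ∧
    M.prod β (ρ (Fin.last d)) (ρ j.castSucc) t') ((Dfn.succ _ _).and (Dfn.prod _ _ _ _)))))

theorem auxOK (β : Bool) : Dfn C (d := d) fun M _ => M.AuxOK β := by
  unfold Mdl.AuxOK ArithRec
  refine .and (.forall_finite fun b => .all (.all (.iff (.dig _ _ _ _) (.or (.and (.zero _)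
    (.letter _ _)) (.and (.isBit _) (.ex (.and (.succ _ _) (.ex (.and (.succ _ _)
      (.dig _ _ _ _)))))))))) (.and (.all (.all (.all (.iff (.prod _ _ _ _) (.iff (.low _ _ _ _)
      (.iff (.high _ _ _ _) (.carry _ _ _ _))))))) (.all (.all (.all (.all (.and
      (.imp (.zero _) (.not (.carry _ _ _ _))) (.imp (.succ _ _) (.iff (.carry _ _ _ _)
      (.or (.and (.low _ _ _ _) (.high _ _ _ _)) (.or (.and (.low _ _ _ _) (.carry _ _ _ _))
      (.and (.high _ _ _ _) (.carry _ _ _ _))))))))))))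

theorem blk (x y : Fin d) : Dfn C fun M ρ => Blk M.w (ρ x) (ρ y) :=
  .and (.le _ _) (.and (.all (.imp (.le _ _) (.imp (.lt _ _) (.isBit _)))) (.not (.isBit _)))

variable {β : Bool}

theorem bit (hC : ∀ M, C M → M.AuxOK β) (b : Bool) (j t : Fin d) :
    Dfn C fun M ρ => (bitsAt M.w (ρ j))[ρ t]? = some b :=
  (Dfn.dig β b j t).congr fun M hM _ hρ => (hC M hM).dig (hρ t) (hρ j) b

theorem prodBit (hC : ∀ M, C M → M.AuxOK β) (i j t : Fin d) :
    Dfn C fun M ρ => (prodAt M.w (ρ i) (ρ j)).testBit (ρ t) = Bool.true :=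
  (Dfn.prod β i j t).congr fun M hM _ hρ => ((hC M hM).prod_carry (hρ t) (hρ i) (hρ j)).1

theorem ratAt (hC : ∀ M, C M → M.AuxOK β) (p x y z : Fin d) :
    Dfn C fun M ρ => RatAt M.w (ρ p) (ρ x) (ρ y) (ρ z) := by
  have h : Dfn C fun M ρ => (M.w[ρ p]? = some (.inl .minus) ∧ ρ x = ρ p + 1 ∨
      ¬ M.w[ρ p]? = some (.inl .minus) ∧ ρ x = ρ p) ∧ Blk M.w (ρ x) (ρ y) ∧
      M.w[ρ y]? = some (.inl .slash) ∧ M.w[ρ z]? = some (.inl .endMark) ∧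
      ∃ y' < M.w.length, y' = ρ y + 1 ∧ Blk M.w y' (ρ z) ∧
        ∃ t < M.w.length, (bitsAt M.w y')[t]? = some Bool.true :=
    .and (.or (.and (.letter _ _) (.succ _ _)) (.and (.not (.letter _ _)) (.eq _ _)))
      (.and (.blk _ _) (.and (.letter _ _) (.and (.letter _ _) (.ex (.and (.succ _ _)
      (.and (.blk _ _) (.ex (.bit hC _ _ _))))))))
  refine h.congr fun M _ ρ hρ => ⟨?_, fun h => ?_⟩
  · rintro ⟨h1, h2, h3, h4, _, -, rfl, h6, h7⟩
    exact ⟨h1, h2, h3, h6, h4, h7⟩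
  · have := h.lt
    have := hρ z
    exact ⟨h.sign, h.num, h.slash, h.endMark, ρ y + 1, by omega, rfl, h.den, h.ne_zero⟩

end Dfn

/-- There is a constant of type `s` at the position `p`. -/
def Good (w : List (Ltr S Cst)) (s : Srt) (p : ℕ) : Prop := ∃ a, Den w s p a

/-- The same constant of type `s` is at the positions `p` and `q`. -/
def SameVal (w : List (Ltr S Cst)) (s : Srt) (p q : ℕ) : Prop := ∃ a, Den w s p a ∧ Den w s q a

/-- The rational at the position `p` is less than the rational at the position `q`. -/
def LtVal (w : List (Ltr S Cst)) (p q : ℕ) : Prop :=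
  ∃ a b : ℚ, Den w .rat p a ∧ Den w .rat q b ∧ a < b

variable {w : List (Ltr S Cst)}

theorem good_rat_iff {p : ℕ} : Good w .rat p ↔
    ∃ x < w.length, ∃ y < w.length, ∃ z < w.length, RatAt w p x y z := by
  constructor
  · rintro ⟨a, x, y, z, h, -⟩
    have := h.lt
    exact ⟨x, by omega, y, by omega, z, by omega, h⟩
  · rintro ⟨x, -, y, -, z, -, h⟩
    exact ⟨_, x, y, z, h, rfl⟩

/-- Different words may denote the same rational, so equality is not tested letter by letter but
derived from the order. -/
theorem sameVal_rat_iff {p q : ℕ} : SameVal w .rat p q ↔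
    Good w .rat p ∧ Good w .rat q ∧ ¬ LtVal w p q ∧ ¬ LtVal w q p := by
  constructor
  · rintro ⟨a, h1, h2⟩
    refine ⟨⟨a, h1⟩, ⟨a, h2⟩, ?_, ?_⟩
    · rintro ⟨b, c, h3, h4, h5⟩
      rw [← h1.unique h3, ← h2.unique h4] at h5
      exact lt_irrefl _ h5
    · rintro ⟨b, c, h3, h4, h5⟩
      rw [← h2.unique h3, ← h1.unique h4] at h5
      exact lt_irrefl _ h5
  · rintro ⟨⟨a, ha⟩, ⟨b, hb⟩, h1, h2⟩
    refine ⟨a, ha, ?_⟩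
    have h1 : ¬ (show ℚ from a) < b := fun h => h1 ⟨a, b, ha, hb, h⟩
    have h2 : ¬ (show ℚ from b) < a := fun h => h2 ⟨b, a, hb, ha, h⟩
    rwa [show a = b from le_antisymm (α := ℚ) (not_lt.1 h2) (not_lt.1 h1)]

/-- Comparison of products by their bits. -/
def ProdLt (w : List (Ltr S Cst)) (i j i' j' : ℕ) : Prop :=
  ∃ t < w.length, ¬ (prodAt w i j).testBit t = true ∧ (prodAt w i' j').testBit t = true ∧
    ∀ r < w.length, t < r → ((prodAt w i j).testBit r = true ↔ (prodAt w i' j').testBit r = true)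

/-- Together with `RatAt.length_add_le` this ensures that the cross products of two fractions have
no bits beyond the positions of the word. -/
theorem prodAt_lt {i j : ℕ} (h : (bitsAt w i).length + (bitsAt w j).length ≤ w.length) :
    prodAt w i j < 2 ^ w.length :=
  calc prodAt w i j < 2 ^ (bitsAt w i).length * 2 ^ (bitsAt w j).length :=
        Nat.mul_lt_mul'' (ofBits_lt _) (ofBits_lt _)
    _ ≤ 2 ^ w.length := by rw [← pow_add]; exact Nat.pow_le_pow_right (by omega) h

theorem ofBits_ne_zero_iff {i : ℕ} :
    ofBits (bitsAt w i) ≠ 0 ↔ ∃ t < w.length, (bitsAt w i)[t]? = some true := by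
  constructor
  · intro h
    obtain ⟨t, ht⟩ := Nat.exists_testBit_of_ne_zero h
    rw [testBit_ofBits] at ht
    refine ⟨t, ?_, ht⟩
    have := (List.getElem?_eq_some_iff.1 ht).1
    have := bitsAt_length_le (w := w) (p := i)
    omega
  · rintro ⟨t, -, ht⟩ h
    rw [← testBit_ofBits, h] at ht
    simp at ht

/-- The comparison of two fractions, in terms of signs and products. -/
def FracLt (w : List (Ltr S Cst)) (p x y q x' y' : ℕ) : Prop :=
  (w[p]? = some (.inl .minus) ∧ w[q]? = some (.inl .minus) ∧ ProdLt w x' y x y') ∨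
  (w[p]? = some (.inl .minus) ∧ ¬ w[q]? = some (.inl .minus) ∧
    ((∃ t < w.length, (bitsAt w x)[t]? = some true) ∨
      ∃ t < w.length, (bitsAt w x')[t]? = some true)) ∨
  (¬ w[p]? = some (.inl .minus) ∧ ¬ w[q]? = some (.inl .minus) ∧ ProdLt w x y' x' y)

-- Cross-multiplication by the positive denominators. For equal signs one compares products, in
-- reverse order if both are negative; a minus sign against none gives a strict inequality unless
-- both numerators vanish, since a signed zero is not excluded.
open Classical in
theorem fracLt_iff {p q x y z x' y' z' : ℕ} (h : RatAt w p x y z) (h' : RatAt w q x' y' z') :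
    FracLt w p x (y + 1) q x' (y' + 1) ↔
    ((if w[p]? = some (.inl .minus) then -1 else 1) * ofBits (bitsAt w x) /
        ofBits (bitsAt w (y + 1)) : ℚ) <
      (if w[q]? = some (.inl .minus) then -1 else 1) * ofBits (bitsAt w x') /
        ofBits (bitsAt w (y' + 1)) := by
  have e1 := lt_iff_testBit (prodAt_lt (h.length_add_le h')) (prodAt_lt (h'.length_add_le h))
  have e2 := lt_iff_testBit (prodAt_lt (h'.length_add_le h)) (prodAt_lt (h.length_add_le h'))
  unfold FracLt
  rw [ProdLt, ProdLt, ← e1, ← e2, ← ofBits_ne_zero_iff, ← ofBits_ne_zero_iff]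
  unfold prodAt
  have hd := h.den_pos
  have hd' := h'.den_pos
  generalize ofBits (bitsAt w (y + 1)) = b at *
  generalize ofBits (bitsAt w (y' + 1)) = b' at *
  generalize ofBits (bitsAt w x) = a at *
  generalize ofBits (bitsAt w x') = a' at *
  have hb : (0 : ℚ) < b := by exact_mod_cast hd
  have hb' : (0 : ℚ) < b' := by exact_mod_cast hd'
  rw [div_lt_div_iff₀ hb hb']
  by_cases hp : w[p]? = some (.inl .minus) <;> by_cases hq : w[q]? = some (.inl .minus) <;>
    simp only [hp, hq, true_and, false_and, not_true, not_false_eq_true, or_false, false_or,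
      if_true, if_false]
  · rw [neg_one_mul, neg_one_mul, neg_mul, neg_mul, neg_lt_neg_iff]
    norm_cast
  · rw [neg_one_mul, one_mul, neg_mul]
    constructor
    · rintro (h | h)
      · have : (0 : ℚ) < a := by exact_mod_cast Nat.pos_of_ne_zero h
        have : (0 : ℚ) ≤ a' := by positivity
        nlinarith [mul_pos ‹(0 : ℚ) < a› hb', mul_nonneg this hb.le]
      · have : (0 : ℚ) < a' := by exact_mod_cast Nat.pos_of_ne_zero h
        nlinarith [mul_pos this hb, mul_nonneg (Nat.cast_nonneg (α := ℚ) a) hb'.le]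
    · intro h
      by_contra hcon
      push Not at hcon
      obtain ⟨rfl, rfl⟩ := hcon
      simp at h
  · rw [neg_one_mul, one_mul, neg_mul]
    simp only [false_iff, not_lt]
    have : (0 : ℚ) ≤ a * b' := by positivity
    have : (0 : ℚ) ≤ a' * b := by positivity
    linarith
  · rw [one_mul, one_mul]
    norm_cast

theorem ltVal_iff {p q : ℕ} : LtVal w p q ↔
    ∃ x < w.length, ∃ y < w.length, ∃ z < w.length, RatAt w p x y z ∧
    ∃ x' < w.length, ∃ y' < w.length, ∃ z' < w.length, RatAt w q x' y' z' ∧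
    ∃ u < w.length, u = y + 1 ∧ ∃ u' < w.length, u' = y' + 1 ∧ FracLt w p x u q x' u' := by
  constructor
  · rintro ⟨a, b, ⟨x, y, z, h, ha⟩, ⟨x', y', z', h', hb⟩, hab⟩
    have := h.lt
    have := h'.lt
    refine ⟨x, by omega, y, by omega, z, by omega, h, x', by omega, y', by omega, z', by omega, h',
      _, by omega, rfl, _, by omega, rfl, (fracLt_iff h h').2 ?_⟩
    rwa [← ha, ← hb]
  · rintro ⟨x, -, y, -, z, -, h, x', -, y', -, z', -, h', _, -, rfl, _, -, rfl, hlt⟩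
    exact ⟨_, _, ⟨x, y, z, h, rfl⟩, ⟨x', y', z', h', rfl⟩, (fracLt_iff h h').1 hlt⟩

theorem sameVal_name_iff {p q : ℕ} : SameVal w .name p q ↔
    ∀ t < w.length, ∀ b, ((bitsAt w p)[t]? = some b ↔ (bitsAt w q)[t]? = some b) := by
  constructor
  · rintro ⟨a, h1, h2⟩ t _ b
    rw [show bitsAt w p = a from h1, show bitsAt w q = a from h2]
  · intro h
    refine ⟨bitsAt w p, rfl, (List.ext_getElem? fun t => ?_ : bitsAt w q = bitsAt w p)⟩
    by_cases ht : t < w.length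
    · exact Option.ext fun b => (h t ht b).symm
    · have h1 := bitsAt_length_le (w := w) (p := p)
      have h2 := bitsAt_length_le (w := w) (p := q)
      rw [List.getElem?_eq_none (by omega), List.getElem?_eq_none (by omega)]

namespace Dfn
variable {C : IMdl S Cst → Prop} {d : ℕ} {β : Bool}

theorem prodLt (hC : ∀ M, C M → M.AuxOK β) (i j i' j' : Fin d) :
    Dfn C fun M ρ => ProdLt M.w (ρ i) (ρ j) (ρ i') (ρ j') :=
  .ex (.and (.not (.prodBit hC _ _ _)) (.and (.prodBit hC _ _ _) (.all (.imp (.lt _ _)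
    (.iff (.prodBit hC _ _ _) (.prodBit hC _ _ _))))))

theorem fracLt (hC : ∀ M, C M → M.AuxOK β) (p x y q x' y' : Fin d) :
    Dfn C fun M ρ => FracLt M.w (ρ p) (ρ x) (ρ y) (ρ q) (ρ x') (ρ y') :=
  .or (.and (.letter _ _) (.and (.letter _ _) (.prodLt hC _ _ _ _)))
    (.or (.and (.letter _ _) (.and (.not (.letter _ _)) (.or (.ex (.bit hC _ _ _))
      (.ex (.bit hC _ _ _)))))
      (.and (.not (.letter _ _)) (.and (.not (.letter _ _)) (.prodLt hC _ _ _ _))))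

theorem ltVal (hC : ∀ M, C M → M.AuxOK β) (p q : Fin d) :
    Dfn C fun M ρ => LtVal M.w (ρ p) (ρ q) :=
  Dfn.congr (.ex (.ex (.ex (.and (.ratAt hC _ _ _ _) (.ex (.ex (.ex (.and (.ratAt hC _ _ _ _)
    (.ex (.and (.succ _ _) (.ex (.and (.succ _ _) (.fracLt hC _ _ _ _ _ _)))))))))))))
    fun _ _ _ _ => ltVal_iff.symm

theorem good (hC : ∀ M, C M → M.AuxOK β) (s : Srt) (p : Fin d) :
    Dfn C fun M ρ => Good M.w s (ρ p) := by
  cases s with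
  | rat => exact Dfn.congr (.ex (.ex (.ex (.ratAt hC _ _ _ _)))) fun _ _ _ _ => good_rat_iff.symm
  | name => exact Dfn.true.congr fun M _ ρ _ => ⟨fun _ => ⟨_, rfl⟩, fun _ => trivial⟩

theorem sameVal (hC : ∀ M, C M → M.AuxOK β) (s : Srt) (p q : Fin d) :
    Dfn C fun M ρ => SameVal M.w s (ρ p) (ρ q) := by
  cases s with
  | rat =>
    exact Dfn.congr (.and (.good hC .rat p) (.and (.good hC .rat q) (.and (.not (.ltVal hC p q))
      (.not (.ltVal hC q p))))) fun _ _ _ _ => sameVal_rat_iff.symm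
  | name =>
    exact Dfn.congr (.all (.forall_finite fun b => .iff (.bit hC b _ _) (.bit hC b _ _)))
      fun _ _ _ _ => sameVal_name_iff.symm

end Dfn

end

/-! ### Evaluation of formulas over the whole domains by quantification over positions -/

/-- Only finitely many comparison patterns relative to `O` exist; `T` contains one point for each
pattern that is realized. -/
theorem finite_cmp_types {α : Type} [LinearOrder α] (O : Set α) (hO : O.Finite) :
    ∃ T : Finset α, ∀ a, ∃ b ∈ T, ∀ x ∈ O, cmp x a = cmp x b := by
  have := hO.to_subtype
  have : Finite Ordering := Finite.of_injective (β := Fin 3)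
    (fun | .lt => 0 | .eq => 1 | .gt => 2) (by rintro (_ | _ | _) (_ | _ | _) <;> simp)
  let f : α → (O → Ordering) := fun a x => cmp x.1 a
  have hfin : (Set.range f).Finite := Set.toFinite _
  obtain ⟨T, -, hT⟩ := Set.exists_subset_bijOn Set.univ f
  have hTfin : T.Finite := Set.Finite.of_finite_image (hfin.subset (by
    rintro _ ⟨x, -, rfl⟩
    exact ⟨x, rfl⟩)) hT.injOn
  refine ⟨hTfin.toFinset, fun a => ?_⟩
  obtain ⟨b, hb, e⟩ := hT.surjOn ⟨a, trivial, rfl⟩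
  exact ⟨b, by simpa using hb, fun x hx => (congrFun e ⟨x, hx⟩).symm⟩

theorem cmp_toLex_congr {α β : Type} [LinearOrder α] [LinearOrder β] {a b : α} {x y z : β}
    (h : cmp x y = cmp x z) : cmp (toLex (b, x)) (toLex (a, y)) =
      cmp (toLex (b, x)) (toLex (a, z)) := by
  have h1 := lt_iff_lt_of_cmp_eq_cmp h
  have h2 := lt_iff_lt_of_cmp_eq_cmp (cmp_eq_cmp_symm.1 h)
  rw [cmp, cmp, cmpUsing, cmpUsing]
  simp only [Prod.Lex.toLex_lt_toLex, h1, h2]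

/-- The constants of each type, numbered by rationals (the rationals by themselves). -/
noncomputable def rank : (s : Srt) → Dom s ≃ ℚ
  | .rat => Equiv.refl ℚ
  | .name => ((Denumerable.ofEncodableOfInfinite (List Bool)).eqv.trans
      (Denumerable.eqv ℚ).symm : List Bool ≃ ℚ)

/-! ### Places for values, and the back-and-forth argument -/

section
variable {S : Schema} {Cst : Type}

/-- The constant at the position `p` is the one numbered `c`. -/
def RankAt (w : List (Ltr S Cst)) (s : Srt) (p : ℕ) (c : ℚ) : Prop :=
  p < w.length ∧ Den w s p ((rank s).symm c)

/-- The numbers of the constants that occur in a word. -/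
def Ranks (w : List (Ltr S Cst)) (s : Srt) : Set ℚ := {c | ∃ p, RankAt w s p c}

variable {w : List (Ltr S Cst)}

theorem RankAt.unique {s : Srt} {p : ℕ} {c c' : ℚ} (h : RankAt w s p c) (h' : RankAt w s p c') :
    c = c' := (rank s).symm.injective (h.2.unique h'.2)

theorem rankAt_rank {s : Srt} {p : ℕ} {a : Dom s} :
    RankAt w s p (rank s a) ↔ p < w.length ∧ Den w s p a := by simp [RankAt]

/-- Each position holds at most one constant of type `s`. -/
theorem ranks_finite (w : List (Ltr S Cst)) (s : Srt) : (Ranks w s).Finite := by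
  have : Ranks w s ⊆ ⋃ p ∈ Finset.range w.length, {c | RankAt w s p c} := by
    rintro c ⟨p, hp⟩
    exact Set.mem_biUnion (by simpa using hp.1) hp
  refine Set.Finite.subset (Set.Finite.biUnion (Finset.finite_toSet _) fun p _ => ?_) this
  exact Set.Subsingleton.finite fun c hc c' hc' => hc.unique hc'

/-- The order of the numbers that occur in the word (at offset `0`) and of the values of the
variables in `W`, matched with their abstract places: a number that occurs and an offset. -/
def entries (w : List (Ltr S Cst)) (W : Set Var) (o : Var → ℚ) (q : Var → ℕ) (v : Valuation)
    (s : Srt) : Set ((Ranks w s ×ₗ ℚ) × ℚ) :=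
  {e | (∃ c : Ranks w s, e = (toLex (c, 0), c.1)) ∨
    ∃ i, (⟨s, i⟩ : Var) ∈ W ∧ ∃ c : Ranks w s, RankAt w s (q ⟨s, i⟩) c ∧
      e = (toLex (c, o ⟨s, i⟩), rank s (v ⟨s, i⟩))}

/-- The valuation `v` of the variables in `W` is described by the offsets `o` and positions `q`. -/
structure Agree (w : List (Ltr S Cst)) (W : Set Var) (o : Var → ℚ) (q : Var → ℕ)
    (v : Valuation) : Prop where
  pos : ∀ x ∈ W, ∃ c, RankAt w x.sort (q x) c
  cmp : ∀ s, ∀ e ∈ entries w W o q v s, ∀ e' ∈ entries w W o q v s, cmp e.1 e'.1 = cmp e.2 e'.2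

variable {W : Set Var} {o : Var → ℚ} {q : Var → ℕ} {v : Valuation}

theorem entries_finite (hW : W.Finite) (s : Srt) : (entries w W o q v s).Finite := by
  have := (ranks_finite w s).to_subtype
  have h1 : (entries w W o q v s) ⊆
      (Set.range fun c : Ranks w s => ((toLex (c, 0), c.1) : (Ranks w s ×ₗ ℚ) × ℚ)) ∪
      (fun p : Ranks w s × Var => ((toLex (p.1, o p.2), if h : p.2.sort = s then
        rank s (h ▸ v p.2) else 0) : (Ranks w s ×ₗ ℚ) × ℚ)) '' (Set.univ ×ˢ W) := by
    rintro e (⟨c, rfl⟩ | ⟨i, hi, c, -, rfl⟩)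
    · exact .inl ⟨c, rfl⟩
    · exact .inr ⟨(c, ⟨s, i⟩), ⟨trivial, hi⟩, by simp⟩
  exact ((Set.finite_range _).union ((Set.finite_univ.prod hW).image _)).subset h1

theorem agree_empty (o : Var → ℚ) (q : Var → ℕ) (v : Valuation) : Agree w ∅ o q v := by
  refine ⟨fun x hx => hx.elim, ?_⟩
  rintro s e (⟨c, rfl⟩ | ⟨i, hi, -⟩) e' (⟨c', rfl⟩ | ⟨i, hi, -⟩)
  · show cmp (toLex (c, (0 : ℚ))) (toLex (c', 0)) = cmp c.1 c'.1
    rw [cmp, cmp, cmpUsing, cmpUsing]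
    simp only [Prod.Lex.toLex_lt_toLex]
    simp
  all_goals exact hi.elim

/-- Only the comparisons of the new entry with the old ones have to be checked. If the variable was
described before, its former entry disappears by the updates. -/
theorem Agree.extend (h : Agree w W o q v) {s : Srt} (i : ℕ) {p : ℕ} {c : Ranks w s} {r : ℚ}
    {a : Dom s} (hp : RankAt w s p c)
    (hc : ∀ e ∈ entries w W o q v s, _root_.cmp e.1 (toLex (c, r)) = _root_.cmp e.2 (rank s a)) :
    Agree w (insert ⟨s, i⟩ W) (Function.update o ⟨s, i⟩ r) (Function.update q ⟨s, i⟩ p)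
      (Function.update v ⟨s, i⟩ a) := by
  have key : ∀ s' e, e ∈ entries w (insert ⟨s, i⟩ W) (Function.update o ⟨s, i⟩ r)
      (Function.update q ⟨s, i⟩ p) (Function.update v ⟨s, i⟩ a) s' →
      e ∈ entries w W o q v s' ∨ ∃ hs : s = s', e = hs ▸ ((toLex (c, r), rank s a) :
        (Ranks w s ×ₗ ℚ) × ℚ) := by
    rintro s' e (h' | ⟨j, hj, d, hd, rfl⟩)
    · exact .inl (.inl h')
    · by_cases hx : (⟨s', j⟩ : Var) = ⟨s, i⟩
      · obtain ⟨rfl, rfl⟩ := Var.mk.inj hx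
        right
        refine ⟨rfl, ?_⟩
        simp only [Function.update_self] at hd ⊢
        rw [Subtype.ext (hd.unique hp)]
      · left
        right
        simp only [Function.update_of_ne hx] at hd ⊢
        exact ⟨j, hj.resolve_left hx, d, hd, rfl⟩
  refine ⟨fun x hx => ?_, fun s' e he e' he' => ?_⟩
  · by_cases hxx : x = ⟨s, i⟩
    · subst hxx
      exact ⟨c, by simpa using hp⟩
    · simp only [Function.update_of_ne hxx]
      exact h.pos x (hx.resolve_left hxx)
  · rcases key s' e he with he | ⟨rfl, rfl⟩ <;> rcases key _ e' he' with he' | ⟨h2, rfl⟩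
    · exact h.cmp s' e he e' he'
    · subst h2
      exact hc e he
    · exact cmp_eq_cmp_symm.1 (hc e' he')
    · simp

/-- The entries form a finite partial isomorphism into `ℚ`, which is dense without endpoints, so
every new place receives a matching value. -/
theorem Agree.exists_value (h : Agree w W o q v) (hW : W.Finite) {s : Srt} (i : ℕ) {p : ℕ} {c : ℚ}
    (hp : RankAt w s p c) (r : ℚ) : ∃ a : Dom s, Agree w (insert ⟨s, i⟩ W)
      (Function.update o ⟨s, i⟩ r) (Function.update q ⟨s, i⟩ p) (Function.update v ⟨s, i⟩ a) := by
  let f : Order.PartialIso (Ranks w s ×ₗ ℚ) ℚ := ⟨(entries_finite (v := v) (o := o) (q := q) hW s).toFinset,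
    fun e he e' he' => h.cmp s e (by simpa using he) e' (by simpa using he')⟩
  obtain ⟨b, hb⟩ := f.exists_across (toLex (⟨c, p, hp⟩, r))
  refine ⟨(rank s).symm b, h.extend i (c := ⟨c, p, hp⟩) hp fun e he => ?_⟩
  rw [Equiv.apply_symm_apply]
  exact hb e (by simpa [f] using he)

/-- The converse direction: a nonempty set of ranks times `ℚ`, ordered lexicographically, is dense
without endpoints, so every new value has a place. Its offset may be exchanged for one in `T`,
because comparisons with entries involve only the offset `0` and those in use. -/
theorem Agree.exists_place (h : Agree w W o q v) (hW : W.Finite) {s : Srt} (i : ℕ) (a : Dom s)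
    (hne : (Ranks w s).Nonempty) {T : Finset ℚ}
    (hT : ∀ r, ∃ r' ∈ T, ∀ x ∈ insert 0 (o '' W), _root_.cmp x r = _root_.cmp x r') :
    ∃ r ∈ T, ∃ p c, RankAt w s p c ∧ Agree w (insert ⟨s, i⟩ W)
      (Function.update o ⟨s, i⟩ r) (Function.update q ⟨s, i⟩ p) (Function.update v ⟨s, i⟩ a) := by
  let f : Order.PartialIso (Ranks w s ×ₗ ℚ) ℚ := ⟨(entries_finite (v := v) (o := o) (q := q) hW s).toFinset,
    fun e he e' he' => h.cmp s e (by simpa using he) e' (by simpa using he')⟩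
  have := hne.to_subtype
  obtain ⟨b, hb⟩ := f.comm.exists_across (rank s a)
  have hb : ∀ e ∈ entries w W o q v s, _root_.cmp e.1 b = _root_.cmp e.2 (rank s a) :=
    fun e he => (hb (e.2, e.1) (by
      simp only [Order.PartialIso.comm, f]
      simpa using he)).symm
  obtain ⟨⟨c, p, hp⟩, r⟩ := b
  obtain ⟨r', hr', hcmp⟩ := hT r
  refine ⟨r', hr', p, c, hp, h.extend i (c := ⟨c, p, hp⟩) hp fun e he => ?_⟩
  rw [← hb e he]
  rcases he with ⟨d, rfl⟩ | ⟨j, hj, d, -, rfl⟩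
  · exact (cmp_toLex_congr (hcmp 0 (by simp))).symm
  · exact (cmp_toLex_congr (hcmp _ (.inr ⟨_, hj, rfl⟩))).symm

/-! ### Terms -/

/-- The letters `inr k` of the word mark the constants `val k`. -/
def Marked (val : Cst → Σ s, Dom s) (w : List (Ltr S Cst)) : Prop :=
  ∀ k, (∃ m : ℕ, w[m]? = some (.inr k)) ∧
    ∀ m : ℕ, w[m]? = some (.inr k) → m + 1 < w.length ∧ Den w (val k).1 (m + 1) (val k).2

/-- The base position of the value of a term. -/
def TermPos (val : Cst → Σ s, Dom s) (w : List (Ltr S Cst)) (q : Var → ℕ) {s : Srt} :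
    Term s → ℕ → Prop
  | .var i, p => p = q ⟨s, i⟩
  | .const a, p => ∃ k, val k = ⟨s, a⟩ ∧ ∃ m < w.length, w[m]? = some (.inr k) ∧ p = m + 1

/-- The offset of the value of a term. -/
def Term.offset (o : Var → ℚ) {s : Srt} : Term s → ℚ
  | .var i => o ⟨s, i⟩
  | .const _ => 0

/-- The constants of a term. -/
def Term.consts {s : Srt} : Term s → Set (Σ s, Dom s)
  | .var _ => ∅
  | .const a => {⟨s, a⟩}

variable {val : Cst → Σ s, Dom s}

theorem exists_termPos (hw : Marked val w) (h : Agree w W o q v) {s : Srt} {t : Term s}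
    (ht : t.vars ⊆ W) (ht' : t.consts ⊆ Set.range val) : ∃ p < w.length, TermPos val w q t p := by
  cases t with
  | var i =>
    obtain ⟨c, hc⟩ := h.pos ⟨s, i⟩ (ht rfl)
    exact ⟨_, hc.1, rfl⟩
  | const a =>
    obtain ⟨k, hk⟩ := ht' rfl
    obtain ⟨m, hm⟩ := (hw k).1
    exact ⟨m + 1, ((hw k).2 m hm).1, k, hk, m, (List.getElem?_eq_some_iff.1 hm).1, hm, rfl⟩

theorem exists_entry (hw : Marked val w) (h : Agree w W o q v) {s : Srt} {t : Term s}
    (ht : t.vars ⊆ W) {p : ℕ} (hp : TermPos val w q t p) : ∃ c : Ranks w s, RankAt w s p c ∧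
      (toLex (c, t.offset o), rank s (t.eval v)) ∈ entries w W o q v s := by
  cases t with
  | var i =>
    obtain ⟨c, hc⟩ := h.pos ⟨s, i⟩ (ht rfl)
    have e : p = q ⟨s, i⟩ := hp
    exact ⟨⟨c, _, hc⟩, by rw [e]; exact hc, .inr ⟨i, ht rfl, ⟨c, _, hc⟩, hc, rfl⟩⟩
  | const a =>
    obtain ⟨k, hk, m, -, hm, rfl⟩ := hp
    have h1 := (hw k).2 m hm
    rw [hk] at h1
    have h2 := rankAt_rank.2 h1
    exact ⟨⟨_, _, h2⟩, h2, .inl ⟨⟨_, _, h2⟩, rfl⟩⟩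

theorem sameVal_iff_rank {s : Srt} {p p' : ℕ} {c c' : ℚ} (h : RankAt w s p c)
    (h' : RankAt w s p' c') : SameVal w s p p' ↔ c = c' := by
  constructor
  · rintro ⟨a, h1, h2⟩
    exact (h.unique (rankAt_rank.2 ⟨h.1, h1⟩)).trans (h'.unique (rankAt_rank.2 ⟨h'.1, h2⟩)).symm
  · rintro rfl
    exact ⟨_, h.2, h'.2⟩

theorem ltVal_iff_rank {p p' : ℕ} {c c' : ℚ} (h : RankAt w .rat p c) (h' : RankAt w .rat p' c') :
    LtVal w p p' ↔ c < c' := by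
  constructor
  · rintro ⟨a, b, h1, h2, h3⟩
    have e1 : c = a := h.2.unique h1
    have e2 : c' = b := h'.2.unique h2
    rwa [e1, e2]
  · intro hlt
    exact ⟨c, c', h.2, h'.2, hlt⟩

/-- `Agree.cmp` transfers comparisons between values and places, and places are equal when both the
constant of the word and the offset agree. Offsets belong to the translation and not to the model,
so their comparison is a constant truth value. -/
theorem term_eq_iff (hw : Marked val w) (h : Agree w W o q v) {s : Srt} {t u : Term s}
    (ht : t.vars ⊆ W) (hu : u.vars ⊆ W) {p p' : ℕ} (hp : TermPos val w q t p)
    (hp' : TermPos val w q u p') :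
    t.eval v = u.eval v ↔ SameVal w s p p' ∧ t.offset o = u.offset o := by
  obtain ⟨c, h1, h2⟩ := exists_entry hw h ht hp
  obtain ⟨c', h1', h2'⟩ := exists_entry hw h hu hp'
  have := eq_iff_eq_of_cmp_eq_cmp (h.cmp s _ h2 _ h2')
  rw [← (rank s).injective.eq_iff, ← this, sameVal_iff_rank h1 h1']
  simp [Subtype.ext_iff]

theorem term_lt_iff (hw : Marked val w) (h : Agree w W o q v) {t u : Term .rat}
    (ht : t.vars ⊆ W) (hu : u.vars ⊆ W) {p p' : ℕ} (hp : TermPos val w q t p)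
    (hp' : TermPos val w q u p') :
    (show ℚ from t.eval v) < (show ℚ from u.eval v) ↔
      LtVal w p p' ∨ SameVal w .rat p p' ∧ t.offset o < u.offset o := by
  obtain ⟨c, h1, h2⟩ := exists_entry hw h ht hp
  obtain ⟨c', h1', h2'⟩ := exists_entry hw h hu hp'
  have := lt_iff_lt_of_cmp_eq_cmp (h.cmp .rat _ h2 _ h2')
  rw [sameVal_iff_rank h1 h1', ltVal_iff_rank h1 h1']
  refine this.symm.trans ?_
  rw [Prod.Lex.toLex_lt_toLex, Subtype.ext_iff]
  rfl

end

/-! ### Translation of formulas -/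

section
variable {S : Schema} {Cst : Type}

/-- Sets of facts whose arguments are given by positions. -/
abbrev PosInst (S : Schema) : Type := (R : S.Rel) → (Fin (S.arity R) → ℕ) → Prop

/-- The positions `q` hold the arguments `a` of a fact over `R`. -/
def ArgsAt (w : List (Ltr S Cst)) (R : S.Rel) (q : Fin (S.arity R) → ℕ)
    (a : (i : Fin (S.arity R)) → Dom (S.sort R i)) : Prop :=
  ∀ i, q i < w.length ∧ Den w (S.sort R i) (q i) (a i)

/-- All constants of `J` occur in the word. -/
def Over (w : List (Ltr S Cst)) (J : Instance S) : Prop :=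
  ∀ f ∈ J, ∀ i, ∃ p < w.length, Den w (S.sort f.rel i) p (f.args i)

/-- `Jp` represents the instance `J`. -/
structure Represents (w : List (Ltr S Cst)) (Jp : PosInst S) (J : Instance S) : Prop where
  iff : ∀ R q a, ArgsAt w R q a → (Jp R q ↔ (⟨R, a⟩ : Fact S) ∈ J)
  occurs : Over w J

/-- Definable families of instances. -/
def DfnInst (C : IMdl S Cst → Prop) (Jp : IMdl S Cst → PosInst S) : Prop :=
  ∀ (d : ℕ) (R : S.Rel) (f : Fin (S.arity R) → Fin d), Dfn C fun M ρ => Jp M R fun i => ρ (f i)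

/-- The constants of a built-in atom. -/
def BuiltIn.consts : BuiltIn → Set (Σ s, Dom s)
  | .eq t u => t.consts ∪ u.consts
  | .lt t u => t.consts ∪ u.consts
  | .le t u => t.consts ∪ u.consts

/-- The constants of a formula. -/
def Formula.consts : Formula S → Set (Σ s, Dom s)
  | .rel _ ts => ⋃ i, (ts i).consts
  | .builtIn b => b.consts
  | .not φ => φ.consts
  | .and φ ψ => φ.consts ∪ ψ.consts
  | .or φ ψ => φ.consts ∪ ψ.consts
  | .all _ φ => φ.consts
  | .ex _ φ => φ.consts

theorem Term.finite_consts {s : Srt} (t : Term s) : t.consts.Finite := by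
  cases t with
  | var i => exact Set.finite_empty
  | const a => exact Set.finite_singleton _

theorem Term.finite_vars {s : Srt} (t : Term s) : t.vars.Finite := by
  cases t with
  | var i => exact Set.finite_singleton _
  | const a => exact Set.finite_empty

theorem BuiltIn.finite_consts (b : BuiltIn) : b.consts.Finite := by
  cases b <;> exact (Term.finite_consts _).union (Term.finite_consts _)

theorem BuiltIn.finite_vars (b : BuiltIn) : b.vars.Finite := by
  cases b <;> exact (Term.finite_vars _).union (Term.finite_vars _)

theorem Formula.finite_consts (φ : Formula S) : φ.consts.Finite := by
  induction φ with
  | rel R ts => exact Set.finite_iUnion fun i => (ts i).finite_consts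
  | builtIn b => exact b.finite_consts
  | not φ ih => exact ih
  | and φ ψ ih ih' => exact ih.union ih'
  | or φ ψ ih ih' => exact ih.union ih'
  | all x φ ih => exact ih
  | ex x φ ih => exact ih

theorem Formula.finite_freeVars (φ : Formula S) : φ.freeVars.Finite := by
  induction φ with
  | rel R ts => exact Set.finite_iUnion fun i => (ts i).finite_vars
  | builtIn b => exact b.finite_vars
  | not φ ih => exact ih
  | and φ ψ ih ih' => exact ih.union ih'
  | or φ ψ ih ih' => exact ih.union ih'
  | all x φ ih => exact ih.sdiff
  | ex x φ ih => exact ih.sdiff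

/-- The models in which formulas are translated. -/
structure Ctx (val : Cst → Σ s, Dom s) (β : Bool) (M : IMdl S Cst) : Prop where
  aux : M.AuxOK β
  marked : Marked val M.w
  nonempty : ∀ s, (Ranks M.w s).Nonempty

variable {val : Cst → Σ s, Dom s} {β : Bool} {C : IMdl S Cst → Prop}

theorem Dfn.termPos {d : ℕ} [Finite Cst] (V : Var → Fin d) {s : Srt} (t : Term s) (p : Fin d) :
    Dfn C fun M ρ => TermPos val M.w (fun x => ρ (V x)) t (ρ p) := by
  cases t with
  | var i => exact .eq _ _
  | const a =>
    exact .exists_finite fun k => .and (.const _) (.ex (.and (.letter _ _) (.succ _ _)))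

variable {Jp : IMdl S Cst → PosInst S}

/-- `φ` is definable, with variables given by offsets and positions. -/
def Transl (val : Cst → Σ s, Dom s) (C : IMdl S Cst → Prop) (Jp : IMdl S Cst → PosInst S)
    (φ : Formula S) : Prop :=
  φ.consts ⊆ Set.range val → ∀ (W : Set Var), W.Finite → φ.freeVars ⊆ W →
    ∀ (d : ℕ) (o : Var → ℚ) (V : Var → Fin d), ∃ P : IMdl S Cst → (Fin d → ℕ) → Prop, Dfn C P ∧
      ∀ M, C M → ∀ ρ : Fin d → ℕ, (∀ i, ρ i < M.w.length) → ∀ v J,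
        Agree M.w W o (fun x => ρ (V x)) v → Represents M.w (Jp M) J → (P M ρ ↔ φ.Sat J v)

namespace Transl

theorem congr {φ ψ : Formula S} (h : Transl val C Jp φ) (hc : φ.consts ⊆ ψ.consts)
    (hv : φ.freeVars ⊆ ψ.freeVars) (hs : ∀ J v, φ.Sat J v ↔ ψ.Sat J v) : Transl val C Jp ψ := by
  intro h1 W hW h2 d o V
  obtain ⟨P, hP, hP'⟩ := h (hc.trans h1) W hW (hv.trans h2) d o V
  exact ⟨P, hP, fun M hM ρ hρ v J ha hJ => (hP' M hM ρ hρ v J ha hJ).trans (hs J v)⟩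

theorem not {φ : Formula S} (h : Transl val C Jp φ) : Transl val C Jp (.not φ) := by
  intro h1 W hW h2 d o V
  obtain ⟨P, hP, hP'⟩ := h h1 W hW h2 d o V
  exact ⟨_, hP.not, fun M hM ρ hρ v J ha hJ => not_congr (hP' M hM ρ hρ v J ha hJ)⟩

theorem and {φ ψ : Formula S} (h : Transl val C Jp φ) (h' : Transl val C Jp ψ) :
    Transl val C Jp (.and φ ψ) := by
  intro h1 W hW h2 d o V
  obtain ⟨P, hP, hP'⟩ := h (Set.subset_union_left.trans h1) W hW (Set.subset_union_left.trans h2)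
    d o V
  obtain ⟨Q, hQ, hQ'⟩ := h' (Set.subset_union_right.trans h1) W hW
    (Set.subset_union_right.trans h2) d o V
  exact ⟨_, hP.and hQ, fun M hM ρ hρ v J ha hJ => and_congr (hP' M hM ρ hρ v J ha hJ)
    (hQ' M hM ρ hρ v J ha hJ)⟩

/-- A quantifier over a whole domain becomes a finite conjunction over offsets `r ∈ T`, each
followed by a quantifier over the positions holding a constant. The set `T` depends on the offsets
in use and not on the model, so that this is a single formula. `Agree.exists_place` shows that it
covers all values, `Agree.exists_value` that it demands nothing superfluous. -/
theorem all (hC : ∀ M, C M → Ctx val β M) {φ : Formula S} (h : Transl val C Jp φ) (x : Var) :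
    Transl val C Jp (.all x φ) := by
  intro h1 W hW h2 d o V
  obtain ⟨s, i⟩ := x
  obtain ⟨T, hT⟩ := finite_cmp_types (insert 0 (o '' W)) ((hW.image o).insert 0)
  have h2' : φ.freeVars ⊆ insert ⟨s, i⟩ W := by
    intro y hy
    by_cases hyx : y = ⟨s, i⟩
    · exact .inl hyx
    · exact .inr (h2 ⟨hy, hyx⟩)
  choose P hP hP' using fun r => h h1 (insert ⟨s, i⟩ W) (hW.insert _) h2' (d + 1)
    (Function.update o ⟨s, i⟩ r) (Function.update (fun y => (V y).castSucc) ⟨s, i⟩ (Fin.last d))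
  have hupd : ∀ (ρ : Fin d → ℕ) (p : ℕ), (fun y => (Fin.snoc (α := fun _ => ℕ) ρ p : Fin (d + 1) → ℕ)
      (Function.update (fun y => (V y).castSucc) ⟨s, i⟩ (Fin.last d) y)) =
      Function.update (fun y => ρ (V y)) ⟨s, i⟩ p := by
    intro ρ p
    funext y
    by_cases hyx : y = ⟨s, i⟩
    · subst hyx
      simp
    · simp [Function.update_of_ne hyx]
  have hsn : ∀ (M : IMdl S Cst) (ρ : Fin d → ℕ), (∀ i, ρ i < M.w.length) → ∀ p < M.w.length,
      ∀ i, (Fin.snoc (α := fun _ => ℕ) ρ p : Fin (d + 1) → ℕ) i < M.w.length := by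
    intro M ρ hρ p hp i
    refine Fin.lastCases ?_ (fun j => ?_) i
    · simpa using hp
    · simpa using hρ j
  refine ⟨fun M ρ => ∀ r ∈ T.toList, ∀ p < M.w.length, Good M.w s p →
    P r M (Fin.snoc (α := fun _ => ℕ) ρ p), ?_, ?_⟩
  · refine Dfn.list_all _ fun r _ => .all (P := fun M ρ p => Good M.w s p →
      P r M (Fin.snoc (α := fun _ => ℕ) ρ p)) (.imp (.good (fun M hM => (hC M hM).aux) _ _)
      ((hP r).congr fun M _ ρ _ => ?_))
    rw [show (fun i : Fin d => ρ i.castSucc) = Fin.init ρ from rfl, Fin.snoc_init_self]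
  · intro M hM ρ hρ v J ha hJ
    constructor
    · intro hall a
      obtain ⟨r, hr, p, c, hp, ha'⟩ := ha.exists_place hW i a ((hC M hM).nonempty s) hT
      refine (hP' r M hM (Fin.snoc (α := fun _ => ℕ) ρ p) (hsn M ρ hρ p hp.1) _ J ?_ hJ).1
        (hall r (by simpa using hr) p hp.1 ⟨_, hp.2⟩)
      rwa [hupd]
    · rintro hall r - p hp ⟨b, hb⟩
      obtain ⟨a, ha'⟩ := ha.exists_value hW i (rankAt_rank.2 ⟨hp, hb⟩) r
      refine (hP' r M hM (Fin.snoc (α := fun _ => ℕ) ρ p) (hsn M ρ hρ p hp) _ J ?_ hJ).2 (hall a)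
      rwa [hupd]

theorem builtIn [Finite Cst] (hC : ∀ M, C M → Ctx val β M) (b : BuiltIn) :
    Transl val C Jp (.builtIn b) := by
  have hA : ∀ M, C M → M.AuxOK β := fun M hM => (hC M hM).aux
  -- Positions for the two terms are introduced by existential quantifiers. They exist by
  -- `exists_termPos`, and by the assumption on `B` it does not matter which ones are chosen.
  have key : ∀ (W : Set Var) {s : Srt} (t u : Term s), t.consts ∪ u.consts ⊆ Set.range val →
      t.vars ∪ u.vars ⊆ W → ∀ (d : ℕ) (o : Var → ℚ) (V : Var → Fin d)
      (B : IMdl S Cst → ℕ → ℕ → Prop), Dfn C (d := d + 1 + 1) (fun M ρ =>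
        B M (ρ (Fin.last d).castSucc) (ρ (Fin.last (d + 1)))) → ∀ (A : Valuation → Prop),
      (∀ M, C M → ∀ q v, Agree M.w W o q v → ∀ p p', TermPos val M.w q t p →
        TermPos val M.w q u p' → (A v ↔ B M p p')) →
      ∃ P : IMdl S Cst → (Fin d → ℕ) → Prop, Dfn C P ∧
      ∀ M, C M → ∀ ρ : Fin d → ℕ, (∀ i, ρ i < M.w.length) → ∀ v,
        Agree M.w W o (fun x => ρ (V x)) v → (P M ρ ↔ A v) := by
    intro W s t u h1 h2 d o V B hB A hA
    refine ⟨fun M ρ => ∃ p < M.w.length, TermPos val M.w (fun x => ρ (V x)) t p ∧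
      ∃ p' < M.w.length, TermPos val M.w (fun x => ρ (V x)) u p' ∧ B M p p',
      .ex (.and (.termPos (fun x => (V x).castSucc) _ _) (.ex (.and
        (.termPos (fun x => (V x).castSucc.castSucc) _ _) hB))), fun M hM ρ hρ v ha => ?_⟩
    constructor
    · rintro ⟨p, -, hp, p', -, hp', hb⟩
      exact (hA M hM _ v ha p p' hp hp').2 hb
    · intro hv
      obtain ⟨p, hpl, hp⟩ := exists_termPos (hC M hM).marked ha (Set.subset_union_left.trans h2)
        (Set.subset_union_left.trans h1)
      obtain ⟨p', hpl', hp'⟩ := exists_termPos (hC M hM).marked ha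
        (Set.subset_union_right.trans h2) (Set.subset_union_right.trans h1)
      exact ⟨p, hpl, hp, p', hpl', hp', (hA M hM _ v ha p p' hp hp').1 hv⟩
  intro h1 W hW h2 d o V
  cases b with
  | eq t u =>
    obtain ⟨P, hP, hP'⟩ := key W t u h1 h2 d o V
      (fun M p p' => SameVal M.w _ p p' ∧ t.offset o = u.offset o)
      (.and (.sameVal hA _ _ _) (.const _)) (fun v => t.eval v = u.eval v)
      fun M hM q v ha p p' hp hp' => term_eq_iff (hC M hM).marked ha
        (Set.subset_union_left.trans h2) (Set.subset_union_right.trans h2) hp hp'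
    exact ⟨P, hP, fun M hM ρ hρ v J ha _ => hP' M hM ρ hρ v ha⟩
  | lt t u =>
    obtain ⟨P, hP, hP'⟩ := key W t u h1 h2 d o V
      (fun M p p' => LtVal M.w p p' ∨ SameVal M.w .rat p p' ∧ t.offset o < u.offset o)
      (.or (.ltVal hA _ _) (.and (.sameVal hA _ _ _) (.const _)))
      (fun v => (show ℚ from t.eval v) < (show ℚ from u.eval v))
      fun M hM q v ha p p' hp hp' => term_lt_iff (hC M hM).marked ha
        (Set.subset_union_left.trans h2) (Set.subset_union_right.trans h2) hp hp'
    exact ⟨P, hP, fun M hM ρ hρ v J ha _ => hP' M hM ρ hρ v ha⟩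
  | le t u =>
    obtain ⟨P, hP, hP'⟩ := key W t u h1 h2 d o V
      (fun M p p' => ¬ (LtVal M.w p' p ∨ SameVal M.w .rat p' p ∧ u.offset o < t.offset o))
      (.not (.or (.ltVal hA _ _) (.and (.sameVal hA _ _ _) (.const _))))
      (fun v => (show ℚ from t.eval v) ≤ (show ℚ from u.eval v))
      fun M hM q v ha p p' hp hp' => by
        rw [← term_lt_iff (hC M hM).marked ha (Set.subset_union_right.trans h2)
          (Set.subset_union_left.trans h2) hp' hp]
        exact not_lt.symm
    exact ⟨P, hP, fun M hM ρ hρ v J ha _ => hP' M hM ρ hρ v ha⟩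

/-- Arguments of facts in `J` occur in the word, and a value equal to an occurring constant has
offset `0`. So an atom is false as soon as one argument has another offset; otherwise the positions
of its arguments decide. -/
theorem rel [Finite Cst] (hC : ∀ M, C M → Ctx val β M) (hJp : DfnInst C Jp) (R : S.Rel)
    (ts : (i : Fin (S.arity R)) → Term (S.sort R i)) : Transl val C Jp (.rel R ts) := by
  intro h1 W hW h2 d o V
  have h1 : ∀ i, (ts i).consts ⊆ Set.range val := fun i => (Set.subset_iUnion _ i).trans h1
  have h2 : ∀ i, (ts i).vars ⊆ W := fun i =>
    (Set.subset_iUnion (fun i => (ts i).vars) i).trans h2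
  refine ⟨fun M ρ => ∃ q : Fin (S.arity R) → ℕ, (∀ i, q i < M.w.length) ∧
    (∀ i, TermPos val M.w (fun x => ρ (V x)) (ts i) (q i)) ∧ (∀ i, (ts i).offset o = 0) ∧ Jp M R q,
    .exTuple (.and (.forall_finite fun i => .termPos (fun x => (V x).castAdd _) _ _)
      (.and (.const _) (hJp _ _ _))), fun M hM ρ hρ v J ha hJ => ?_⟩
  have hm := (hC M hM).marked
  have hargs : ∀ q : Fin (S.arity R) → ℕ,
      (∀ i, TermPos val M.w (fun x => ρ (V x)) (ts i) (q i)) → (∀ i, (ts i).offset o = 0) →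
      ArgsAt M.w R q fun i => (ts i).eval v := by
    intro q hq h0 i
    obtain ⟨c, hc, he⟩ := exists_entry hm ha (h2 i) (hq i)
    rw [h0 i] at he
    have := (eq_iff_eq_of_cmp_eq_cmp (ha.cmp _ _ he _ (.inl ⟨c, rfl⟩))).1 rfl
    rw [← rankAt_rank]
    rwa [← show rank _ ((ts i).eval v) = c.1 from this] at hc
  constructor
  · rintro ⟨q, -, hq, h0, hJq⟩
    exact (hJ.iff R q _ (hargs q hq h0)).1 hJq
  · intro hmem
    choose q hql hq using fun i => exists_termPos hm ha (h2 i) (h1 i)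
    have h0 : ∀ i, (ts i).offset o = 0 := by
      intro i
      obtain ⟨c, hc, he⟩ := exists_entry hm ha (h2 i) (hq i)
      obtain ⟨p, hp, hden⟩ := hJ.occurs _ hmem i
      have hr := rankAt_rank.2 ⟨hp, hden⟩
      have := (eq_iff_eq_of_cmp_eq_cmp (ha.cmp _ _ he _ (.inl ⟨⟨_, _, hr⟩, rfl⟩))).2 rfl
      exact congrArg (fun k => (ofLex k).2) this
    exact ⟨q, hql, hq, h0, (hJ.iff R q _ (hargs q hq h0)).2 hmem⟩

end Transl

theorem transl [Finite Cst] (hC : ∀ M, C M → Ctx val β M) (hJp : DfnInst C Jp) (φ : Formula S) :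
    Transl val C Jp φ := by
  induction φ with
  | rel R ts => exact .rel hC hJp R ts
  | builtIn b => exact .builtIn hC b
  | not φ ih => exact ih.not
  | and φ ψ ih ih' => exact ih.and ih'
  | or φ ψ ih ih' =>
    refine (ih.not.and ih'.not).not.congr subset_rfl subset_rfl fun J v => ?_
    simp only [Formula.Sat]
    tauto
  | all x φ ih => exact ih.all hC x
  | ex x φ ih =>
    refine (ih.not.all hC x).not.congr subset_rfl subset_rfl fun J v => ?_
    simp only [Formula.Sat]
    push Not
    rfl

theorem Ctx.length_pos {M : IMdl S Cst} (h : Ctx val β M) : 0 < M.w.length := by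
  obtain ⟨c, p, hp, -⟩ := h.nonempty .rat
  omega

/-- Truth of a closed formula in a definable instance is definable. -/
theorem Dfn.holds_of_closed [Finite Cst] {d : ℕ} (hC : ∀ M, C M → Ctx val β M)
    (hJp : DfnInst C Jp) {φ : Formula S} (hφ : φ.IsClosed) (hφ' : φ.consts ⊆ Set.range val) :
    ∃ P : IMdl S Cst → Prop, Dfn C (d := d) (fun M _ => P M) ∧
      ∀ M, C M → ∀ J, Represents M.w (Jp M) J → (P M ↔ Holds J φ) := by
  -- A map from variables to `Fin d` needs a target, hence one dummy position. With `W = ∅` every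
  -- valuation agrees with it.
  obtain ⟨P, hP, hP'⟩ := transl hC hJp φ hφ' ∅ Set.finite_empty (subset_of_eq hφ) 1 (fun _ => 0)
    fun _ => 0
  refine ⟨fun M => ∀ a < M.w.length, P M fun _ => a, .all (P := fun M _ a => P M fun _ => a)
    (hP.subst fun _ => Fin.last d), fun M hM J hJ => ⟨fun h v => ?_, fun h a ha => ?_⟩⟩
  · exact (hP' M hM (fun _ => 0) (fun _ => (hC M hM).length_pos) v J (agree_empty _ _ _) hJ).1
      (h 0 (hC M hM).length_pos)
  · exact (hP' M hM (fun _ => a) (fun _ => ha) (fun x => (rank x.sort).symm 0) J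
      (agree_empty _ _ _) hJ).2 (h _)

/-- `Holds` already quantifies over all valuations, so prefixing a universal quantifier changes
nothing. -/
theorem holds_all_iff (J : Instance S) (x : Var) (φ : Formula S) :
    Holds J (.all x φ) ↔ Holds J φ := by
  refine ⟨fun h v => ?_, fun h v a => h _⟩
  have := h v (v x)
  rwa [Function.update_eq_self] at this

/-- The universal closure of a formula. -/
theorem exists_closure (φ : Formula S) : ∃ ψ : Formula S, ψ.IsClosed ∧ ψ.consts = φ.consts ∧
    ∀ J, Holds J ψ ↔ Holds J φ := by
  suffices h : ∀ l : List Var, ∃ ψ : Formula S, ψ.freeVars = φ.freeVars \ {x | x ∈ l} ∧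
      ψ.consts = φ.consts ∧ ∀ J, Holds J ψ ↔ Holds J φ by
    obtain ⟨ψ, h1, h2⟩ := h φ.finite_freeVars.toFinset.toList
    exact ⟨ψ, by rw [Formula.IsClosed, h1]; simp, h2⟩
  intro l
  induction l with
  | nil => exact ⟨φ, by simp, rfl, fun _ => Iff.rfl⟩
  | cons x l ih =>
    obtain ⟨ψ, h1, h2, h3⟩ := ih
    refine ⟨.all x ψ, ?_, h2, fun J => (holds_all_iff J x ψ).trans (h3 J)⟩
    rw [Formula.freeVars, h1]
    ext y
    simp only [List.mem_cons, Set.mem_sdiff, Set.mem_singleton_iff, Set.mem_ofPred_eq]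
    tauto

theorem Dfn.holds [Finite Cst] {d : ℕ} (hC : ∀ M, C M → Ctx val β M)
    (hJp : DfnInst C Jp) {φ : Formula S} (hφ : φ.consts ⊆ Set.range val) :
    ∃ P : IMdl S Cst → Prop, Dfn C (d := d) (fun M _ => P M) ∧
      ∀ M, C M → ∀ J, Represents M.w (Jp M) J → (P M ↔ Holds J φ) := by
  obtain ⟨ψ, h1, h2, h3⟩ := exists_closure φ
  obtain ⟨P, hP, hP'⟩ := Dfn.holds_of_closed (d := d) hC hJp h1 (h2.trans_subset hφ)
  exact ⟨P, hP, fun M hM J hJ => (hP' M hM J hJ).trans (h3 J)⟩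

/-! ### Constraints as formulas -/

def Formula.tt (S : Schema) : Formula S :=
  .builtIn (.eq (s := .rat) (.const (0 : ℚ)) (.const (0 : ℚ)))

def VarAtom.toFormula (A : VarAtom S) : Formula S := .rel A.rel fun i => .var (A.idx i)

def Cond.toFormula (S : Schema) : Cond → Formula S
  | .tt => .tt S
  | .atom b => .builtIn b
  | .not φ => .not (φ.toFormula S)
  | .and φ ψ => .and (φ.toFormula S) (ψ.toFormula S)
  | .or φ ψ => .or (φ.toFormula S) (ψ.toFormula S)

def Formula.conj (l : List (Formula S)) : Formula S := l.foldr .and (.tt S)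

/-- A universal constraint as a formula. -/
def UniversalConstraint.toFormula (c : UniversalConstraint S) : Formula S :=
  .not (.and (.conj (c.pos.map VarAtom.toFormula)) (.and
    (.conj (c.neg.map fun A => .not A.toFormula)) (c.cond.toFormula S)))

theorem Formula.sat_conj (J : Instance S) (v : Valuation) (l : List (Formula S)) :
    (Formula.conj l).Sat J v ↔ ∀ φ ∈ l, φ.Sat J v := by
  induction l with
  | nil => simp [Formula.conj, Formula.tt, Formula.Sat, BuiltIn.Sat]
  | cons φ l ih =>
    rw [List.forall_mem_cons, ← ih]
    rfl

theorem Cond.sat_toFormula (J : Instance S) (v : Valuation) (c : Cond) :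
    (c.toFormula S).Sat J v ↔ c.Sat v := by
  induction c with
  | tt => simp [Cond.toFormula, Formula.tt, Formula.Sat, BuiltIn.Sat, Cond.Sat]
  | atom b => rfl
  | not φ ih => exact not_congr ih
  | and φ ψ ih ih' => exact and_congr ih ih'
  | or φ ψ ih ih' => exact or_congr ih ih'

theorem UniversalConstraint.holds_toFormula (c : UniversalConstraint S) (J : Instance S) :
    CQA.Holds J c.toFormula ↔ c.Holds J := by
  refine forall_congr' fun v => not_congr ?_
  simp only [Formula.Sat, Formula.sat_conj, Cond.sat_toFormula, List.forall_mem_map]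
  rfl

end

/-! ### Reading instances off a word -/

section
variable {S : Schema} {Cst : Type}

/-- What parsing needs: the end marker occurs only at the end and thus delimits constants, a
relation symbol can only begin a fact, and a separator never belongs to a fact. -/
theorem encodeConst_eq (S : Schema) (s : Srt) (a : Dom s) : ∃ u : List (Sym S),
    encodeConst S s a = u ++ [Sym.endMark] ∧ Sym.endMark ∉ u ∧ Sym.sep ∉ u ∧ ∀ R, Sym.rel R ∉ u := by
  cases s with
  | rat =>
    change ℚ at a
    refine ⟨(if a < 0 then [Sym.minus] else []) ++ encodeBits S a.num.natAbs.bits ++ [Sym.slash] ++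
        encodeBits S a.den.bits, rfl, ?_⟩
    split_ifs <;> simp [encodeBits]
  | name =>
    change List Bool at a
    exact ⟨encodeBits S a, rfl, by simp [encodeBits], by simp [encodeBits], by simp [encodeBits]⟩

theorem mem_encodeConst {s : Srt} {a : Dom s} : Sym.sep ∉ encodeConst S s a ∧
    ∀ R, Sym.rel R ∉ encodeConst S s a := by
  obtain ⟨u, h1, h2, h3, h4⟩ := encodeConst_eq S s a
  rw [h1]
  simp [h3, h4]

theorem encodeFacts_cons (f : Fact S) (l : List (Fact S)) :
    encodeFacts (f :: l) = encodeFact f ++ encodeFacts l := rfl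

theorem encodeFacts_append (l l' : List (Fact S)) :
    encodeFacts (l ++ l') = encodeFacts l ++ encodeFacts l' := by simp [encodeFacts]

theorem sep_notMem_encodeFacts (l : List (Fact S)) : Sym.sep ∉ encodeFacts l := by
  simp only [encodeFacts, encodeFact, List.mem_flatten, List.mem_map, not_exists, not_and,
    forall_exists_index, and_imp]
  rintro _ f - rfl h
  simp only [List.mem_cons, reduceCtorEq, List.mem_flatten, List.mem_ofFn, false_or] at h
  obtain ⟨_, ⟨i, rfl⟩, h⟩ := h
  exact mem_encodeConst.1 h

theorem encodeFacts_drop {l : List (Fact S)} {p : ℕ} {R : S.Rel}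
    (h : (encodeFacts l)[p]? = some (.rel R)) :
    ∃ f ∈ l, ∃ r, (encodeFacts l).drop p = encodeFact f ++ r := by
  induction l generalizing p with
  | nil => simp [encodeFacts] at h
  | cons f l ih =>
    rw [encodeFacts_cons] at h ⊢
    by_cases hp : p < (encodeFact f).length
    · rw [List.getElem?_append_left hp] at h
      cases p with
      | zero => exact ⟨f, by simp, _, rfl⟩
      | succ p =>
        rw [encodeFact, List.getElem?_cons_succ] at h
        obtain ⟨_, h1, h2⟩ := List.mem_flatten.1 (List.mem_of_getElem? h)
        obtain ⟨i, rfl⟩ := (List.mem_ofFn).1 h1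
        exact (mem_encodeConst.2 _ h2).elim
    · rw [List.getElem?_append_right (by omega)] at h
      obtain ⟨g, hg, r, hr⟩ := ih h
      refine ⟨g, by simp [hg], r, ?_⟩
      rw [List.drop_append, List.drop_eq_nil_of_le (by omega), List.nil_append, hr]

/-- The end of the constant at the position `y`. -/
def Nxt (w : List (Ltr S Cst)) (y z : ℕ) : Prop :=
  ∃ e < w.length, y ≤ e ∧ w[e]? = some (.inl .endMark) ∧
    (∀ r < w.length, y ≤ r → r < e → ¬ w[r]? = some (.inl .endMark)) ∧ z = e + 1

/-- The position of the `i`-th argument of the fact at the position `p`. -/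
def ArgPos (w : List (Ltr S Cst)) (p : ℕ) : ℕ → ℕ → Prop
  | 0, x => x = p + 1
  | i + 1, x => ∃ y < w.length, ArgPos w p i y ∧ Nxt w y x

/-- The fact at the position `p` is over `R` and has the arguments at the positions `q`. -/
def FactAt (w : List (Ltr S Cst)) (R : S.Rel) (p : ℕ) (q : Fin (S.arity R) → ℕ) : Prop :=
  w[p]? = some (.inl (.rel R)) ∧
    ∀ i : Fin (S.arity R), ∃ x < w.length, ArgPos w p i x ∧ SameVal w (S.sort R i) x (q i)

/-- The facts listed after (`b = true`) or before (`b = false`) the first separator. -/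
def wordInst (b : Bool) (w : List (Ltr S Cst)) : PosInst S := fun R q =>
  ∃ p < w.length, ((∃ r < w.length, r < p ∧ w[r]? = some (.inl .sep)) ↔ b = true) ∧ FactAt w R p q

variable {w : List (Ltr S Cst)}

theorem Nxt.unique {y z z' : ℕ} (h : Nxt w y z) (h' : Nxt w y z') : z = z' := by
  obtain ⟨e, h1, h2, h3, h4, rfl⟩ := h
  obtain ⟨e', h1', h2', h3', h4', rfl⟩ := h'
  rcases lt_trichotomy e e' with h | rfl | h
  · exact (h4' e h1 h2 h h3).elim
  · rfl
  · exact (h4 e' h1' h2' h h3').elim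

theorem ArgPos.unique {p i x x' : ℕ} (h : ArgPos w p i x) (h' : ArgPos w p i x') : x = x' := by
  induction i generalizing x x' with
  | zero => exact Eq.trans h (Eq.symm h')
  | succ i ih =>
    obtain ⟨y, -, h1, h2⟩ := h
    obtain ⟨y', -, h1', h2'⟩ := h'
    obtain rfl := ih h1 h1'
    exact h2.unique h2'

theorem nxt_of_encodeConst {s : Srt} {a : Dom s} {y : ℕ} {r : List (Ltr S Cst)}
    (h : w.drop y = (encodeConst S s a).map .inl ++ r) :
    Nxt w y (y + (encodeConst S s a).length) := by
  obtain ⟨u, h1, h2, -, -⟩ := encodeConst_eq S s a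
  rw [h1, List.map_append, List.append_assoc] at h
  have hw : ∀ i, w[y + i]? = (u.map .inl ++ ([Sym.endMark].map .inl ++ r))[i]? :=
    fun i => by rw [← h, List.getElem?_drop]
  have he : w[y + u.length]? = some (.inl .endMark) := by
    rw [hw, List.getElem?_append_right (by simp)]
    simp
  refine ⟨y + u.length, (List.getElem?_eq_some_iff.1 he).1, by omega, he, ?_, ?_⟩
  · intro k _ h3 h4 h5
    obtain ⟨i, rfl⟩ := Nat.exists_eq_add_of_le h3
    rw [hw, List.getElem?_append_left (by simp; omega)] at h5
    have := List.mem_of_getElem? h5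
    simp [h2] at this
  · rw [h1]
    simp
    omega

theorem argPos_of_drop {f : Fact S} {p : ℕ} {r : List (Ltr S Cst)}
    (h : w.drop p = (encodeFact f).map .inl ++ r) (i : Fin (S.arity f.rel)) :
    ∃ x < w.length, ArgPos w p i x ∧ Den w (S.sort f.rel i) x (f.args i) := by
  set g : Fin (S.arity f.rel) → List (Sym S) :=
    fun i => encodeConst S (S.sort f.rel i) (f.args i) with hg
  have hlt : ∀ {x : ℕ} {i : Fin (S.arity f.rel)} {t : List (Ltr S Cst)},
      w.drop x = (g i).map .inl ++ t → x < w.length := by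
    intro x i t h
    by_contra hx
    rw [List.drop_eq_nil_of_le (by omega)] at h
    obtain ⟨u, h1, -⟩ := encodeConst_eq S (S.sort f.rel i) (f.args i)
    rw [hg] at h
    simp [h1] at h
  have hcons : ∀ i (hi : i < S.arity f.rel), (((List.ofFn g).drop i).flatten.map .inl ++ r :
      List (Ltr S Cst)) = (g ⟨i, hi⟩).map .inl ++
        (((List.ofFn g).drop (i + 1)).flatten.map .inl ++ r) := by
    intro i hi
    rw [List.drop_eq_getElem_cons (by simpa using hi)]
    simp
  have key : ∀ i ≤ S.arity f.rel, ∃ x, ArgPos w p i x ∧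
      w.drop x = ((List.ofFn g).drop i).flatten.map .inl ++ r := by
    intro i
    induction i with
    | zero =>
      intro _
      refine ⟨p + 1, rfl, ?_⟩
      rw [← List.drop_drop, h]
      simp [encodeFact, hg]
    | succ i ih =>
      intro hi
      obtain ⟨x, h1, h2⟩ := ih (by omega)
      rw [hcons i (by omega)] at h2
      refine ⟨_, ⟨x, hlt h2, h1, nxt_of_encodeConst h2⟩, ?_⟩
      rw [← List.drop_drop, h2, List.drop_append]
      simp [hg]
  obtain ⟨x, h1, h2⟩ := key i i.2.le
  rw [hcons i i.2] at h2
  exact ⟨x, hlt h2, h1, den_of_encodeConst h2⟩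

/-- The argument positions inside an encoded fact are unique and denote its arguments; by uniqueness
of denotation, having the same values as `q` means having the arguments `a`. -/
theorem factAt_iff {f : Fact S} {p : ℕ} {r : List (Ltr S Cst)}
    (h : w.drop p = (encodeFact f).map .inl ++ r) {R : S.Rel} {q : Fin (S.arity R) → ℕ}
    {a : (i : Fin (S.arity R)) → Dom (S.sort R i)} (hq : ArgsAt w R q a) :
    FactAt w R p q ↔ f = ⟨R, a⟩ := by
  have h0 : w[p]? = some (.inl (.rel f.rel)) := by
    have := List.getElem?_drop (xs := w) (i := p) (j := 0)
    rw [h] at this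
    simpa [encodeFact] using this.symm
  constructor
  · rintro ⟨h1, h2⟩
    have e : f.rel = R := by
      rw [h0] at h1
      simpa using h1
    subst e
    have : f.args = a := by
      funext i
      obtain ⟨x, -, hx, c, hc, hc'⟩ := h2 i
      obtain ⟨x', -, hx', hd⟩ := argPos_of_drop h i
      obtain rfl := hx.unique hx'
      rw [hd.unique hc, hc'.unique (hq i).2]
    rw [← this]
  · rintro rfl
    refine ⟨h0, fun i => ?_⟩
    obtain ⟨x, hl, hx, hd⟩ := argPos_of_drop h i
    exact ⟨x, hl, hx, _, hd, (hq i).2⟩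

/-! ### Words listing two instances and the marked constants -/

/-- The list of the marked constants. -/
def markList (val : Cst → Σ s, Dom s) (L : List Cst) : List (Ltr S Cst) :=
  L.flatMap fun k => .inr k :: (encodeConst S (val k).1 (val k).2).map .inl

/-- The word that lists the facts in `l` and `l'` and the marked constants. -/
def instWord (val : Cst → Σ s, Dom s) (L : List Cst) (l l' : List (Fact S)) (j : ℕ) :
    List (Ltr S Cst) :=
  (encodeFacts l).map .inl ++ .inl .sep :: ((encodeFacts l').map .inl ++
    (List.replicate j (.inl .sep) ++ markList val L))

variable {val : Cst → Σ s, Dom s}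

theorem markList_drop {L : List Cst} {p : ℕ} {k : Cst}
    (h : (markList (S := S) val L)[p]? = some (.inr k)) : ∃ r,
      (markList (S := S) val L).drop p =
        .inr k :: ((encodeConst S (val k).1 (val k).2).map .inl ++ r) := by
  induction L generalizing p with
  | nil => simp [markList] at h
  | cons c L ih =>
    have e : markList (S := S) val (c :: L) = (.inr c :: (encodeConst S (val c).1 (val c).2).map .inl)
      ++ markList val L := rfl
    rw [e] at h ⊢
    by_cases hp : p < (Sum.inr c :: (encodeConst S (val c).1 (val c).2).map Sum.inl :
        List (Ltr S Cst)).length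
    · rw [List.getElem?_append_left hp] at h
      cases p with
      | zero =>
        obtain rfl : c = k := by simpa using h
        exact ⟨_, rfl⟩
      | succ p =>
        rw [List.getElem?_cons_succ] at h
        have := List.mem_of_getElem? h
        simp at this
    · rw [List.getElem?_append_right (by omega)] at h
      obtain ⟨r, hr⟩ := ih h
      refine ⟨r, ?_⟩
      rw [List.drop_append, List.drop_eq_nil_of_le (by omega), List.nil_append, hr]

theorem inr_mem_markList {L : List Cst} {k : Cst} (hk : k ∈ L) :
    (.inr k : Ltr S Cst) ∈ markList val L :=
  List.mem_flatMap.2 ⟨k, hk, by simp⟩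

theorem rel_notMem_markList {L : List Cst} {R : S.Rel} :
    (.inl (.rel R) : Ltr S Cst) ∉ markList val L := by
  intro h
  obtain ⟨k, -, h⟩ := List.mem_flatMap.1 h
  simp only [List.mem_cons, reduceCtorEq, List.mem_map, Sum.inl.injEq, exists_eq_right,
    false_or] at h
  exact mem_encodeConst.2 _ h

variable {L : List Cst} {l l' : List (Fact S)} {j : ℕ}

theorem marked_instWord (hL : ∀ k, k ∈ L) : Marked val (instWord val L l l' j) := by
  intro k
  constructor
  · apply List.mem_iff_getElem?.1
    simp [instWord, inr_mem_markList (hL k)]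
  · intro m hm
    have e : instWord val L l l' j = ((encodeFacts l).map .inl ++ .inl .sep ::
        ((encodeFacts l').map .inl ++ List.replicate j (.inl .sep))) ++ markList val L := by
      simp [instWord]
    rw [e] at hm ⊢
    generalize hA : ((encodeFacts l).map .inl ++ .inl .sep ::
        ((encodeFacts l').map .inl ++ List.replicate j (.inl .sep)) : List (Ltr S Cst)) = A at *
    have hmA : A.length ≤ m := by
      by_contra hlt
      rw [List.getElem?_append_left (by omega)] at hm
      have := List.mem_of_getElem? hm
      rw [← hA] at this
      simp at this
    rw [List.getElem?_append_right hmA] at hm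
    obtain ⟨r, hr⟩ := markList_drop hm
    have hd : (A ++ markList val L).drop (m + 1) =
        (encodeConst S (val k).1 (val k).2).map .inl ++ r := by
      rw [← List.drop_drop, List.drop_append, List.drop_eq_nil_of_le hmA, List.nil_append, hr]
      rfl
    refine ⟨?_, den_of_encodeConst hd⟩
    by_contra hlt
    rw [List.drop_eq_nil_of_le (by omega)] at hd
    obtain ⟨u, h1, -⟩ := encodeConst_eq S (val k).1 (val k).2
    simp [h1] at hd

theorem instWord_drop_fst {p : ℕ} (hp : p ≤ (encodeFacts l).length) :
    (instWord val L l l' j).drop p = ((encodeFacts l).drop p).map .inl ++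
      .inl .sep :: ((encodeFacts l').map .inl ++
        (List.replicate j (.inl .sep) ++ markList val L)) := by
  rw [instWord, List.drop_append, List.map_drop, List.length_map, Nat.sub_eq_zero_of_le hp,
    List.drop_zero]

theorem instWord_drop_snd {p : ℕ} (hp : p ≤ (encodeFacts l').length) :
    (instWord val L l l' j).drop ((encodeFacts l).length + 1 + p) =
      ((encodeFacts l').drop p).map .inl ++
        (List.replicate j (.inl .sep) ++ markList val L) := by
  rw [add_assoc, ← List.drop_drop, instWord_drop_fst le_rfl, List.drop_length,
    ← List.drop_drop]
  simp only [List.map_nil, List.nil_append, List.drop_one, List.tail_cons]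
  rw [List.drop_append, List.map_drop, List.length_map, Nat.sub_eq_zero_of_le hp, List.drop_zero]

theorem getElem?_eq_of_drop {α : Type} {w u : List α} {p : ℕ} (h : w.drop p = u) (i : ℕ) :
    w[p + i]? = u[i]? := by rw [← h, List.getElem?_drop]

/-- Encoded facts contain no separator, so the first one stands directly behind the facts of `l`. -/
theorem sep_lt_iff {p : ℕ} (hp : p < (instWord val L l l' j).length) :
    (∃ r < (instWord val L l l' j).length, r < p ∧
      (instWord val L l l' j)[r]? = some (.inl .sep)) ↔ (encodeFacts l).length < p := by
  constructor
  · rintro ⟨r, -, h1, h2⟩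
    by_contra hlt
    rw [instWord, List.getElem?_append_left (by simp; omega)] at h2
    have := List.mem_of_getElem? h2
    simp [sep_notMem_encodeFacts] at this
  · intro h
    refine ⟨(encodeFacts l).length, by omega, h, ?_⟩
    have := getElem?_eq_of_drop (instWord_drop_fst (val := val) (L := L) (l := l) (l' := l') (j := j)
      (p := (encodeFacts l).length) le_rfl) 0
    simpa using this

/-- Every fact in the word is read off, and nothing else. -/
theorem instWord_facts (b : Bool) :
    (∀ p R, ((∃ r < (instWord val L l l' j).length, r < p ∧
      (instWord val L l l' j)[r]? = some (.inl .sep)) ↔ b = true) →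
      (instWord val L l l' j)[p]? = some (.inl (.rel R)) →
      ∃ f ∈ (if b then l' else l), ∃ r,
        (instWord val L l l' j).drop p = (encodeFact f).map .inl ++ r) ∧
    ∀ f ∈ (if b then l' else l), ∃ p < (instWord val L l l' j).length,
      ((∃ r < (instWord val L l l' j).length, r < p ∧
      (instWord val L l l' j)[r]? = some (.inl .sep)) ↔ b = true) ∧
      ∃ r, (instWord val L l l' j).drop p = (encodeFact f).map .inl ++ r := by
  have hlt : ∀ {p : ℕ} {f : Fact S} {r}, (instWord val L l l' j).drop p =
      (encodeFact f).map .inl ++ r → p < (instWord val L l l' j).length := by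
    intro p f r h
    by_contra hlt
    rw [List.drop_eq_nil_of_le (by omega)] at h
    simp [encodeFact] at h
  have hsplit : ∀ {l : List (Fact S)} {f}, f ∈ l → ∃ p ≤ (encodeFacts l).length, ∃ r,
      (encodeFacts l).drop p = encodeFact f ++ r := by
    intro l f hf
    obtain ⟨l₁, l₂, rfl⟩ := List.append_of_mem hf
    refine ⟨(encodeFacts l₁).length, by simp [encodeFacts_append], encodeFacts l₂, ?_⟩
    rw [encodeFacts_append, List.drop_left, encodeFacts_cons]
  constructor
  · intro p R h1 h2
    have hp := (List.getElem?_eq_some_iff.1 h2).1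
    rw [sep_lt_iff hp] at h1
    cases b with
    | false =>
      have hle : p ≤ (encodeFacts l).length := by simpa using h1
      have hd := instWord_drop_fst (val := val) (L := L) (l := l) (l' := l') (j := j) hle
      have h3 : (encodeFacts l)[p]? = some (.rel R) := by
        have := getElem?_eq_of_drop hd 0
        rw [add_zero, h2] at this
        rcases hle.lt_or_eq with hle | hle
        · rw [List.getElem?_append_left (by simp; omega)] at this
          simpa using this.symm
        · rw [hle] at this
          simp at this
      obtain ⟨f, hf, r, hr⟩ := encodeFacts_drop h3
      rw [hr, List.map_append, List.append_assoc] at hd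
      exact ⟨f, hf, _, hd⟩
    | true =>
      have hle : (encodeFacts l).length < p := by simpa using h1
      obtain ⟨i, rfl⟩ := Nat.exists_eq_add_of_le (show (encodeFacts l).length + 1 ≤ p from hle)
      have h0 := getElem?_eq_of_drop (instWord_drop_snd (val := val) (L := L) (l := l) (l' := l')
        (j := j) (p := 0) (by omega)) i
      rw [add_zero, h2, List.drop_zero] at h0
      -- Beyond the facts of `l'` there are only separators and marked constants, without relation
      -- symbols.
      have hi : i < (encodeFacts l').length := by
        by_contra hi
        rw [List.getElem?_append_right (by simp; omega)] at h0
        have := List.mem_of_getElem? h0.symm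
        simp [rel_notMem_markList] at this
      rw [List.getElem?_append_left (by simpa using hi)] at h0
      have h3 : (encodeFacts l')[i]? = some (.rel R) := by simpa using h0.symm
      obtain ⟨f, hf, r, hr⟩ := encodeFacts_drop h3
      have hd := instWord_drop_snd (val := val) (L := L) (l := l) (l' := l') (j := j) hi.le
      rw [hr, List.map_append, List.append_assoc] at hd
      exact ⟨f, hf, _, hd⟩
  · intro f hf
    cases b with
    | false =>
      replace hf : f ∈ l := hf
      obtain ⟨p, hp, r, hr⟩ := hsplit hf
      have hd := instWord_drop_fst (val := val) (L := L) (l := l) (l' := l') (j := j) hp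
      rw [hr, List.map_append, List.append_assoc] at hd
      refine ⟨p, hlt hd, ?_, _, hd⟩
      rw [sep_lt_iff (hlt hd)]
      simpa using hp
    | true =>
      replace hf : f ∈ l' := hf
      obtain ⟨p, hp, r, hr⟩ := hsplit hf
      have hd := instWord_drop_snd (val := val) (L := L) (l := l) (l' := l') (j := j) hp
      rw [hr, List.map_append, List.append_assoc] at hd
      refine ⟨_, hlt hd, ?_, _, hd⟩
      rw [sep_lt_iff (hlt hd)]
      simp
      omega

theorem represents_wordInst (b : Bool) {I : Instance S}
    (hI : ∀ f, f ∈ (if b then l' else l) ↔ f ∈ I) :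
    Represents (instWord val L l l' j) (wordInst b (instWord val L l l' j)) I := by
  obtain ⟨h1, h2⟩ := instWord_facts (val := val) (L := L) (l := l) (l' := l') (j := j) b
  refine ⟨fun R q a hq => ⟨?_, fun hf => ?_⟩, fun f hf i => ?_⟩
  · rintro ⟨p, hp, hs, hfact⟩
    obtain ⟨f, hf, r, hr⟩ := h1 p R hs hfact.1
    rw [← (factAt_iff hr hq).1 hfact]
    exact (hI f).1 hf
  · obtain ⟨p, hp, hs, r, hr⟩ := h2 _ ((hI _).2 hf)
    exact ⟨p, hp, hs, (factAt_iff hr hq).2 rfl⟩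
  · obtain ⟨p, hp, hs, r, hr⟩ := h2 f ((hI f).2 hf)
    obtain ⟨x, hx, -, hd⟩ := argPos_of_drop hr i
    exact ⟨x, hx, hd⟩

namespace Dfn
variable {C : IMdl S Cst → Prop} {d : ℕ} {β : Bool}

theorem argPos (i : ℕ) : ∀ {d : ℕ} (p x : Fin d), Dfn C fun M ρ => ArgPos M.w (ρ p) i (ρ x) := by
  induction i with
  | zero => exact fun p x => .succ _ _
  | succ i ih =>
    intro d p x
    exact .ex (.and (ih _ _) (.ex (.and (.le _ _) (.and (.letter _ _) (.and
      (.all (.imp (.le _ _) (.imp (.lt _ _) (.not (.letter _ _))))) (.succ _ _))))))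

end Dfn

theorem dfnInst_wordInst {C : IMdl S Cst → Prop} {β : Bool} (hC : ∀ M, C M → M.AuxOK β) (b : Bool) :
    DfnInst C fun M => wordInst b M.w := fun _ _ _ =>
  .ex (.and (.iff (.ex (.and (.lt _ _) (.letter _ _))) (.const _)) (.and (.letter _ _)
    (.forall_finite fun i => .ex (.and (.argPos i _ _) (.sameVal hC _ _ _)))))

end

/-! ### Guessed instances and their comparison -/

section
variable {S : Schema} {Cst : Type}

/-- The guessed instance. -/
def soInst (b : Bool) (M : IMdl S Cst) : PosInst S := fun R q => M.so b (.inr R) q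

/-- The guessed relations do not distinguish between positions of the same constant. -/
def SoInv (b : Bool) (M : IMdl S Cst) : Prop := ∀ R, ∀ q : Fin (S.arity R) → ℕ,
  (∀ i, q i < M.w.length) → ∀ q' : Fin (S.arity R) → ℕ, (∀ i, q' i < M.w.length) →
    (∀ i, SameVal M.w (S.sort R i) (q i) (q' i)) → (soInst b M R q ↔ soInst b M R q')

/-- The relations on positions given by an instance. -/
def posInst (w : List (Ltr S Cst)) (J : Instance S) : PosInst S := fun R q =>
  ∃ a, ArgsAt w R q a ∧ (⟨R, a⟩ : Fact S) ∈ J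

variable {w : List (Ltr S Cst)}

theorem ArgsAt.unique {R : S.Rel} {q : Fin (S.arity R) → ℕ}
    {a a' : (i : Fin (S.arity R)) → Dom (S.sort R i)} (h : ArgsAt w R q a) (h' : ArgsAt w R q a') :
    a = a' := funext fun i => (h i).2.unique (h' i).2

theorem represents_posInst {J : Instance S} (hJ : Over w J) : Represents w (posInst w J) J := by
  refine ⟨fun R q a hq => ⟨?_, fun h => ⟨a, hq, h⟩⟩, hJ⟩
  rintro ⟨a', hq', h⟩
  rwa [hq.unique hq']

theorem soInv_of_eq {b : Bool} {M : IMdl S Cst} {J : Instance S}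
    (h : ∀ R, M.so b (.inr R) = posInst M.w J R) : SoInv b M := by
  have key : ∀ R (q q' : Fin (S.arity R) → ℕ), (∀ i, q' i < M.w.length) →
      (∀ i, SameVal M.w (S.sort R i) (q i) (q' i)) → posInst M.w J R q → posInst M.w J R q' := by
    rintro R q q' hq' hs ⟨a, ha, hf⟩
    refine ⟨a, fun i => ⟨hq' i, ?_⟩, hf⟩
    obtain ⟨c, h1, h2⟩ := hs i
    rwa [(ha i).2.unique h1]
  intro R q hq q' hq' hs
  unfold soInst
  rw [h]
  exact ⟨key R q q' hq' hs, key R q' q hq fun i => (hs i).imp fun _ h => h.symm⟩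

/-- The instance collects the facts denoted by the guessed tuples. It is finite because there are
finitely many relation names and tuples of positions; by invariance, whether a tuple is in the
relation depends only on the fact it denotes. -/
theorem exists_represents {b : Bool} {M : IMdl S Cst} (h : SoInv b M) :
    ∃ J, Represents M.w (soInst b M) J := by
  have hR := S.finite_rel
  have hfin : {f : Fact S | ∃ q, ArgsAt M.w f.rel q f.args ∧ soInst b M f.rel q}.Finite := by
    refine Set.Finite.subset (s := ⋃ x : (Σ R : S.Rel, (Fin (S.arity R) → Fin M.w.length)),
      {f : Fact S | ∃ e : f.rel = x.1, ArgsAt M.w x.1 (fun i => x.2 i) (e ▸ f.args)})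
      (Set.finite_iUnion fun x => Set.Subsingleton.finite ?_) ?_
    · rintro ⟨R, a⟩ ⟨e, ha⟩ ⟨R', a'⟩ ⟨e', ha'⟩
      dsimp only at e e'
      subst e
      subst e'
      rw [show a = a' from ArgsAt.unique ha ha']
    · rintro f ⟨q, hq, -⟩
      exact Set.mem_iUnion.2 ⟨⟨f.rel, fun i => ⟨q i, (hq i).1⟩⟩, rfl, hq⟩
  refine ⟨hfin.toFinset, fun R q a hq => ?_, fun f hf i => ?_⟩
  · rw [Set.Finite.mem_toFinset]
    constructor
    · exact fun h => ⟨q, hq, h⟩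
    · rintro ⟨q', hq', h'⟩
      exact (h R q (fun i => (hq i).1) q' (fun i => (hq' i).1)
        fun i => ⟨a i, (hq i).2, (hq' i).2⟩).2 h'
  · rw [Set.Finite.mem_toFinset] at hf
    obtain ⟨q, hq, -⟩ := hf
    exact ⟨q i, hq i⟩

/-- The comparison of instances, in terms of positions. -/
def PosProxLE (w : List (Ltr S Cst)) (Ip Jp Jp' : PosInst S) : Prop :=
  ∀ R, ∀ q : Fin (S.arity R) → ℕ, (∀ i, q i < w.length) → (∀ i, Good w (S.sort R i) (q i)) →
    ((Ip R q ∧ ¬ Jp R q) ∨ (Jp R q ∧ ¬ Ip R q)) → ((Ip R q ∧ ¬ Jp' R q) ∨ (Jp' R q ∧ ¬ Ip R q))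

def PosEq (w : List (Ltr S Cst)) (Jp Jp' : PosInst S) : Prop :=
  ∀ R, ∀ q : Fin (S.arity R) → ℕ, (∀ i, q i < w.length) → (∀ i, Good w (S.sort R i) (q i)) →
    (Jp R q ↔ Jp' R q)

theorem Over.exists_argsAt {J : Instance S} (hJ : Over w J) {f : Fact S} (hf : f ∈ J) :
    ∃ q, ArgsAt w f.rel q f.args := by
  choose q hq using hJ f hf
  exact ⟨q, hq⟩

/-- A fact of `Δ(I, J)` belongs to `I` or to `J`, so its arguments occur in the word and
quantification over positions reaches it. -/
theorem posProxLE_iff {Ip Jp Jp' : PosInst S} {I J J' : Instance S} (hI : Represents w Ip I)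
    (hJ : Represents w Jp J) (hJ' : Represents w Jp' J') :
    PosProxLE w Ip Jp Jp' ↔ ProxLE I J J' := by
  constructor
  · intro h f hf
    obtain ⟨q, hq⟩ : ∃ q, ArgsAt w f.rel q f.args := by
      rcases hf with hf | hf
      · exact hI.occurs.exists_argsAt hf.1
      · exact hJ.occurs.exists_argsAt hf.1
    have := h f.rel q (fun i => (hq i).1) (fun i => ⟨_, (hq i).2⟩)
    rw [hI.iff _ _ _ hq, hJ.iff _ _ _ hq, hJ'.iff _ _ _ hq] at this
    exact this hf
  · intro h R q hq hg
    choose a ha using hg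
    have hq : ArgsAt w R q a := fun i => ⟨hq i, ha i⟩
    rw [hI.iff _ _ _ hq, hJ.iff _ _ _ hq, hJ'.iff _ _ _ hq]
    exact fun hf => h hf

theorem posEq_iff {Jp Jp' : PosInst S} {J J' : Instance S} (hJ : Represents w Jp J)
    (hJ' : Represents w Jp' J') : PosEq w Jp Jp' ↔ J = J' := by
  constructor
  · intro h
    have key : ∀ f q, ArgsAt w f.rel q f.args → (f ∈ J ↔ f ∈ J') := by
      intro f q hq
      have := h f.rel q (fun i => (hq i).1) (fun i => ⟨_, (hq i).2⟩)
      rwa [hJ.iff _ _ _ hq, hJ'.iff _ _ _ hq] at this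
    ext f
    constructor
    · intro hf
      obtain ⟨q, hq⟩ := hJ.occurs.exists_argsAt hf
      exact (key f q hq).1 hf
    · intro hf
      obtain ⟨q, hq⟩ := hJ'.occurs.exists_argsAt hf
      exact (key f q hq).2 hf
  · rintro rfl R q hq hg
    choose a ha using hg
    have hq : ArgsAt w R q a := fun i => ⟨hq i, ha i⟩
    rw [hJ.iff _ _ _ hq, hJ'.iff _ _ _ hq]

section
variable {C : IMdl S Cst → Prop} {β : Bool} {d : ℕ}

theorem dfnInst_soInst (b : Bool) : DfnInst C (soInst b) := fun _ R f =>
  Dfn.so (Λ := Ltr S Cst) (X := GRel S) (ar := GRel.arity S) b (Sum.inr R) f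

theorem Dfn.soInv (hC : ∀ M, C M → M.AuxOK β) (b : Bool) : Dfn C (d := d) fun M _ => SoInv b M := by
  have := S.finite_rel
  exact .forall_finite fun R => .allTuple (.allTuple (.imp (.forall_finite fun i =>
    .sameVal hC _ _ _) (.iff (dfnInst_soInst b _ _ _) (dfnInst_soInst b _ _ _))))

theorem Dfn.posProxLE (hC : ∀ M, C M → M.AuxOK β) {Ip Jp Jp' : IMdl S Cst → PosInst S}
    (hI : DfnInst C Ip) (hJ : DfnInst C Jp) (hJ' : DfnInst C Jp') :
    Dfn C (d := d) fun M _ => PosProxLE M.w (Ip M) (Jp M) (Jp' M) := by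
  have := S.finite_rel
  exact .forall_finite fun R => .allTuple (.imp (.forall_finite fun i => .good hC _ _) (.imp
    (.or (.and (hI _ _ _) (.not (hJ _ _ _))) (.and (hJ _ _ _) (.not (hI _ _ _))))
    (.or (.and (hI _ _ _) (.not (hJ' _ _ _))) (.and (hJ' _ _ _) (.not (hI _ _ _))))))

theorem Dfn.posEq (hC : ∀ M, C M → M.AuxOK β) {Jp Jp' : IMdl S Cst → PosInst S}
    (hJ : DfnInst C Jp) (hJ' : DfnInst C Jp') :
    Dfn C (d := d) fun M _ => PosEq M.w (Jp M) (Jp' M) := by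
  have := S.finite_rel
  exact .forall_finite fun R => .allTuple (.imp (.forall_finite fun i => .good hC _ _) (.iff
    (hJ _ _ _) (hJ' _ _ _)))

theorem Dfn.consistent [Finite Cst] {val : Cst → Σ s, Dom s} (hC : ∀ M, C M → Ctx val β M)
    {Jp : IMdl S Cst → PosInst S} (hJp : DfnInst C Jp) (F : Finset (UniversalConstraint S))
    (hF : ∀ c ∈ F, c.toFormula.consts ⊆ Set.range val) :
    ∃ P : IMdl S Cst → Prop, Dfn C (d := d) (fun M _ => P M) ∧
      ∀ M, C M → ∀ J, Represents M.w (Jp M) J → (P M ↔ Consistent F J) := by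
  choose! P hP hP' using fun c hc => Dfn.holds (d := d) hC hJp (hF c hc)
  refine ⟨fun M => ∀ c ∈ F.toList, P c M, Dfn.list_all _ fun c hc => hP c (by simpa using hc),
    fun M hM J hJ => ?_⟩
  simp only [Finset.mem_toList]
  exact forall₂_congr fun c hc => (hP' c hc M hM J hJ).trans (c.holds_toFormula J)

end

/-! ### The constants that occur in repairs -/

theorem ProxLE.mem_or_mem {I J J' : Instance S} (h : ProxLE I J J') {f : Fact S} (hf : f ∈ J) :
    f ∈ I ∨ f ∈ J' := by
  by_cases hI : f ∈ I
  · exact .inl hI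
  · rcases h (.inr ⟨hf, hI⟩) with h | h
    · exact (hI h.1).elim
    · exact .inr h.1

/-- Indeed `J ⊆ I ∪ J'`. So every competitor of a candidate repair can be guessed by relations on
positions. -/
theorem Over.of_proxLE {I J J' : Instance S} (hI : Over w I) (hJ' : Over w J') (h : ProxLE I J J') :
    Over w J := by
  intro f hf
  rcases h.mem_or_mem hf with hf | hf
  · exact hI f hf
  · exact hJ' f hf

open Classical in
/-- A repair of `I` contains only constants of `I`. -/
theorem IsRepair.over {F : Finset (UniversalConstraint S)} {I I' : Instance S}
    (h : IsRepair F I I') (hI : Over w I) : Over w I' := by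
  have hsub : ∀ f, f ∈ I'.filter (fun f => ∀ i, ∃ p < w.length, Den w (S.sort f.rel i) p (f.args i))
      ↔ f ∈ I' ∧ ∀ i, ∃ p < w.length, Den w (S.sort f.rel i) p (f.args i) :=
    fun f => Finset.mem_filter
  -- The facts removed from `I'` are not in `I`, so `J` is at most as far from `I`. If `J` is
  -- consistent, minimality of `I'` forces `J = I'`.
  set J := I'.filter (fun f => ∀ i, ∃ p < w.length, Den w (S.sort f.rel i) p (f.args i))
  suffices e : J = I' by
    intro f hf
    rw [← e] at hf
    exact ((hsub f).1 hf).2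
  by_contra hne
  refine h.2 ⟨J, fun c hc v hv => ?_, ?_, hne⟩
  · refine h.1 c hc v ⟨fun R hR => ((hsub _).1 (hv.1 R hR)).1, fun P hP hmem => hv.2.1 P hP ?_, hv.2.2⟩
    refine (hsub _).2 ⟨hmem, fun i => ?_⟩
    -- Here safety enters: each variable of a negated atom occurs in a positive one, whose ground
    -- instance is in `J`, so its value occurs in the word. Hence a ground negated atom that is in
    -- `I'` survives in `J`, and deletion creates no violation.
    obtain ⟨R, hR, k, hk⟩ : ∃ R ∈ c.pos, (⟨S.sort P.rel i, P.idx i⟩ : Var) ∈ R.vars := by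
      simpa only [Set.mem_iUnion, exists_prop] using c.safe_neg P hP ⟨i, rfl⟩
    obtain ⟨p, hp, hd⟩ := ((hsub _).1 (hv.1 R hR)).2 k
    refine ⟨p, hp, ?_⟩
    have key : ∀ x y : Var, x = y → Den w x.sort p (v x) → Den w y.sort p (v y) := by
      rintro x _ rfl h
      exact h
    exact key _ _ hk hd
  · rintro f (⟨h1, h2⟩ | ⟨h1, h2⟩)
    · exact .inl ⟨h1, fun h3 => h2 ((hsub f).2 ⟨h3, hI f h1⟩)⟩
    · exact .inr ⟨((hsub f).1 h1).1, h2⟩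

end

/-! ### Membership in the complexity classes -/

section
variable {S : Schema}

instance [Finite S.Rel] : Finite (Sym S) :=
  Finite.of_injective (β := S.Rel ⊕ Bool ⊕ Fin 4)
    (fun
      | .rel R => .inl R
      | .bit b => .inr (.inl b)
      | .minus => .inr (.inr 0)
      | .slash => .inr (.inr 1)
      | .endMark => .inr (.inr 2)
      | .sep => .inr (.inr 3))
    (by rintro (_ | _ | _ | _ | _ | _) (_ | _ | _ | _ | _ | _) <;> simp)

/-- A constant of each type is added to those of the formulas, so that places exist even when
neither the instance nor the formulas provide any constant. -/
theorem exists_constants (l : List (Formula S)) : ∃ (Cst : Type) (_ : Finite Cst)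
    (val : Cst → Σ s, Dom s), (∀ φ ∈ l, φ.consts ⊆ Set.range val) ∧ ∀ s, ∃ k, (val k).1 = s := by
  have hfin : ((⋃ φ ∈ {φ | φ ∈ l}, φ.consts) ∪ Set.range fun s : Srt =>
      (⟨s, (rank s).symm 0⟩ : Σ s, Dom s)).Finite := by
    have : Finite Srt := Finite.of_injective (β := Bool)
      (fun | .rat => true | .name => false) (by rintro (_ | _) (_ | _) <;> simp)
    exact (Set.Finite.biUnion (List.finite_toSet l) fun φ _ => φ.finite_consts).union
      (Set.finite_range _)
  refine ⟨_, hfin.to_subtype, Subtype.val, fun φ hφ => ?_, fun s => ⟨⟨_, .inr ⟨s, rfl⟩⟩, rfl⟩⟩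
  rw [Subtype.range_coe]
  exact fun c hc => .inl (Set.mem_biUnion (show φ ∈ {φ | φ ∈ l} from hφ) hc)

variable {Cst : Type} {val : Cst → Σ s, Dom s} {L : List Cst} {β : Bool}

/-- The models over words that list facts, with correct auxiliary relations. -/
def ListsFacts (val : Cst → Σ s, Dom s) (L : List Cst) (M : IMdl S Cst) : Prop :=
  ∃ l l' j, M.w = instWord val L l l' j

theorem ListsFacts.ctx {M : IMdl S Cst} (h : ListsFacts val L M) (h' : M.AuxOK β)
    (hL : ∀ k, k ∈ L) (hval : ∀ s, ∃ k, (val k).1 = s) : Ctx val β M := by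
  obtain ⟨l, l', j, hw⟩ := h
  have hm : Marked val M.w := by
    rw [hw]
    exact marked_instWord hL
  refine ⟨h', hm, fun s => ?_⟩
  obtain ⟨k, rfl⟩ := hval s
  obtain ⟨⟨m, hm1⟩, hm2⟩ := hm k
  exact ⟨_, m + 1, rankAt_rank.2 (hm2 m hm1)⟩

end

section
variable {S : Schema}

theorem instWord_eq_append {Cst : Type} (val : Cst → Σ s, Dom s) (L : List Cst)
    (l l' : List (Fact S)) : instWord val L l l' 2 =
      (encodeFacts l ++ Sym.sep :: encodeFacts l').map .inl ++
        .inl .sep :: .inl .sep :: markList val L := by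
  simp [instWord, List.replicate]

/-- With a single instance, the first appended separator plays the role of the one between the two
lists, and the second list is empty. Two separators make the suffix longer than one letter, as the
coding of tuples requires. -/
theorem instWord_nil_eq_append {Cst : Type} (val : Cst → Σ s, Dom s) (L : List Cst)
    (l : List (Fact S)) : instWord val L l [] 1 =
      (encodeFacts l).map .inl ++ .inl .sep :: .inl .sep :: markList val L := by
  simp [instWord, List.replicate, encodeFacts]

/-- Guessed relations: the intended auxiliary relations and the instance `J`. -/
def guessedRels {Cst : Type} (w : List (Ltr S Cst)) (J : Instance S) :
    Rels (GRel S) (GRel.arity S)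
  | .inl x => auxRels w x
  | .inr R => posInst w J R

/-- The sentence requires correct auxiliary relations and says that `I'` violates `F` or that the
guessed relations form a consistent instance different from `I'` and at most as far from `I`. -/
theorem repairChecking_inCoNP (F : Finset (UniversalConstraint S)) :
    InCoNP RepresentsPair (repairChecking F) := by
  have := S.finite_rel
  obtain ⟨Cst, hfin, val, hF, hval⟩ := exists_constants (F.toList.map UniversalConstraint.toFormula)
  have hF : ∀ c ∈ F, c.toFormula.consts ⊆ Set.range val := fun c hc =>
    hF _ (List.mem_map_of_mem (by simpa using hc))
  obtain ⟨L, hL⟩ : ∃ L : List Cst, ∀ k, k ∈ L := by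
    have := Fintype.ofFinite Cst
    exact ⟨Finset.univ.toList, by simp⟩
  set C : IMdl S Cst → Prop := fun M => ListsFacts val L M ∧ M.AuxOK true with hC
  have hctx : ∀ M, C M → Ctx val true M := fun M hM => hM.1.ctx hM.2 hL hval
  have haux : ∀ M, C M → M.AuxOK true := fun M hM => hM.2
  have hw := fun b => dfnInst_wordInst haux b
  have hs : DfnInst C (soInst true) := dfnInst_soInst true
  obtain ⟨P, hP, hP'⟩ := Dfn.consistent (d := 0) hctx (hw true) F hF
  obtain ⟨P', hPs, hPs'⟩ := Dfn.consistent (d := 0) hctx hs F hF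
  obtain ⟨φ, hφ⟩ := Dfn.and_of_weaken (Dfn.auxOK (C := ListsFacts val L) (d := 0) true)
    (.or hP.not (.and (.soInv haux true) (.and hPs (.and
      (.posProxLE haux (hw false) hs (hw true)) (.not (.posEq haux hs (hw true)))))))
  obtain ⟨A, hA, hA'⟩ := mem_NP_of_fml (ι := (Sum.inl : Sym S → Ltr S Cst)) Sum.inl_injective
    (.inl .sep :: .inl .sep :: markList val L) (by simp) φ
  refine ⟨A, hA, ?_⟩
  rintro w ⟨I, I'⟩ ⟨_, _, ⟨l, hl, rfl⟩, ⟨l', hl', rfl⟩, rfl⟩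
  rw [hA', ← instWord_eq_append]
  set W := instWord val L l l' 2 with hW
  have hI : Represents W (wordInst false W) I := represents_wordInst false hl
  have hI' : Represents W (wordInst true W) I' := represents_wordInst true hl'
  have hlist : ∀ G H, ListsFacts val L (mdl W G H : IMdl S Cst) := fun G H => ⟨l, l', 2, rfl⟩
  have hiff : ∀ H, _ ↔ _ := fun H => hφ (mdl W (fun _ _ => False) H) (hlist _ H) Fin.elim0
    fun i => i.elim0
  simp only [hiff]
  show _ ↔ ¬ IsRepair F I I'
  rw [IsRepair, not_and_or, not_not]
  constructor
  · rintro ⟨H, hax, h⟩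
    set M : IMdl S Cst := mdl W (fun _ _ => False) H with hM
    have hCM : C M := ⟨hlist _ H, hax⟩
    rw [hP' M hCM I' hI'] at h
    refine h.imp_right ?_
    rintro ⟨hinv, hcons, hle, hne⟩
    obtain ⟨J, hJ⟩ := exists_represents hinv
    exact ⟨J, (hPs' M hCM J hJ).1 hcons, (posProxLE_iff hI hJ hI').1 hle,
      fun e => hne ((posEq_iff hJ hI').2 e)⟩
  · intro h
    by_cases hcons : Consistent F I'
    · obtain ⟨J, h1, h2, h3⟩ := h.resolve_left (not_not.2 hcons)
      have hover : Over W J := hI.occurs.of_proxLE hI'.occurs h2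
      set M : IMdl S Cst := mdl W (fun _ _ => False) (guessedRels W J) with hM
      have hax : M.AuxOK true := auxOK_of_eq fun _ => rfl
      have hCM : C M := ⟨hlist _ _, hax⟩
      have hJ : Represents M.w (soInst true M) J := represents_posInst hover
      exact ⟨guessedRels W J, hax, .inr ⟨soInv_of_eq (J := J) fun _ => rfl,
        (hPs' M hCM J hJ).2 h1, (posProxLE_iff hI hJ hI').2 h2,
        fun e => h3 ((posEq_iff hJ hI').1 e)⟩⟩
    -- If `I'` itself is inconsistent, only the auxiliary relations matter, and the guessed instance
    -- is a dummy.
    · set M : IMdl S Cst := mdl W (fun _ _ => False) (guessedRels W ∅) with hM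
      have hax : M.AuxOK true := auxOK_of_eq fun _ => rfl
      have hCM : C M := ⟨hlist _ _, hax⟩
      exact ⟨guessedRels W ∅, hax, .inl fun h => hcons ((hP' M hCM I' hI').1 h)⟩

/-- The outer guess `G` codes a consistent candidate falsifying `Q` together with the auxiliary
relations; the inner `H` ranges over the competitors. The auxiliary relations in `G` serve for both,
and those in `H` are ignored. -/
theorem consistentQueryAnswering_inPiTwo (F : Finset (UniversalConstraint S)) {Q : Formula S}
    (hQ : Q.IsClosed) : InPiTwo RepresentsInstance (consistentQueryAnswering F Q) := by
  have := S.finite_rel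
  obtain ⟨Cst, hfin, val, hF, hval⟩ :=
    exists_constants (Q :: F.toList.map UniversalConstraint.toFormula)
  have hQc : Q.consts ⊆ Set.range val := hF Q (by simp)
  have hF : ∀ c ∈ F, c.toFormula.consts ⊆ Set.range val := fun c hc =>
    hF _ (List.mem_cons_of_mem _ (List.mem_map_of_mem (by simpa using hc)))
  obtain ⟨L, hL⟩ : ∃ L : List Cst, ∀ k, k ∈ L := by
    have := Fintype.ofFinite Cst
    exact ⟨Finset.univ.toList, by simp⟩
  set C : IMdl S Cst → Prop := fun M => ListsFacts val L M ∧ M.AuxOK false with hC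
  have hctx : ∀ M, C M → Ctx val false M := fun M hM => hM.1.ctx hM.2 hL hval
  have haux : ∀ M, C M → M.AuxOK false := fun M hM => hM.2
  have hw := dfnInst_wordInst haux false
  have hs : ∀ b, DfnInst C (soInst b) := dfnInst_soInst
  obtain ⟨P, hP, hP'⟩ := Dfn.consistent (d := 0) hctx (hs false) F hF
  obtain ⟨P', hPs, hPs'⟩ := Dfn.consistent (d := 0) hctx (hs true) F hF
  obtain ⟨PQ, hPQ, hPQ'⟩ := Dfn.holds_of_closed (d := 0) hctx (hs false) hQ hQc
  obtain ⟨φ, hφ⟩ := Dfn.and_of_weaken (Dfn.auxOK (C := ListsFacts val L) (d := 0) false)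
    (.and (.soInv haux false) (.and hP (.and hPQ.not (.imp (.and (.soInv haux true) (.and hPs
      (.posProxLE haux hw (hs true) (hs false)))) (.posEq haux (hs true) (hs false))))))
  obtain ⟨A, hA, hA'⟩ := mem_NPwithNPOracle_of_fml (ι := (Sum.inl : Sym S → Ltr S Cst))
    Sum.inl_injective (.inl .sep :: .inl .sep :: markList val L) (by simp) φ
  refine ⟨A, hA, ?_⟩
  rintro w I ⟨l, hl, rfl⟩
  rw [hA', ← instWord_nil_eq_append]
  set W := instWord val L l [] 1 with hW
  have hI : Represents W (wordInst false W) I := represents_wordInst false hl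
  have hlist : ∀ G H, ListsFacts val L (mdl W G H : IMdl S Cst) := fun G H => ⟨l, [], 1, rfl⟩
  have hiff : ∀ G H, _ ↔ _ := fun G H => hφ (mdl W G H) (hlist G H) Fin.elim0 fun i => i.elim0
  simp only [hiff]
  show _ ↔ ¬ ∀ I', IsRepair F I I' → Holds I' Q
  push Not
  constructor
  · rintro ⟨G, h⟩
    -- The conjuncts about `G` alone do not depend on `H`, so they are read off for the empty `H`.
    have hrep : ∃ I', Represents W (soInst false (mdl W G fun _ _ => False)) I' :=
      exists_represents (h fun _ _ => False).2.1
    obtain ⟨I', hI'⟩ := hrep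
    have hCM : ∀ H, C (mdl W G H) := fun H => ⟨hlist G H, (h H).1⟩
    have hI' : ∀ H, Represents W (soInst false (mdl W G H)) I' := fun _ => hI'
    obtain ⟨-, -, hcons, hnQ, -⟩ := h fun _ _ => False
    refine ⟨I', ⟨(hP' _ (hCM _) I' (hI' _)).1 hcons, ?_⟩,
      fun h => hnQ ((hPQ' _ (hCM _) I' (hI' _)).2 h)⟩
    rintro ⟨J, h1, h2, h3⟩
    -- An arbitrary competitor is within reach of the quantifier over `H`, since it uses only
    -- constants of the word.
    have hover : Over W J := hI.occurs.of_proxLE (hI' fun _ _ => False).occurs h2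
    set M : IMdl S Cst := mdl W G (guessedRels W J) with hM
    have hJ : Represents M.w (soInst true M) J := represents_posInst hover
    refine h3 ((posEq_iff hJ (hI' _)).1 ((h (guessedRels W J)).2.2.2.2
      ⟨soInv_of_eq (J := J) fun _ => rfl, (hPs' M (hCM _) J hJ).2 h1,
        (posProxLE_iff hI hJ (hI' _)).2 h2⟩))
  · rintro ⟨I', hrep, hnQ⟩
    have hover : Over W I' := hrep.over hI.occurs
    refine ⟨guessedRels W I', fun H => ?_⟩
    set M : IMdl S Cst := mdl W (guessedRels W I') H with hM
    have hax : M.AuxOK false := auxOK_of_eq fun _ => rfl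
    have hCM : C M := ⟨hlist _ _, hax⟩
    have hI' : Represents M.w (soInst false M) I' := represents_posInst hover
    refine ⟨hax, soInv_of_eq (J := I') fun _ => rfl, (hP' M hCM I' hI').2 hrep.1,
      fun h => hnQ ((hPQ' M hCM I' hI').1 h), ?_⟩
    rintro ⟨hinv, hcons, hle⟩
    obtain ⟨J, hJ⟩ := exists_represents hinv
    refine (posEq_iff hJ hI').2 ?_
    by_contra hne
    exact hrep.2 ⟨J, (hPs' M hCM J hJ).1 hcons, (posProxLE_iff hI hJ hI').1 hle, hne⟩

end

end CQA

theorem mainTheorem9 (S : CQA.Schema) (F : Finset (CQA.UniversalConstraint S)) :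
    CQA.InCoNP CQA.RepresentsPair (CQA.repairChecking F) ∧
      ∀ Q : CQA.Formula S, Q.IsClosed →
        CQA.InPiTwo CQA.RepresentsInstance (CQA.consistentQueryAnswering F Q) :=
  ⟨CQA.repairChecking_inCoNP F, fun _ hQ => CQA.consistentQueryAnswering_inPiTwo F hQ⟩
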